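/- **Conventions.** All tensor products of C*-algebras are minimal (spatial) ones, $M(A)$ is the multiplier algebra of $A$, and $I$ is the unit of $M(A)$. A pair $(A,\Delta)$ is a *C\*-bialgebra* if $A$ is a C*-algebra and $\Delta:A\to M(A\otimes A)$ is a $*$-homomorphism such that the linear span of $\{\Delta(a)(b\otimes c):a,b,c\in A\}$ is norm dense in $A\otimes A$ and $(\Delta\otimes \mathrm{id})\circ\Delta=(\mathrm{id}\otimes\Delta)\circ\Delta$, where $\Delta\otimes\mathrm{id}$ and $\mathrm{id}\otimes\Delta$ are extended to unital $*$-homomorphisms from $M(A\otimes A)$ to $M(A\otimes A\otimes A)$. It is *cocommutative* if $\Delta$ is invariant under (the extension to $M(A\otimes A)$ of) the flip automorphism $a\otimes b\mapsto b\otimes a$. A *counit* is a $*$-homomorphism $\varepsilon:A\to\mathbb{C}$ with $(\varepsilon\otimes\mathrm{id})\circ\Delta=\mathrm{id}=(\mathrm{id}\otimes\varepsilon)\circ\Delta$. The pair is *proper* if $\Delta(a)(I\otimes b)\in A\otimes A$ and $(b\otimes I)\Delta(a)\in A\otimes A$ for all $a,b\in A$. A proper C*-bialgebra satisfies the *cancellation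 law* if the linear spans of $\{\Delta(a)(I\otimes b):a,b\in A\}$ and of $\{\Delta(a)(b\otimes I):a,b\in A\}$ are dense subspaces of $A\otimes A$. **The algebra.** Let $S$ be the set of all sequences $\mathbf a=(a_1,a_2,\ldots)$ of integers $a_i\ge 2$ together with the constant sequence $\mathbf 1=(1,1,\ldots)$; it is a commutative monoid under componentwise multiplication $\mathbf a\cdot\mathbf b=(a_1b_1,a_2b_2,\ldots)$. For $\mathbf a\in S$, $\mathbf a\neq\mathbf 1$, let $\mathcal A(\mathbf a)$ be the UHF algebra $\varinjlim_n \mathcal A_n(\mathbf a)$, where $\mathcal A_n(\mathbf a)=M_{a_1}(\mathbb{C})\otimes\cdots\otimes M_{a_n}(\mathbb{C})$ is embedded in $\mathcal A_{n+1}(\mathbf a)$ by $x\mapsto x\otimes I$, and let $\mathcal A(\mathbf 1)=\mathbb{C}$. Let $$\mathcal A(*)=\bigoplus_{\mathbf a\in S}\mathcal A(\mathbf a)$$ be the C*-algebra ($c_0$-)direct sum, i.e. all families $(x_{\mathbf a})_{\mathbf a\in S}$, $x_{\mathbf a}\in\mathcal A(\mathbf a)$, such that for every $\delta>0$ one has $\|x_{\mathbf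 a}\|\ge\delta$ for only finitely many $\mathbf a$. **The comultiplication.** For $\mathbf b,\mathbf c\in S\setminus\{\mathbf 1\}$ let $\varphi_{\mathbf b,\mathbf c}:\mathcal A(\mathbf b\cdot\mathbf c)\to\mathcal A(\mathbf b)\otimes\mathcal A(\mathbf c)$ be the $*$-isomorphism given on matrix units by $$\varphi_{\mathbf b,\mathbf c}\bigl(E^{(b_1c_1)}_{j_1,k_1}\otimes\cdots\otimes E^{(b_nc_n)}_{j_n,k_n}\bigr)=\bigl(E^{(b_1)}_{j_1',k_1'}\otimes\cdots\otimes E^{(b_n)}_{j_n',k_n'}\bigr)\otimes\bigl(E^{(c_1)}_{j_1'',k_1''}\otimes\cdots\otimes E^{(c_n)}_{j_n'',k_n''}\bigr),$$ where $j_i=c_i(j_i'-1)+j_i''$, $k_i=c_i(k_i'-1)+k_i''$ with $j_i',k_i'\in\{1,\ldots,b_i\}$ and $j_i'',k_i''\in\{1,\ldots,c_i\}$. For $\mathbf a\in S$ put $\varphi_{\mathbf 1,\mathbf a}(x)=1\otimes x$ and $\varphi_{\mathbf a,\mathbf 1}(x)=x\otimes 1$. Since $\mathcal A(*)\otimes\mathcal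 A(*)=\bigoplus_{(\mathbf b,\mathbf c)\in S\times S}\mathcal A(\mathbf b)\otimes\mathcal A(\mathbf c)$, every bounded family in $\prod_{(\mathbf b,\mathbf c)}\mathcal A(\mathbf b)\otimes\mathcal A(\mathbf c)$ is a multiplier of $\mathcal A(*)\otimes\mathcal A(*)$. Define $$\Delta_\varphi:\mathcal A(*)\to M(\mathcal A(*)\otimes\mathcal A(*)),\qquad \Delta_\varphi(x)=\bigl(\varphi_{\mathbf b,\mathbf c}(x_{\mathbf b\cdot\mathbf c})\bigr)_{(\mathbf b,\mathbf c)\in S\times S},$$ and let $\varepsilon:\mathcal A(*)\to\mathcal A(\mathbf 1)=\mathbb{C}$, $\varepsilon(x)=x_{\mathbf 1}$, be the projection. **Theorem.** 1. $(\mathcal A(*),\Delta_\varphi)$ is a non-cocommutative proper C*-bialgebra with counit $\varepsilon$. 2. $(\mathcal A(*),\Delta_\varphi)$ satisfies the cancellation law. -/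

import Mathlib

open scoped TensorProduct ENNReal ComplexOrder MultiplierAlgebra InnerProductSpace

noncomputable section HilbertTensor

variable {H K : Type*} [NormedAddCommGroup H] [InnerProductSpace ℂ H] [CompleteSpace H]
  [NormedAddCommGroup K] [InnerProductSpace ℂ K] [CompleteSpace K]

/-- The Hilbert space tensor product of `H` and `K`. -/
abbrev HilbertTensor (H K : Type*) [NormedAddCommGroup H] [InnerProductSpace ℂ H]
    [NormedAddCommGroup K] [InnerProductSpace ℂ K] : Type _ :=
  UniformSpace.Completion (H ⊗[ℂ] K)

theorem inner_map_tensor (T : H →L[ℂ] H) (S : K →L[ℂ] K) (x y : H ⊗[ℂ] K) :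
    ⟪TensorProduct.map (T : H →ₗ[ℂ] H) (S : K →ₗ[ℂ] K) x, y⟫_ℂ =
      ⟪x, TensorProduct.map ((star T : H →L[ℂ] H) : H →ₗ[ℂ] H)
        ((star S : K →L[ℂ] K) : K →ₗ[ℂ] K) y⟫_ℂ := by
  induction x with
  | zero => simp
  | add a b ha hb => simp only [map_add, inner_add_left, ha, hb]
  | tmul a b =>
    induction y with
    | zero => simp
    | add c d hc hd => simp only [map_add, inner_add_right, hc, hd]
    | tmul c d =>
      simp [TensorProduct.inner_tmul, ContinuousLinearMap.star_eq_adjoint,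
        ContinuousLinearMap.adjoint_inner_right]

theorem norm_rTensor_le (T : H →L[ℂ] H) (x : H ⊗[ℂ] K) :
    ‖TensorProduct.map (T : H →ₗ[ℂ] H) (LinearMap.id : K →ₗ[ℂ] K) x‖ ≤ ‖T‖ * ‖x‖ := by
  have h0 : (0 : H →L[ℂ] H) ≤ algebraMap ℝ _ (‖T‖ ^ 2) - star T * T := by
    have := CStarAlgebra.star_mul_le_algebraMap_norm_sq (a := T)
    exact sub_nonneg.2 this
  obtain ⟨R, hR⟩ := (CStarAlgebra.nonneg_iff_eq_star_mul_self).1 h0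
  have key : ∀ U : H →L[ℂ] H, (‖TensorProduct.map (U : H →ₗ[ℂ] H) (LinearMap.id : K →ₗ[ℂ] K) x‖ : ℂ) ^ 2
      = ⟪x, TensorProduct.map ((star U * U : H →L[ℂ] H) : H →ₗ[ℂ] H)
        (LinearMap.id : K →ₗ[ℂ] K) x⟫_ℂ := by
    intro U
    have h1 := inner_map_tensor (K := K) U 1 x (TensorProduct.map (U : H →ₗ[ℂ] H) (LinearMap.id : K →ₗ[ℂ] K) x)
    have h2 := inner_self_eq_norm_sq_to_K (𝕜 := ℂ) (TensorProduct.map (U : H →ₗ[ℂ] H) (LinearMap.id : K →ₗ[ℂ] K) x)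
    refine h2.symm.trans (h1.trans ?_)
    rw [← LinearMap.comp_apply, ← TensorProduct.map_comp]
    simp only [star_one]
    rfl
  have e1 := key R
  have e2 := key T
  rw [← hR] at e1
  have e3 : ((algebraMap ℝ (H →L[ℂ] H) (‖T‖ ^ 2) - star T * T : H →L[ℂ] H) : H →ₗ[ℂ] H)
      = ((‖T‖ ^ 2 : ℝ) : ℂ) • LinearMap.id - ((star T * T : H →L[ℂ] H) : H →ₗ[ℂ] H) := by
    ext v
    simp [Algebra.algebraMap_eq_smul_one, -Complex.ofReal_pow]
  rw [e3] at e1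
  have e5 : TensorProduct.map (((‖T‖ ^ 2 : ℝ) : ℂ) • (LinearMap.id : H →ₗ[ℂ] H)
      - ((star T * T : H →L[ℂ] H) : H →ₗ[ℂ] H)) (LinearMap.id : K →ₗ[ℂ] K)
      = ((‖T‖ ^ 2 : ℝ) : ℂ) • TensorProduct.map LinearMap.id LinearMap.id
        - TensorProduct.map ((star T * T : H →L[ℂ] H) : H →ₗ[ℂ] H) LinearMap.id := by
    ext a b
    simp [TensorProduct.sub_tmul, TensorProduct.smul_tmul']
  rw [e5, LinearMap.sub_apply, inner_sub_right, ← e2, TensorProduct.map_id, LinearMap.smul_apply, LinearMap.id_apply,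
    inner_smul_right, inner_self_eq_norm_sq_to_K] at e1
  have e4 : ‖TensorProduct.map (R : H →ₗ[ℂ] H) (LinearMap.id : K →ₗ[ℂ] K) x‖ ^ 2 =
      ‖T‖ ^ 2 * ‖x‖ ^ 2 - ‖TensorProduct.map (T : H →ₗ[ℂ] H) (LinearMap.id : K →ₗ[ℂ] K) x‖ ^ 2 := by
    have := e1
    simp only [RCLike.ofReal_eq_complex_ofReal] at this
    exact_mod_cast this
  refine le_of_sq_le_sq ?_ (by positivity)
  nlinarith [sq_nonneg ‖TensorProduct.map (R : H →ₗ[ℂ] H) (LinearMap.id : K →ₗ[ℂ] K) x‖]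

theorem norm_map_tensor_le (T : H →L[ℂ] H) (S : K →L[ℂ] K) (x : H ⊗[ℂ] K) :
    ‖TensorProduct.map (T : H →ₗ[ℂ] H) (S : K →ₗ[ℂ] K) x‖ ≤ ‖T‖ * ‖S‖ * ‖x‖ := by
  have h1 : TensorProduct.map (T : H →ₗ[ℂ] H) (S : K →ₗ[ℂ] K) x =
      TensorProduct.map (T : H →ₗ[ℂ] H) (LinearMap.id : K →ₗ[ℂ] K)
        (TensorProduct.map (LinearMap.id : H →ₗ[ℂ] H) (S : K →ₗ[ℂ] K) x) := by
    rw [← LinearMap.comp_apply, ← TensorProduct.map_comp]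
    rfl
  have h2 : ‖TensorProduct.map (LinearMap.id : H →ₗ[ℂ] H) (S : K →ₗ[ℂ] K) x‖ ≤ ‖S‖ * ‖x‖ := by
    have h3 := norm_rTensor_le (K := H) S (TensorProduct.comm ℂ H K x)
    have h4 : TensorProduct.map (S : K →ₗ[ℂ] K) (LinearMap.id : H →ₗ[ℂ] H)
        (TensorProduct.comm ℂ H K x) =
        TensorProduct.comm ℂ H K (TensorProduct.map (LinearMap.id : H →ₗ[ℂ] H) (S : K →ₗ[ℂ] K) x) :=
      TensorProduct.map_comm _ _ _
    rw [h4] at h3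
    simpa only [TensorProduct.norm_comm] using h3
  rw [h1, mul_assoc]
  exact (norm_rTensor_le T _).trans (mul_le_mul_of_nonneg_left h2 (norm_nonneg _))

/-- The operator `T ⊗ S` on the algebraic tensor product `H ⊗ K`. -/
def opTensorPre (T : H →L[ℂ] H) (S : K →L[ℂ] K) : (H ⊗[ℂ] K) →L[ℂ] (H ⊗[ℂ] K) :=
  (TensorProduct.map (T : H →ₗ[ℂ] H) (S : K →ₗ[ℂ] K)).mkContinuous (‖T‖ * ‖S‖)
    (norm_map_tensor_le T S)

/-- The bounded operator `T ⊗ S` on the Hilbert space tensor product of `H` and `K`. -/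
def opTensor (T : H →L[ℂ] H) (S : K →L[ℂ] K) : HilbertTensor H K →L[ℂ] HilbertTensor H K :=
  (opTensorPre T S).completion

@[simp] theorem opTensor_tmul (T : H →L[ℂ] H) (S : K →L[ℂ] K) (x : H) (y : K) :
    opTensor T S ((x ⊗ₜ[ℂ] y : H ⊗[ℂ] K) : HilbertTensor H K) = ((T x ⊗ₜ[ℂ] S y : H ⊗[ℂ] K) : HilbertTensor H K) := by
  simp [opTensor, opTensorPre]

theorem HilbertTensor.clm_ext {U V : HilbertTensor H K →L[ℂ] HilbertTensor H K}
    (h : ∀ x y, U ((x ⊗ₜ[ℂ] y : H ⊗[ℂ] K) : HilbertTensor H K) =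
      V ((x ⊗ₜ[ℂ] y : H ⊗[ℂ] K) : HilbertTensor H K)) : U = V := by
  ext v
  induction v using UniformSpace.Completion.induction_on with
  | hp => exact isClosed_eq U.continuous V.continuous
  | ih v =>
    induction v with
    | zero => rw [UniformSpace.Completion.coe_zero, map_zero, map_zero]
    | tmul x y => exact h x y
    | add a b ha hb => rw [UniformSpace.Completion.coe_add, map_add, map_add, ha, hb]

theorem opTensor_add_left (T T' : H →L[ℂ] H) (S : K →L[ℂ] K) :
    opTensor (T + T') S = opTensor T S + opTensor T' S :=
  HilbertTensor.clm_ext fun x y => by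
    simp [TensorProduct.add_tmul, UniformSpace.Completion.coe_add]

theorem opTensor_add_right (T : H →L[ℂ] H) (S S' : K →L[ℂ] K) :
    opTensor T (S + S') = opTensor T S + opTensor T S' :=
  HilbertTensor.clm_ext fun x y => by
    simp [TensorProduct.tmul_add, UniformSpace.Completion.coe_add]

theorem opTensor_smul_left (c : ℂ) (T : H →L[ℂ] H) (S : K →L[ℂ] K) :
    opTensor (c • T) S = c • opTensor T S :=
  HilbertTensor.clm_ext fun x y => by
    rw [smul_apply, opTensor_tmul, opTensor_tmul,
      ← UniformSpace.Completion.coe_smul, TensorProduct.smul_tmul']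
    rfl

theorem opTensor_smul_right (c : ℂ) (T : H →L[ℂ] H) (S : K →L[ℂ] K) :
    opTensor T (c • S) = c • opTensor T S :=
  HilbertTensor.clm_ext fun x y => by
    simp [UniformSpace.Completion.coe_smul]

theorem opTensor_mul (T T' : H →L[ℂ] H) (S S' : K →L[ℂ] K) :
    opTensor T S * opTensor T' S' = opTensor (T * T') (S * S') :=
  HilbertTensor.clm_ext fun x y => by simp

theorem star_opTensor (T : H →L[ℂ] H) (S : K →L[ℂ] K) :
    star (opTensor T S) = opTensor (star T) (star S) := by
  symm
  rw [ContinuousLinearMap.star_eq_adjoint (opTensor T S)]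
  refine (ContinuousLinearMap.eq_adjoint_iff _ _).2 fun x y => ?_
  induction x, y using UniformSpace.Completion.induction_on₂ with
  | hp => apply isClosed_eq <;> fun_prop
  | ih x y =>
    have := inner_map_tensor (star T) (star S) x y
    simp only [star_star] at this
    simpa [opTensor, opTensorPre] using this

theorem norm_opTensor_le (T : H →L[ℂ] H) (S : K →L[ℂ] K) : ‖opTensor T S‖ ≤ ‖T‖ * ‖S‖ := by
  refine ContinuousLinearMap.opNorm_le_bound _ (by positivity) fun v => ?_
  induction v using UniformSpace.Completion.induction_on with
  | hp => apply isClosed_le <;> fun_prop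
  | ih v => simpa [opTensor, opTensorPre] using norm_map_tensor_le T S v

end HilbertTensor

noncomputable section MinTensor

/- The canonical order of a C*-algebra: `0 ≤ x` iff `x` is self-adjoint with nonnegative spectrum. -/
attribute [local instance] CStarAlgebra.spectralOrder CStarAlgebra.spectralOrderedRing

universe u v

variable (A : Type u) (B : Type v) [NonUnitalCStarAlgebra A] [NonUnitalCStarAlgebra B]

/-- Positive linear functionals on a C*-algebra. -/
abbrev PosFunctional : Type u := A →ₚ[ℂ] ℂ

variable {A B}

/-- The GNS Hilbert space of a positive functional. -/
abbrev PosFunctional.Space (f : PosFunctional A) : Type u := PositiveLinearMap.GNS f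

/-- The GNS representation of a positive functional. -/
def PosFunctional.rep (f : PosFunctional A) : A →⋆ₙₐ[ℂ] (f.Space →L[ℂ] f.Space) :=
  PositiveLinearMap.gnsNonUnitalStarAlgHom f

theorem PosFunctional.norm_rep_le (f : PosFunctional A) (a : A) : ‖f.rep a‖ ≤ ‖a‖ :=
  NonUnitalStarAlgHom.norm_apply_le f.rep a

variable (A B)

/-- The C*-algebra of bounded operators on the Hilbert space `H_f ⊗ H_g`. -/
def GNSOp (p : PosFunctional A × PosFunctional B) : Type max u v :=
  HilbertTensor p.1.Space p.2.Space →L[ℂ] HilbertTensor p.1.Space p.2.Space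

instance (p : PosFunctional A × PosFunctional B) : CStarAlgebra (GNSOp A B p) :=
  inferInstanceAs (CStarAlgebra
    (HilbertTensor p.1.Space p.2.Space →L[ℂ] HilbertTensor p.1.Space p.2.Space))

/-- The C*-algebra of bounded families of operators on the Hilbert spaces `H_f ⊗ H_g`, where
`f`, `g` run through the positive functionals on `A`, `B` and `H_f`, `H_g` are the GNS spaces. -/
def GNSTensorAlgebra : Type max u v :=
  lp (GNSOp A B) ∞

instance : NonUnitalCStarAlgebra (GNSTensorAlgebra A B) :=
  inferInstanceAs (NonUnitalCStarAlgebra (lp (GNSOp A B) ∞))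

variable {A B} in
/-- A bounded family of operators, as an element of the algebra of such families. -/
def GNSTensorAlgebra.mk (T : ∀ p, GNSOp A B p) (C : ℝ) (h : ∀ p, ‖T p‖ ≤ C) :
    GNSTensorAlgebra A B :=
  (⟨T, memℓp_infty ⟨C, by rintro _ ⟨p, rfl⟩; exact h p⟩⟩ : lp (GNSOp A B) ∞)

variable {A B} in
/-- The component of a family of operators at `p`. -/
def GNSTensorAlgebra.coord (x : GNSTensorAlgebra A B) (p : PosFunctional A × PosFunctional B) :
    GNSOp A B p :=
  (show lp (GNSOp A B) ∞ from x) p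

variable {A B}

theorem GNSTensorAlgebra.ext {x y : GNSTensorAlgebra A B} (h : ∀ p, x.coord p = y.coord p) :
    x = y :=
  lp.ext (funext h)

theorem GNSTensorAlgebra.coord_add (x y : GNSTensorAlgebra A B) (p) :
    (x + y).coord p = x.coord p + y.coord p := rfl

theorem GNSTensorAlgebra.coord_mul (x y : GNSTensorAlgebra A B) (p) :
    (x * y).coord p = x.coord p * y.coord p := rfl

theorem GNSTensorAlgebra.coord_smul (c : ℂ) (x : GNSTensorAlgebra A B) (p) :
    (c • x).coord p = c • x.coord p := rfl

theorem GNSTensorAlgebra.coord_star (x : GNSTensorAlgebra A B) (p) :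
    (star x).coord p = star (x.coord p) := rfl


/-- The family of operators `π_f(a) ⊗ π_g(b)`. -/
def gnsTensor (a : A) (b : B) : GNSTensorAlgebra A B :=
  .mk (fun p => (opTensor (p.1.rep a) (p.2.rep b) : GNSOp A B p)) (‖a‖ * ‖b‖) fun p =>
    (norm_opTensor_le _ _).trans
      (mul_le_mul (p.1.norm_rep_le a) (p.2.norm_rep_le b) (norm_nonneg _) (norm_nonneg _))

/-- The family of operators `1 ⊗ π_g(b)`. -/
def gnsTensorRight (b : B) : GNSTensorAlgebra A B :=
  .mk (fun p => (opTensor 1 (p.2.rep b) : GNSOp A B p)) ‖b‖ fun p =>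
    ((norm_opTensor_le _ _).trans
      (mul_le_mul ContinuousLinearMap.norm_id_le (p.2.norm_rep_le b) (norm_nonneg _)
        zero_le_one)).trans_eq (one_mul _)

/-- The family of operators `π_f(a) ⊗ 1`. -/
def gnsTensorLeft (a : A) : GNSTensorAlgebra A B :=
  .mk (fun p => (opTensor (p.1.rep a) 1 : GNSOp A B p)) ‖a‖ fun p =>
    ((norm_opTensor_le _ _).trans
      (mul_le_mul (p.1.norm_rep_le a) ContinuousLinearMap.norm_id_le (norm_nonneg _)
        (norm_nonneg _))).trans_eq (mul_one _)

theorem gnsTensor_mul (a a' : A) (b b' : B) :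
    gnsTensor a b * gnsTensor a' b' = gnsTensor (a * a') (b * b') :=
  GNSTensorAlgebra.ext fun p => by
    rw [GNSTensorAlgebra.coord_mul]
    refine (opTensor_mul _ _ _ _).trans ?_
    rw [← map_mul, ← map_mul]; rfl

theorem gnsTensorRight_mul (a : A) (b b' : B) :
    gnsTensorRight b * gnsTensor a b' = gnsTensor a (b * b') :=
  GNSTensorAlgebra.ext fun p => by
    rw [GNSTensorAlgebra.coord_mul]
    refine (opTensor_mul _ _ _ _).trans ?_
    rw [one_mul, ← map_mul]; rfl

theorem mul_gnsTensorRight (a : A) (b b' : B) :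
    gnsTensor a b' * gnsTensorRight b = gnsTensor a (b' * b) :=
  GNSTensorAlgebra.ext fun p => by
    rw [GNSTensorAlgebra.coord_mul]
    refine (opTensor_mul _ _ _ _).trans ?_
    rw [mul_one, ← map_mul]; rfl

theorem gnsTensorLeft_mul (a a' : A) (b : B) :
    gnsTensorLeft a * gnsTensor a' b = gnsTensor (a * a') b :=
  GNSTensorAlgebra.ext fun p => by
    rw [GNSTensorAlgebra.coord_mul]
    refine (opTensor_mul _ _ _ _).trans ?_
    rw [one_mul, ← map_mul]; rfl

theorem mul_gnsTensorLeft (a a' : A) (b : B) :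
    gnsTensor a' b * gnsTensorLeft a = gnsTensor (a' * a) b :=
  GNSTensorAlgebra.ext fun p => by
    rw [GNSTensorAlgebra.coord_mul]
    refine (opTensor_mul _ _ _ _).trans ?_
    rw [mul_one, ← map_mul]; rfl

theorem star_gnsTensor (a : A) (b : B) : star (gnsTensor a b) = gnsTensor (star a) (star b) :=
  GNSTensorAlgebra.ext fun p => by
    rw [GNSTensorAlgebra.coord_star]
    refine (star_opTensor _ _).trans ?_
    rw [← map_star, ← map_star]; rfl

theorem gnsTensor_add_left (a a' : A) (b : B) :
    gnsTensor (a + a') b = gnsTensor a b + gnsTensor a' b :=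
  GNSTensorAlgebra.ext fun p => by
    rw [GNSTensorAlgebra.coord_add]
    refine Eq.trans ?_ (opTensor_add_left _ _ _)
    rw [← map_add]; rfl

theorem gnsTensor_add_right (a : A) (b b' : B) :
    gnsTensor a (b + b') = gnsTensor a b + gnsTensor a b' :=
  GNSTensorAlgebra.ext fun p => by
    rw [GNSTensorAlgebra.coord_add]
    refine Eq.trans ?_ (opTensor_add_right _ _ _)
    rw [← map_add]; rfl

theorem gnsTensor_smul_left (c : ℂ) (a : A) (b : B) :
    gnsTensor (c • a) b = c • gnsTensor a b :=
  GNSTensorAlgebra.ext fun p => by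
    rw [GNSTensorAlgebra.coord_smul]
    refine Eq.trans ?_ (opTensor_smul_left _ _ _)
    rw [← map_smul]; rfl

theorem gnsTensor_smul_right (c : ℂ) (a : A) (b : B) :
    gnsTensor a (c • b) = c • gnsTensor a b :=
  GNSTensorAlgebra.ext fun p => by
    rw [GNSTensorAlgebra.coord_smul]
    refine Eq.trans ?_ (opTensor_smul_right _ _ _)
    rw [← map_smul]; rfl

variable (A B)

/-- The closed `*`-subalgebra generated by the elements `a ⊗ b` in the tensor product of the
universal representations of `A` and `B`. -/
def minTensorSubalgebra : NonUnitalStarSubalgebra ℂ (GNSTensorAlgebra A B) :=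
  (NonUnitalStarAlgebra.adjoin ℂ (Set.range fun p : A × B => gnsTensor p.1 p.2)).topologicalClosure

instance isClosed_minTensorSubalgebra :
    IsClosed (minTensorSubalgebra A B : Set (GNSTensorAlgebra A B)) :=
  NonUnitalStarSubalgebra.isClosed_topologicalClosure _

/-- The minimal (spatial) tensor product of two C*-algebras: the completion of the algebraic
tensor product in the norm `‖t‖ = sup ‖(π_f ⊗ π_g)(t)‖`, the supremum being taken over the GNS
representations of all pairs of positive functionals, i.e. the norm in the tensor product of the
universal representations. -/
def MinTensor : Type max u v := minTensorSubalgebra A B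

instance : NonUnitalCStarAlgebra (MinTensor A B) :=
  inferInstanceAs (NonUnitalCStarAlgebra (minTensorSubalgebra A B))

variable {A B}

namespace MinTensor

/-- The inclusion of the minimal tensor product in the algebra it is generated in. -/
def incl : MinTensor A B →⋆ₙₐ[ℂ] GNSTensorAlgebra A B :=
  NonUnitalStarSubalgebraClass.subtype (minTensorSubalgebra A B)

theorem incl_injective : Function.Injective (incl : MinTensor A B → GNSTensorAlgebra A B) :=
  Subtype.val_injective

theorem continuous_incl : Continuous (incl : MinTensor A B → GNSTensorAlgebra A B) :=
  continuous_subtype_val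

theorem norm_incl (t : MinTensor A B) : ‖incl t‖ = ‖t‖ := rfl

theorem incl_mem (t : MinTensor A B) : incl t ∈ minTensorSubalgebra A B := t.2

/-- An element of the closed subalgebra, as an element of the minimal tensor product. -/
def ofMem (x : GNSTensorAlgebra A B) (hx : x ∈ minTensorSubalgebra A B) : MinTensor A B :=
  ⟨x, hx⟩

theorem incl_ofMem (x : GNSTensorAlgebra A B) (hx) : incl (ofMem x hx) = x := rfl

theorem gnsTensor_mem (a : A) (b : B) : gnsTensor a b ∈ minTensorSubalgebra A B :=
  NonUnitalStarSubalgebra.le_topologicalClosure _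
    (NonUnitalStarAlgebra.subset_adjoin ℂ _ ⟨(a, b), rfl⟩)

/-- The elementary tensor `a ⊗ b` in the minimal tensor product. -/
def tmul (a : A) (b : B) : MinTensor A B := ofMem (gnsTensor a b) (gnsTensor_mem a b)

theorem incl_tmul (a : A) (b : B) : incl (tmul a b) = gnsTensor a b := rfl

theorem tmul_mul_tmul (a a' : A) (b b' : B) : tmul a b * tmul a' b' = tmul (a * a') (b * b') :=
  incl_injective (by rw [map_mul]; exact gnsTensor_mul _ _ _ _)

theorem star_tmul (a : A) (b : B) : star (tmul a b) = tmul (star a) (star b) :=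
  incl_injective (by rw [map_star]; exact star_gnsTensor _ _)

theorem add_tmul (a a' : A) (b : B) : tmul (a + a') b = tmul a b + tmul a' b :=
  incl_injective (by rw [map_add]; exact gnsTensor_add_left _ _ _)

theorem tmul_add (a : A) (b b' : B) : tmul a (b + b') = tmul a b + tmul a b' :=
  incl_injective (by rw [map_add]; exact gnsTensor_add_right _ _ _)

theorem smul_tmul (c : ℂ) (a : A) (b : B) : tmul (c • a) b = c • tmul a b :=
  incl_injective (by rw [map_smul]; exact gnsTensor_smul_left _ _ _)

theorem tmul_smul (c : ℂ) (a : A) (b : B) : tmul a (c • b) = c • tmul a b :=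
  incl_injective (by rw [map_smul]; exact gnsTensor_smul_right _ _ _)

theorem norm_tmul_le (a : A) (b : B) : ‖tmul a b‖ ≤ ‖a‖ * ‖b‖ :=
  lp.norm_le_of_forall_le (by positivity) fun p =>
    (norm_opTensor_le _ _).trans
      (mul_le_mul (p.1.norm_rep_le a) (p.2.norm_rep_le b) (norm_nonneg _) (norm_nonneg _))

/-- The elementary tensor `a ⊗ b` as a bilinear function. -/
def tmulₗ : A →ₗ[ℂ] B →ₗ[ℂ] MinTensor A B :=
  LinearMap.mk₂ ℂ tmul add_tmul smul_tmul tmul_add tmul_smul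

theorem mem_span_of_mem_adjoin {x : GNSTensorAlgebra A B}
    (hx : x ∈ NonUnitalStarAlgebra.adjoin ℂ (Set.range fun p : A × B => gnsTensor p.1 p.2)) :
    x ∈ Submodule.span ℂ (Set.range fun p : A × B => gnsTensor p.1 p.2) := by
  induction hx using NonUnitalStarAlgebra.adjoin_induction with
  | mem x hx => exact Submodule.subset_span hx
  | add x y _ _ hx hy => exact add_mem hx hy
  | zero => exact zero_mem _
  | mul x y mx my hx hy =>
    clear mx my
    induction hx using Submodule.span_induction with
    | mem x hx =>
      obtain ⟨⟨a, b⟩, rfl⟩ := hx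
      induction hy using Submodule.span_induction with
      | mem y hy =>
        obtain ⟨⟨a', b'⟩, rfl⟩ := hy
        exact Submodule.subset_span ⟨(a * a', b * b'), (gnsTensor_mul _ _ _ _).symm⟩
      | zero => rw [mul_zero]; exact zero_mem _
      | add u v _ _ hu hv => rw [mul_add]; exact add_mem hu hv
      | smul c u _ hu => rw [mul_smul_comm]; exact Submodule.smul_mem _ _ hu
    | zero => rw [zero_mul]; exact zero_mem _
    | add u v _ _ hu hv => rw [add_mul]; exact add_mem hu hv
    | smul c u _ hu => rw [smul_mul_assoc]; exact Submodule.smul_mem _ _ hu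
  | smul c x _ hx => exact Submodule.smul_mem _ _ hx
  | star x mx hx =>
    clear mx
    induction hx using Submodule.span_induction with
    | mem x hx =>
      obtain ⟨⟨a, b⟩, rfl⟩ := hx
      exact Submodule.subset_span ⟨(star a, star b), (star_gnsTensor _ _).symm⟩
    | zero => rw [star_zero]; exact zero_mem _
    | add u v _ _ hu hv => rw [star_add]; exact add_mem hu hv
    | smul c u _ hu => rw [star_smul]; exact Submodule.smul_mem _ _ hu

/-- Induction principle: a closed property that holds for elementary tensors and is stable under
sums holds on the whole minimal tensor product. -/
theorem induction_on {P : MinTensor A B → Prop} (hc : IsClosed {t | P t})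
    (h0 : P 0) (ht : ∀ a b, P (tmul a b)) (ha : ∀ s t, P s → P t → P (s + t))
    (t : MinTensor A B) : P t := by
  have h1 : ∀ x, ∀ hx : x ∈ Submodule.span ℂ (Set.range fun p : A × B => gnsTensor p.1 p.2),
      ∃ t : MinTensor A B, incl t = x ∧ P t := by
    intro x hx
    induction hx using Submodule.closure_induction with
    | zero => exact ⟨0, map_zero _, h0⟩
    | add x y _ _ hx hy =>
      obtain ⟨s, rfl, hs⟩ := hx
      obtain ⟨t, rfl, ht⟩ := hy
      exact ⟨s + t, map_add _ _ _, ha s t hs ht⟩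
    | smul_mem c x hx =>
      obtain ⟨⟨a, b⟩, rfl⟩ := hx
      exact ⟨tmul (c • a) b, gnsTensor_smul_left _ _ _, ht _ _⟩
  have h2 : incl t ∈ closure (NonUnitalStarAlgebra.adjoin ℂ
      (Set.range fun p : A × B => gnsTensor p.1 p.2) : Set (GNSTensorAlgebra A B)) := incl_mem t
  have h3 : t ∈ closure {t : MinTensor A B | P t} := by
    rw [Metric.mem_closure_iff] at h2 ⊢
    intro ε hε
    obtain ⟨y, hy, hd⟩ := h2 ε hε
    obtain ⟨s, rfl, hs⟩ := h1 y (mem_span_of_mem_adjoin hy)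
    exact ⟨s, hs, hd⟩
  rwa [hc.closure_eq] at h3

/-- An element of the ambient algebra that multiplies the minimal tensor product into itself
defines a multiplier. -/
def multiplier (y : GNSTensorAlgebra A B)
    (hl : ∀ t : MinTensor A B, y * incl t ∈ minTensorSubalgebra A B)
    (hr : ∀ t : MinTensor A B, incl t * y ∈ minTensorSubalgebra A B) : 𝓜(ℂ, MinTensor A B) where
  fst := LinearMap.mkContinuous
    { toFun := fun t => ofMem (y * incl t) (hl t)
      map_add' := fun s t => incl_injective (by simp [incl_ofMem, mul_add])
      map_smul' := fun c t => incl_injective (mul_smul_comm c y (incl t)) } ‖y‖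
    fun t => norm_mul_le y (incl t)
  snd := LinearMap.mkContinuous
    { toFun := fun t => ofMem (incl t * y) (hr t)
      map_add' := fun s t => incl_injective (by simp [incl_ofMem, add_mul])
      map_smul' := fun c t => incl_injective (smul_mul_assoc c (incl t) y) } ‖y‖
    fun t => (norm_mul_le (incl t) y).trans_eq (mul_comm _ _)
  central := fun s t => incl_injective (mul_assoc (incl s) y (incl t))

/-- The multiplier `1 ⊗ b` of the minimal tensor product. -/
def oneTmul (b : B) : 𝓜(ℂ, MinTensor A B) :=
  multiplier (gnsTensorRight b)
    (fun t => by
      induction t using induction_on with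
      | hc =>
        exact (isClosed_minTensorSubalgebra A B).preimage
          (continuous_const.mul continuous_incl)
      | h0 => rw [map_zero, mul_zero]; exact zero_mem _
      | ht a b' => rw [incl_tmul, gnsTensorRight_mul]; exact gnsTensor_mem _ _
      | ha s t hs ht => rw [map_add, mul_add]; exact add_mem hs ht)
    (fun t => by
      induction t using induction_on with
      | hc =>
        exact (isClosed_minTensorSubalgebra A B).preimage
          (continuous_incl.mul continuous_const)
      | h0 => rw [map_zero, zero_mul]; exact zero_mem _
      | ht a b' => rw [incl_tmul, mul_gnsTensorRight]; exact gnsTensor_mem _ _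
      | ha s t hs ht => rw [map_add, add_mul]; exact add_mem hs ht)

/-- The multiplier `a ⊗ 1` of the minimal tensor product. -/
def tmulOne (a : A) : 𝓜(ℂ, MinTensor A B) :=
  multiplier (gnsTensorLeft a)
    (fun t => by
      induction t using induction_on with
      | hc =>
        exact (isClosed_minTensorSubalgebra A B).preimage
          (continuous_const.mul continuous_incl)
      | h0 => rw [map_zero, mul_zero]; exact zero_mem _
      | ht a b' => rw [incl_tmul, gnsTensorLeft_mul]; exact gnsTensor_mem _ _
      | ha s t hs ht => rw [map_add, mul_add]; exact add_mem hs ht)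
    (fun t => by
      induction t using induction_on with
      | hc =>
        exact (isClosed_minTensorSubalgebra A B).preimage
          (continuous_incl.mul continuous_const)
      | h0 => rw [map_zero, zero_mul]; exact zero_mem _
      | ht a b' => rw [incl_tmul, mul_gnsTensorLeft]; exact gnsTensor_mem _ _
      | ha s t hs ht => rw [map_add, add_mul]; exact add_mem hs ht)

theorem oneTmul_fst_tmul (a : A) (b b' : B) : (oneTmul b).fst (tmul a b') = tmul a (b * b') :=
  incl_injective (gnsTensorRight_mul a b b')

theorem oneTmul_snd_tmul (a : A) (b b' : B) : (oneTmul b).snd (tmul a b') = tmul a (b' * b) :=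
  incl_injective (mul_gnsTensorRight a b b')

theorem tmulOne_fst_tmul (a a' : A) (b : B) : (tmulOne a).fst (tmul a' b) = tmul (a * a') b :=
  incl_injective (gnsTensorLeft_mul a a' b)

theorem tmulOne_snd_tmul (a a' : A) (b : B) : (tmulOne a).snd (tmul a' b) = tmul (a' * a) b :=
  incl_injective (mul_gnsTensorLeft a a' b)

end MinTensor

end MinTensor

noncomputable section C0Sum

open Filter Topology

variable {ι : Type*} (A : ι → Type*) [∀ i, NonUnitalCStarAlgebra (A i)]

/-- The bounded families `x` with `‖x i‖ → 0` as `i → ∞`, as a `*`-subalgebra of the direct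
product of the C*-algebras `A i`. -/
def c0Subalgebra : NonUnitalStarSubalgebra ℂ (lp A ∞) where
  carrier := {x | Tendsto (fun i => ‖x i‖) cofinite (𝓝 0)}
  zero_mem' := by
    have h : (fun i => ‖(0 : lp A ∞) i‖) = fun _ => (0 : ℝ) := funext fun i => norm_zero
    exact (congrArg (fun f => Tendsto f cofinite (𝓝 0)) h).mpr tendsto_const_nhds
  add_mem' {x y} hx hy := by
    have h : Tendsto (fun i => ‖x i‖ + ‖y i‖) cofinite (𝓝 0) := by
      simpa using Tendsto.add hx hy
    exact squeeze_zero (fun i => norm_nonneg _) (fun i => norm_add_le (x i) (y i)) h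
  mul_mem' {x y} hx hy := by
    have h : Tendsto (fun i => ‖x i‖ * ‖y i‖) cofinite (𝓝 0) := by
      simpa using Tendsto.mul hx hy
    exact squeeze_zero (fun i => norm_nonneg _) (fun i => norm_mul_le (x i) (y i)) h
  smul_mem' c x hx := by
    have h : Tendsto (fun i => ‖c‖ * ‖x i‖) cofinite (𝓝 0) := by
      simpa using Tendsto.const_mul ‖c‖ hx
    exact squeeze_zero (fun i => norm_nonneg _) (fun i => (norm_smul c (x i)).le) h
  star_mem' {x} hx := by
    have h : (fun i => ‖(star x : lp A ∞) i‖) = fun i => ‖x i‖ :=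
      funext fun i => norm_star (x i)
    exact (congrArg (fun f => Tendsto f cofinite (𝓝 0)) h).mpr hx

theorem mem_c0Subalgebra (x : lp A ∞) :
    x ∈ c0Subalgebra A ↔ Tendsto (fun i => ‖x i‖) cofinite (𝓝 0) := Iff.rfl

instance isClosed_c0Subalgebra : IsClosed (c0Subalgebra A : Set (lp A ∞)) := by
  refine isClosed_of_closure_subset fun x hx => ?_
  refine (mem_c0Subalgebra A x).2 ?_
  rw [Metric.tendsto_nhds]
  intro ε hε
  obtain ⟨y, hy, hd⟩ := Metric.mem_closure_iff.1 hx (ε / 2) (half_pos hε)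
  have h1 := (Metric.tendsto_nhds.1 ((mem_c0Subalgebra A y).1 hy)) (ε / 2) (half_pos hε)
  filter_upwards [h1] with i hi
  simp only [dist_zero_right, norm_norm] at hi ⊢
  have h2 : ‖x i - y i‖ ≤ ‖x - y‖ := lp.norm_apply_le_norm ENNReal.top_ne_zero (x - y) i
  rw [dist_eq_norm] at hd
  have h3 : ‖x i‖ ≤ ‖x i - y i‖ + ‖y i‖ := by
    simpa using norm_add_le (x i - y i) (y i)
  linarith

/-- The direct sum of a family of C*-algebras: the families `x` with `‖x i‖ → 0` as `i → ∞`,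
with componentwise operations and the norm `sup ‖x i‖`. -/
def C0Sum : Type _ := c0Subalgebra A

instance : NonUnitalCStarAlgebra (C0Sum A) :=
  inferInstanceAs (NonUnitalCStarAlgebra (c0Subalgebra A))

variable {A}

namespace C0Sum

/-- The inclusion of the direct sum in the direct product. -/
def incl : C0Sum A →⋆ₙₐ[ℂ] lp A ∞ :=
  NonUnitalStarSubalgebraClass.subtype (c0Subalgebra A)

/-- The `i`-th component of an element of the direct sum. -/
def coord (x : C0Sum A) (i : ι) : A i := incl x i

theorem ext {x y : C0Sum A} (h : ∀ i, x.coord i = y.coord i) : x = y :=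
  Subtype.ext (lp.ext (funext h))

theorem tendsto_norm_coord (x : C0Sum A) : Tendsto (fun i => ‖x.coord i‖) cofinite (𝓝 0) := x.2

theorem norm_coord_le (x : C0Sum A) (i : ι) : ‖x.coord i‖ ≤ ‖x‖ :=
  lp.norm_apply_le_norm ENNReal.top_ne_zero (incl x) i

theorem norm_le {x : C0Sum A} {C : ℝ} (hC : 0 ≤ C) (h : ∀ i, ‖x.coord i‖ ≤ C) : ‖x‖ ≤ C :=
  lp.norm_le_of_forall_le hC h

/-- The projection of the direct sum onto its `i`-th summand. -/
def proj (i : ι) : C0Sum A →⋆ₙₐ[ℂ] A i where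
  toFun x := x.coord i
  map_smul' _ _ := rfl
  map_zero' := rfl
  map_add' _ _ := rfl
  map_mul' _ _ := rfl
  map_star' _ := rfl

theorem proj_apply (i : ι) (x : C0Sum A) : proj i x = x.coord i := rfl

open Classical in
/-- The element of the direct sum with `i`-th component `a` and all other components zero. -/
def singleFun (i : ι) (a : A i) : C0Sum A :=
  ⟨⟨Pi.single i a, memℓp_infty ⟨‖a‖, by
    rintro _ ⟨j, rfl⟩
    by_cases h : j = i
    · subst h; simp
    · simp [h]⟩⟩, by
    refine (mem_c0Subalgebra A _).2 (tendsto_const_nhds.congr' ?_)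
    have h : ({i}ᶜ : Set ι) ∈ (cofinite : Filter ι) := (Set.finite_singleton i).compl_mem_cofinite
    filter_upwards [h] with j hj
    have hj' : j ≠ i := hj
    exact (by rw [Pi.single_eq_of_ne hj', norm_zero] :
      ‖(Pi.single i a : ∀ j, A j) j‖ = 0).symm⟩

theorem coord_singleFun_same (i : ι) (a : A i) : (singleFun i a).coord i = a :=
  open Classical in Pi.single_eq_same i a

theorem coord_singleFun_of_ne {i j : ι} (h : j ≠ i) (a : A i) : (singleFun i a).coord j = 0 :=
  open Classical in Pi.single_eq_of_ne h a

/-- The inclusion of the `i`-th summand in the direct sum. -/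
def single (i : ι) : A i →⋆ₙₐ[ℂ] C0Sum A where
  toFun := singleFun i
  map_smul' c a := ext fun j => by
    by_cases h : j = i
    · subst h
      exact (coord_singleFun_same _ _).trans (congrArg (c • ·) (coord_singleFun_same j a)).symm
    · exact (coord_singleFun_of_ne h _).trans
        ((congrArg (c • ·) (coord_singleFun_of_ne h a)).trans (smul_zero c)).symm
  map_zero' := ext fun j => by
    by_cases h : j = i
    · subst h; exact coord_singleFun_same _ _
    · exact coord_singleFun_of_ne h _
  map_add' a b := ext fun j => by
    change _ = (singleFun i a).coord j + (singleFun i b).coord j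
    by_cases h : j = i
    · subst h; simp only [coord_singleFun_same]
    · simp only [coord_singleFun_of_ne h, add_zero]
  map_mul' a b := ext fun j => by
    change _ = (singleFun i a).coord j * (singleFun i b).coord j
    by_cases h : j = i
    · subst h; simp only [coord_singleFun_same]
    · simp only [coord_singleFun_of_ne h, mul_zero]
  map_star' a := ext fun j => by
    change _ = star ((singleFun i a).coord j)
    by_cases h : j = i
    · subst h; simp only [coord_singleFun_same]
    · simp only [coord_singleFun_of_ne h, star_zero]

theorem coord_single_same (i : ι) (a : A i) : (single i a).coord i = a :=
  coord_singleFun_same i a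

theorem coord_single_of_ne {i j : ι} (h : j ≠ i) (a : A i) : (single i a).coord j = 0 :=
  coord_singleFun_of_ne h a

/-- Induction principle: a closed property that is stable under sums and holds for elements with
one nonzero component holds on the whole direct sum. -/
theorem induction_on {P : C0Sum A → Prop} (hc : IsClosed {x | P x})
    (h0 : P 0) (hs : ∀ i a, P (single i a)) (ha : ∀ x y, P x → P y → P (x + y))
    (x : C0Sum A) : P x := by
  classical
  have hsum : ∀ F : Finset ι, P (∑ i ∈ F, single i (x.coord i)) := fun F => by
    induction F using Finset.induction_on with
    | empty => simpa using h0
    | insert i F hi ih => rw [Finset.sum_insert hi]; exact ha _ _ (hs _ _) ih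
  have hcoord : ∀ (F : Finset ι) (j : ι), (∑ i ∈ F, single i (x.coord i)).coord j =
      if j ∈ F then x.coord j else 0 := fun F j => by
    rw [← proj_apply, map_sum]
    by_cases hj : j ∈ F
    · rw [Finset.sum_eq_single j, if_pos hj, proj_apply, coord_single_same]
      · intro i _ hij
        exact coord_single_of_ne hij.symm _
      · exact fun h => absurd hj h
    · rw [if_neg hj]
      refine Finset.sum_eq_zero fun i hi => coord_single_of_ne ?_ _
      rintro rfl
      exact hj hi
  have hcl : x ∈ closure {x : C0Sum A | P x} := by
    rw [Metric.mem_closure_iff]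
    intro ε hε
    have h1 := (Metric.tendsto_nhds.1 x.tendsto_norm_coord) (ε / 2) (half_pos hε)
    rw [eventually_cofinite] at h1
    refine ⟨_, hsum h1.toFinset, ?_⟩
    rw [dist_eq_norm]
    refine lt_of_le_of_lt (norm_le (half_pos hε).le fun j => ?_) (half_lt_self hε)
    rw [← proj_apply, map_sub, proj_apply, proj_apply, hcoord]
    split_ifs with hj
    · simp only [sub_self, norm_zero]; exact (half_pos hε).le
    · simp only [Set.Finite.mem_toFinset, Set.mem_ofPred_eq, not_not, dist_zero_right,
        norm_norm] at hj
      rw [sub_zero]; exact hj.le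
  rwa [hc.closure_eq] at hcl

end C0Sum

end C0Sum

section Bialgebra

variable {A B : Type*} [NonUnitalCStarAlgebra A] [NonUnitalCStarAlgebra B]

/-- A unital `*`-homomorphism `F : M(A) → M(B)` is the canonical extension of a nondegenerate
`*`-homomorphism `A → M(B)` if `F(A)B` spans a dense subspace of `B`. Such an `F` is determined by
its restriction to `A`. -/
def IsNondegenerateExtension (F : 𝓜(ℂ, A) →⋆ₐ[ℂ] 𝓜(ℂ, B)) : Prop :=
  Dense (Submodule.span ℂ {y : B | ∃ (a : A) (b : B), y = (F (a : 𝓜(ℂ, A))).fst b} : Set B)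

/-- `F : M(A ⊗ A) → M((A ⊗ A) ⊗ A)` is the extension of `Δ ⊗ id`, that is, of the
`*`-homomorphism on `A ⊗ A` given by `(Δ ⊗ id)(a ⊗ b) (t ⊗ c) = Δ(a) t ⊗ b c`. -/
structure IsComulTensorId (Δ : A →⋆ₙₐ[ℂ] 𝓜(ℂ, MinTensor A A))
    (F : 𝓜(ℂ, MinTensor A A) →⋆ₐ[ℂ] 𝓜(ℂ, MinTensor (MinTensor A A) A)) : Prop where
  nondegenerate : IsNondegenerateExtension F
  apply : ∀ (a b c : A) (t : MinTensor A A),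
    (F (MinTensor.tmul a b : 𝓜(ℂ, MinTensor A A))).fst (MinTensor.tmul t c) =
      MinTensor.tmul ((Δ a).fst t) (b * c)

/-- `F : M(A ⊗ A) → M(A ⊗ (A ⊗ A))` is the extension of `id ⊗ Δ`, that is, of the
`*`-homomorphism on `A ⊗ A` given by `(id ⊗ Δ)(a ⊗ b) (c ⊗ t) = a c ⊗ Δ(b) t`. -/
structure IsIdTensorComul (Δ : A →⋆ₙₐ[ℂ] 𝓜(ℂ, MinTensor A A))
    (F : 𝓜(ℂ, MinTensor A A) →⋆ₐ[ℂ] 𝓜(ℂ, MinTensor A (MinTensor A A))) : Prop where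
  nondegenerate : IsNondegenerateExtension F
  apply : ∀ (a b c : A) (t : MinTensor A A),
    (F (MinTensor.tmul a b : 𝓜(ℂ, MinTensor A A))).fst (MinTensor.tmul c t) =
      MinTensor.tmul (a * c) ((Δ b).fst t)

/-- Coassociativity `(Δ ⊗ id) ∘ Δ = (id ⊗ Δ) ∘ Δ`. The two sides take values in
`M((A ⊗ A) ⊗ A)` and `M(A ⊗ (A ⊗ A))`, which are identified through the associativity isomorphism
`α` of the minimal tensor product. The isomorphism `α` and the extensions `L` of `Δ ⊗ id` and `R`
of `id ⊗ Δ` are uniquely determined by the stated conditions. -/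
def IsCoassociative (Δ : A →⋆ₙₐ[ℂ] 𝓜(ℂ, MinTensor A A)) : Prop :=
  ∃ (α : MinTensor (MinTensor A A) A ≃⋆ₐ[ℂ] MinTensor A (MinTensor A A))
    (L : 𝓜(ℂ, MinTensor A A) →⋆ₐ[ℂ] 𝓜(ℂ, MinTensor (MinTensor A A) A))
    (R : 𝓜(ℂ, MinTensor A A) →⋆ₐ[ℂ] 𝓜(ℂ, MinTensor A (MinTensor A A))),
    (∀ a b c : A, α (MinTensor.tmul (MinTensor.tmul a b) c) =
      MinTensor.tmul a (MinTensor.tmul b c)) ∧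
    IsComulTensorId Δ L ∧ IsIdTensorComul Δ R ∧
    ∀ (x : A) (t : MinTensor (MinTensor A A) A),
      α ((L (Δ x)).fst t) = (R (Δ x)).fst (α t)

/-- `(A, Δ)` is a C*-bialgebra: `Δ` is a `*`-homomorphism from `A` to `M(A ⊗ A)`, the linear span
of `Δ(a)(b ⊗ c)` is norm dense in `A ⊗ A`, and `Δ` is coassociative. -/
structure IsCStarBialgebra (Δ : A →⋆ₙₐ[ℂ] 𝓜(ℂ, MinTensor A A)) : Prop where
  dense_span : Dense (Submodule.span ℂ
    {t : MinTensor A A | ∃ a b c : A, t = (Δ a).fst (MinTensor.tmul b c)} : Set (MinTensor A A))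
  coassociative : IsCoassociative Δ

/-- `ε` is a counit: `(ε ⊗ id) ∘ Δ = id = (id ⊗ ε) ∘ Δ`. Here `L` and `R` are the extensions to
`M(A ⊗ A)` of `ε ⊗ id` and `id ⊗ ε`, viewed as maps to `A = ℂ ⊗ A = A ⊗ ℂ`. -/
def IsCounit (Δ : A →⋆ₙₐ[ℂ] 𝓜(ℂ, MinTensor A A)) (ε : A →⋆ₙₐ[ℂ] ℂ) : Prop :=
  ∃ L R : 𝓜(ℂ, MinTensor A A) →⋆ₐ[ℂ] 𝓜(ℂ, A),
    IsNondegenerateExtension L ∧ IsNondegenerateExtension R ∧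
    (∀ a b : A, L (MinTensor.tmul a b : 𝓜(ℂ, MinTensor A A)) = (ε a • b : A)) ∧
    (∀ a b : A, R (MinTensor.tmul a b : 𝓜(ℂ, MinTensor A A)) = (ε b • a : A)) ∧
    ∀ x : A, L (Δ x) = x ∧ R (Δ x) = x

/-- `Δ` is cocommutative: it is invariant under the flip automorphism `a ⊗ b ↦ b ⊗ a` of `A ⊗ A`,
extended to `M(A ⊗ A)`. -/
def IsCocommutative (Δ : A →⋆ₙₐ[ℂ] 𝓜(ℂ, MinTensor A A)) : Prop :=
  ∀ σ : MinTensor A A ≃⋆ₐ[ℂ] MinTensor A A,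
    (∀ a b : A, σ (MinTensor.tmul a b) = MinTensor.tmul b a) →
    ∀ (x : A) (t : MinTensor A A), σ ((Δ x).fst t) = (Δ x).fst (σ t)

/-- `(A, Δ)` is proper: `Δ(a)(1 ⊗ b)` and `(b ⊗ 1)Δ(a)` belong to `A ⊗ A`. -/
def IsProperComul (Δ : A →⋆ₙₐ[ℂ] 𝓜(ℂ, MinTensor A A)) : Prop :=
  ∀ a b : A, (∃ t : MinTensor A A, Δ a * MinTensor.oneTmul b = (t : 𝓜(ℂ, MinTensor A A))) ∧
    ∃ t : MinTensor A A, MinTensor.tmulOne b * Δ a = (t : 𝓜(ℂ, MinTensor A A))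

/-- The cancellation law: the linear spans `Δ(A)(1 ⊗ A)` and `Δ(A)(A ⊗ 1)` consist of elements of
`A ⊗ A` and are dense in `A ⊗ A`. -/
structure HasCancellation (Δ : A →⋆ₙₐ[ℂ] 𝓜(ℂ, MinTensor A A)) : Prop where
  mem_right : ∀ a b : A,
    ∃ t : MinTensor A A, Δ a * MinTensor.oneTmul b = (t : 𝓜(ℂ, MinTensor A A))
  mem_left : ∀ a b : A,
    ∃ t : MinTensor A A, Δ a * MinTensor.tmulOne b = (t : 𝓜(ℂ, MinTensor A A))
  dense_right : Dense (Submodule.span ℂ {t : MinTensor A A | ∃ a b : A,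
    (t : 𝓜(ℂ, MinTensor A A)) = Δ a * MinTensor.oneTmul b} : Set (MinTensor A A))
  dense_left : Dense (Submodule.span ℂ {t : MinTensor A A | ∃ a b : A,
    (t : 𝓜(ℂ, MinTensor A A)) = Δ a * MinTensor.tmulOne b} : Set (MinTensor A A))

end Bialgebra

noncomputable section UHF

open scoped CStarAlgebra

/-- The index set `{1, …, a₁} × ⋯ × {1, …, aₙ}` (counted from zero). -/
abbrev UHFIndex (a : ℕ → ℕ) (n : ℕ) : Type := ∀ j : Fin n, Fin (a j)

namespace UHFIndex

variable {a : ℕ → ℕ} {n m k : ℕ}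

/-- The first `n` entries of a multi-index. -/
def trunc (h : n ≤ m) (J : UHFIndex a m) : UHFIndex a n := fun j => J (Fin.castLE h j)

/-- Two multi-indices have the same entries from position `n` on. -/
def SameTail (n : ℕ) (J K : UHFIndex a m) : Prop := ∀ j : Fin m, n ≤ (j : ℕ) → J j = K j

instance (n : ℕ) (J K : UHFIndex a m) : Decidable (SameTail n J K) := by
  unfold SameTail; infer_instance

/-- The multi-index with first `n` entries from `P` and the remaining ones from `J`. -/
def glue (P : UHFIndex a n) (J : UHFIndex a m) : UHFIndex a m := fun j =>
  if h : (j : ℕ) < n then P ⟨j, h⟩ else J j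

theorem trunc_glue (h : n ≤ m) (P : UHFIndex a n) (J : UHFIndex a m) :
    trunc h (glue P J) = P := by
  funext j
  have hj : ((Fin.castLE h j : Fin m) : ℕ) < n := j.2
  exact dif_pos hj

theorem sameTail_glue (P : UHFIndex a n) (J : UHFIndex a m) : SameTail n J (glue P J) :=
  fun j hj => (dif_neg (not_lt.2 hj) : glue P J j = J j).symm

theorem glue_trunc (h : n ≤ m) {J K : UHFIndex a m} (hJK : SameTail n J K) :
    glue (trunc h K) J = K := by
  funext j
  by_cases hj : (j : ℕ) < n
  · exact dif_pos hj
  · exact (dif_neg hj).trans (hJK j (not_lt.1 hj))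

theorem SameTail.symm {J K : UHFIndex a m} (h : SameTail n J K) : SameTail n K J :=
  fun j hj => (h j hj).symm

theorem SameTail.trans {J K L : UHFIndex a m} (h : SameTail n J K) (h' : SameTail n K L) :
    SameTail n J L :=
  fun j hj => (h j hj).trans (h' j hj)

theorem SameTail.refl (J : UHFIndex a m) : SameTail n J J := fun _ _ => rfl

theorem sum_sameTail (h : n ≤ m) (J : UHFIndex a m) {M : Type*} [AddCommMonoid M]
    (g : UHFIndex a n → M) :
    (∑ L : UHFIndex a m, if SameTail n J L then g (trunc h L) else 0) = ∑ P, g P := by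
  rw [← Finset.sum_filter]
  refine Finset.sum_bij' (fun L _ => trunc h L) (fun P _ => glue P J) ?_ ?_ ?_ ?_ ?_
  · exact fun _ _ => Finset.mem_univ _
  · exact fun P _ => Finset.mem_filter.2 ⟨Finset.mem_univ _, sameTail_glue P J⟩
  · exact fun L hL => glue_trunc h (Finset.mem_filter.1 hL).2
  · exact fun P _ => trunc_glue h P J
  · exact fun _ _ => rfl

end UHFIndex

open UHFIndex

/-- The matrix algebra `M_{a₁} ⊗ ⋯ ⊗ M_{aₙ}`, as the C*-algebra of matrices indexed by
`{1, …, a₁} × ⋯ × {1, …, aₙ}`: the tensor product of matrix units `E_{j₁,k₁} ⊗ ⋯ ⊗ E_{jₙ,kₙ}` is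
the matrix unit `E_{J,K}` with `J = (j₁, …, jₙ)`, `K = (k₁, …, kₙ)`. -/
abbrev UHFMatrix (a : ℕ → ℕ) (n : ℕ) : Type := CStarMatrix (UHFIndex a n) (UHFIndex a n) ℂ

/-- The entry of a matrix at the pair of multi-indices `J`, `K`. -/
def UHFMatrix.entry {a : ℕ → ℕ} {n : ℕ} (M : UHFMatrix a n) (J K : UHFIndex a n) : ℂ := M J K

namespace UHFMatrix

variable {a : ℕ → ℕ} {n : ℕ}

theorem ext {M N : UHFMatrix a n} (h : ∀ J K, M.entry J K = N.entry J K) : M = N :=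
  CStarMatrix.ext h

theorem entry_mul (M N : UHFMatrix a n) (J K : UHFIndex a n) :
    UHFMatrix.entry (M * N) J K = ∑ L, M.entry J L * N.entry L K := CStarMatrix.mul_apply

theorem entry_one (J K : UHFIndex a n) : (1 : UHFMatrix a n).entry J K = if J = K then 1 else 0 :=
  CStarMatrix.one_apply

theorem entry_add (M N : UHFMatrix a n) (J K : UHFIndex a n) :
    (M + N).entry J K = M.entry J K + N.entry J K := rfl

theorem entry_smul (c : ℂ) (M : UHFMatrix a n) (J K : UHFIndex a n) :
    (c • M).entry J K = c * M.entry J K := rfl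

theorem entry_star (M : UHFMatrix a n) (J K : UHFIndex a n) :
    (star M).entry J K = star (M.entry K J) := rfl

/-- The matrix with given entries. -/
def of (g : UHFIndex a n → UHFIndex a n → ℂ) : UHFMatrix a n := CStarMatrix.ofMatrix g

theorem entry_of (g : UHFIndex a n → UHFIndex a n → ℂ) (J K : UHFIndex a n) :
    (of g).entry J K = g J K := rfl

/-- The matrix unit `E_{J,K} = E_{j₁,k₁} ⊗ ⋯ ⊗ E_{jₙ,kₙ}`. -/
def unit (J K : UHFIndex a n) : UHFMatrix a n := of fun P Q => if P = J ∧ Q = K then 1 else 0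

end UHFMatrix

open UHFMatrix

/-- The embedding `A ↦ A ⊗ I` of `M_{a₁} ⊗ ⋯ ⊗ M_{aₙ}` in `M_{a₁} ⊗ ⋯ ⊗ M_{aₘ}` for `n ≤ m`,
as a linear map. -/
def uhfEmbedₗ (a : ℕ → ℕ) (n m : ℕ) (h : n ≤ m) : UHFMatrix a n →ₗ[ℂ] UHFMatrix a m where
  toFun M := UHFMatrix.of fun J K =>
    if SameTail n J K then M.entry (trunc h J) (trunc h K) else 0
  map_add' M N := UHFMatrix.ext fun J K => by
    simp only [entry_add, entry_of]
    split_ifs <;> simp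
  map_smul' c M := UHFMatrix.ext fun J K => by
    simp only [RingHom.id_apply, entry_smul, entry_of]
    split_ifs <;> simp

theorem entry_uhfEmbedₗ (a : ℕ → ℕ) (n m : ℕ) (h : n ≤ m) (M : UHFMatrix a n)
    (J K : UHFIndex a m) : (uhfEmbedₗ a n m h M).entry J K =
      if SameTail n J K then M.entry (trunc h J) (trunc h K) else 0 := rfl

theorem uhfEmbedₗ_one (a : ℕ → ℕ) (n m : ℕ) (h : n ≤ m) : uhfEmbedₗ a n m h 1 = 1 :=
  UHFMatrix.ext fun J K => by
    rw [entry_uhfEmbedₗ, entry_one, entry_one]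
    by_cases hJK : J = K
    · subst hJK
      rw [if_pos (SameTail.refl J), if_pos rfl, if_pos rfl]
    · rw [if_neg hJK]
      split_ifs with ht h'
      · refine absurd ?_ hJK
        rw [← glue_trunc h (SameTail.refl (n := n) J), h', glue_trunc h ht]
      · rfl
      · rfl

theorem uhfEmbedₗ_mul (a : ℕ → ℕ) (n m : ℕ) (h : n ≤ m) (M N : UHFMatrix a n) :
    uhfEmbedₗ a n m h (M * N) = uhfEmbedₗ a n m h M * uhfEmbedₗ a n m h N :=
  UHFMatrix.ext fun J K => by
    rw [entry_uhfEmbedₗ, entry_mul, entry_mul]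
    simp only [entry_uhfEmbedₗ]
    split_ifs with ht
    · rw [← sum_sameTail h J fun P => M.entry (trunc h J) P * N.entry P (trunc h K)]
      refine Finset.sum_congr rfl fun L _ => ?_
      by_cases h1 : SameTail n J L
      · rw [if_pos h1, if_pos h1, if_pos (h1.symm.trans ht)]
      · rw [if_neg h1, if_neg h1, zero_mul]
    · symm
      refine Finset.sum_eq_zero fun L _ => ?_
      by_cases h1 : SameTail n J L
      · rw [if_neg (fun h2 => ht (h1.trans h2)), mul_zero]
      · rw [if_neg h1, zero_mul]

/-- The embedding `A ↦ A ⊗ I` of `M_{a₁} ⊗ ⋯ ⊗ M_{aₙ}` in `M_{a₁} ⊗ ⋯ ⊗ M_{aₘ}` for `n ≤ m`. -/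
def uhfEmbed (a : ℕ → ℕ) (n m : ℕ) (h : n ≤ m) : UHFMatrix a n →⋆ₐ[ℂ] UHFMatrix a m where
  __ := AlgHom.ofLinearMap (uhfEmbedₗ a n m h) (uhfEmbedₗ_one a n m h) (uhfEmbedₗ_mul a n m h)
  map_star' M := UHFMatrix.ext fun J K => by
    change (uhfEmbedₗ a n m h (star M)).entry J K = (star (uhfEmbedₗ a n m h M)).entry J K
    rw [entry_star, entry_uhfEmbedₗ, entry_uhfEmbedₗ, entry_star]
    by_cases ht : SameTail n J K
    · rw [if_pos ht, if_pos ht.symm]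
    · rw [if_neg ht, if_neg (fun h' => ht h'.symm), star_zero]

theorem entry_uhfEmbed (a : ℕ → ℕ) (n m : ℕ) (h : n ≤ m) (M : UHFMatrix a n)
    (J K : UHFIndex a m) : (uhfEmbed a n m h M).entry J K =
      if SameTail n J K then M.entry (trunc h J) (trunc h K) else 0 := rfl

instance uhfDirectedSystem (a : ℕ → ℕ) :
    DirectedSystem (UHFMatrix a) (fun n m h => uhfEmbed a n m h) where
  map_self n M := UHFMatrix.ext fun J K => by
    have h : SameTail n J K := fun j hj => absurd j.2 (not_lt.2 hj)
    rw [entry_uhfEmbed, if_pos h]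
    rfl
  map_map k m n hnm hmk M := UHFMatrix.ext fun J K => by
    simp only [entry_uhfEmbed]
    by_cases h1 : SameTail n J K
    · have h2 : SameTail m J K := fun j hj => h1 j (hnm.trans hj)
      have h3 : SameTail n (trunc hmk J) (trunc hmk K) := fun j hj => h1 (Fin.castLE hmk j) hj
      rw [if_pos h1, if_pos h2, if_pos h3]
      rfl
    · rw [if_neg h1]
      split_ifs with h2 h3
      · refine absurd (fun j hj => ?_) h1
        by_cases hj' : (j : ℕ) < m
        · exact h3 ⟨j, hj'⟩ hj
        · exact h2 j (not_lt.1 hj')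
      · rfl
      · rfl

/-- A sequence of positive integers. -/
class PosSeq (a : ℕ → ℕ) : Prop where
  pos : ∀ j, 0 < a j

instance (a : ℕ → ℕ) [PosSeq a] (n : ℕ) : Nonempty (UHFIndex a n) :=
  ⟨fun j => ⟨0, PosSeq.pos (j : ℕ)⟩⟩

theorem uhfEmbed_injective (a : ℕ → ℕ) [PosSeq a] (n m : ℕ) (h : n ≤ m) :
    Function.Injective (uhfEmbed a n m h) := by
  refine fun M N hMN => UHFMatrix.ext fun P Q => ?_
  obtain ⟨J⟩ := (inferInstance : Nonempty (UHFIndex a m))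
  have h1 := congrArg (fun X : UHFMatrix a m => X.entry (glue P J) (glue Q J)) hMN
  have ht : SameTail n (glue P J) (glue Q J) := (sameTail_glue P J).symm.trans (sameTail_glue Q J)
  simp only [entry_uhfEmbed] at h1
  rwa [if_pos ht, if_pos ht, trunc_glue, trunc_glue] at h1

theorem norm_uhfEmbed (a : ℕ → ℕ) [PosSeq a] (n m : ℕ) (h : n ≤ m) (M : UHFMatrix a n) :
    ‖uhfEmbed a n m h M‖ = ‖M‖ :=
  NonUnitalStarAlgHom.norm_map (uhfEmbed a n m h) (uhfEmbed_injective a n m h) M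

/-- The union of the matrix algebras `M_{a₁} ⊗ ⋯ ⊗ M_{aₙ}` along the embeddings `A ↦ A ⊗ I`,
that is, their algebraic direct limit. -/
def PreUHF (a : ℕ → ℕ) : Type := DirectLimit (UHFMatrix a) (uhfEmbed a)

namespace PreUHF

instance (a : ℕ → ℕ) : Ring (PreUHF a) :=
  inferInstanceAs (Ring (DirectLimit (UHFMatrix a) (uhfEmbed a)))

instance (a : ℕ → ℕ) : StarRing (PreUHF a) :=
  inferInstanceAs (StarRing (DirectLimit (UHFMatrix a) (uhfEmbed a)))

instance instAlgebra (a : ℕ → ℕ) : Algebra ℂ (PreUHF a) :=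
  inferInstanceAs (Algebra ℂ (DirectLimit (UHFMatrix a) (uhfEmbed a)))

instance (a : ℕ → ℕ) : StarModule ℂ (PreUHF a) :=
  inferInstanceAs (StarModule ℂ (DirectLimit (UHFMatrix a) (uhfEmbed a)))

/-- The canonical map from `M_{a₁} ⊗ ⋯ ⊗ M_{aₙ}` to the union. -/
def ofMatrix (a : ℕ → ℕ) (n : ℕ) : UHFMatrix a n →⋆ₐ[ℂ] PreUHF a where
  __ := AlgHom.ofLinearMap
    { toFun := fun M => (⟦⟨n, M⟩⟧ : DirectLimit (UHFMatrix a) (uhfEmbed a))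
      map_add' := fun M N => (DirectLimit.add_def n M N).symm
      map_smul' := fun c M => (DirectLimit.smul_def n M c).symm }
    (DirectLimit.one_def n).symm (fun M N => (DirectLimit.mul_def n M N).symm)
  map_star' M := (DirectLimit.star_def n M).symm

theorem ofMatrix_uhfEmbed (a : ℕ → ℕ) {n m : ℕ} (h : n ≤ m) (M : UHFMatrix a n) :
    ofMatrix a m (uhfEmbed a n m h M) = ofMatrix a n M :=
  DirectLimit.mk_apply n m M h

theorem induction {a : ℕ → ℕ} {P : PreUHF a → Prop} (h : ∀ n M, P (ofMatrix a n M)) (x : PreUHF a) :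
    P x :=
  DirectLimit.induction (uhfEmbed a) h x

theorem induction₂ {a : ℕ → ℕ} {P : PreUHF a → PreUHF a → Prop}
    (h : ∀ n M N, P (ofMatrix a n M) (ofMatrix a n N)) (x y : PreUHF a) : P x y :=
  DirectLimit.induction₂ (uhfEmbed a) h x y

variable (a : ℕ → ℕ) [PosSeq a]

instance : Norm (PreUHF a) where
  norm := DirectLimit.lift (uhfEmbed a) (fun _ M => ‖M‖)
    (fun n m h M => (norm_uhfEmbed a n m h M).symm)

theorem norm_ofMatrix (n : ℕ) (M : UHFMatrix a n) : ‖ofMatrix a n M‖ = ‖M‖ := rfl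

instance : NormedRing (PreUHF a) where
  __ := (inferInstance : Ring (PreUHF a))
  __ := AddGroupNorm.toNormedAddCommGroup (E := PreUHF a)
    { toFun := fun x => ‖x‖
      map_zero' := by
        rw [← map_zero (ofMatrix a 0), norm_ofMatrix, norm_zero]
      add_le' := induction₂ fun n M N => by
        rw [← map_add]; simp only [norm_ofMatrix]; exact norm_add_le M N
      neg' := induction fun n M => by
        rw [← map_neg]; simp only [norm_ofMatrix]; exact norm_neg M
      eq_zero_of_map_eq_zero' := induction fun n M hM => by
        rw [norm_ofMatrix] at hM
        rw [norm_eq_zero.1 hM, map_zero] }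
  norm_mul_le := induction₂ fun n M N => by
    rw [← map_mul]; exact norm_mul_le M N

instance : NormedAlgebra ℂ (PreUHF a) where
  __ := instAlgebra a
  norm_smul_le c := induction fun n M => by
    rw [← map_smul]; exact norm_smul_le c M

instance : CStarRing (PreUHF a) where
  norm_mul_self_le := induction fun n M => by
    rw [← map_star, ← map_mul]; exact CStarRing.norm_mul_self_le M

end PreUHF

section Completion

/- The completion of a normed `*`-algebra satisfying the C*-identity. -/
variable (D : Type*) [NormedRing D] [NormedAlgebra ℂ D] [StarRing D] [StarModule ℂ D] [CStarRing D]

open UniformSpace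

instance completionStar : Star (Completion D) where
  star := Completion.map star

variable {D}

theorem completion_coe_star (x : D) : ((star x : D) : Completion D) = star (x : Completion D) :=
  (Completion.map_coe (star_isometry (E := D)).uniformContinuous x).symm

theorem continuous_completion_star : Continuous (star : Completion D → Completion D) :=
  Completion.continuous_map

instance completionStarRing : StarRing (Completion D) where
  star_involutive x := by
    induction x using Completion.induction_on with
    | hp =>
      exact isClosed_eq (continuous_completion_star.comp continuous_completion_star) continuous_id
    | ih x => rw [← completion_coe_star, ← completion_coe_star, star_star]
  star_mul x y := by
    induction x, y using Completion.induction_on₂ with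
    | hp =>
      exact isClosed_eq (continuous_completion_star.comp (continuous_fst.mul continuous_snd))
        ((continuous_completion_star.comp continuous_snd).mul
          (continuous_completion_star.comp continuous_fst))
    | ih x y =>
      rw [← Completion.coe_mul, ← completion_coe_star, star_mul, Completion.coe_mul,
        completion_coe_star, completion_coe_star]
  star_add x y := by
    induction x, y using Completion.induction_on₂ with
    | hp =>
      exact isClosed_eq (continuous_completion_star.comp (continuous_fst.add continuous_snd))
        ((continuous_completion_star.comp continuous_fst).add
          (continuous_completion_star.comp continuous_snd))
    | ih x y =>
      rw [← Completion.coe_add, ← completion_coe_star, star_add, Completion.coe_add,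
        completion_coe_star, completion_coe_star]

instance completionNormedAlgebra : NormedAlgebra ℂ (Completion D) where
  __ := (inferInstance : Algebra ℂ (Completion D))
  norm_smul_le := norm_smul_le

instance completionStarModule : StarModule ℂ (Completion D) where
  star_smul c x := by
    induction x using Completion.induction_on with
    | hp =>
      exact isClosed_eq (continuous_completion_star.comp (continuous_const_smul c))
        (continuous_completion_star.const_smul (star c))
    | ih x =>
      rw [← Completion.coe_smul, ← completion_coe_star, star_smul, Completion.coe_smul,
        completion_coe_star]

instance completionCStarRing : CStarRing (Completion D) where
  norm_mul_self_le x := by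
    induction x using Completion.induction_on with
    | hp =>
      exact isClosed_le (continuous_norm.mul continuous_norm)
        (continuous_norm.comp (continuous_completion_star.mul continuous_id))
    | ih x =>
      rw [← completion_coe_star, ← Completion.coe_mul, Completion.norm_coe, Completion.norm_coe]
      exact CStarRing.norm_mul_self_le x

/-- The completion of a normed `*`-algebra satisfying the C*-identity is a C*-algebra. -/
instance completionCStarAlgebra : CStarAlgebra (Completion D) where

end Completion

/-- The C*-algebra `A(a)`: the C*-inductive limit of the matrix algebras `M_{a₁} ⊗ ⋯ ⊗ M_{aₙ}`
along the embeddings `A ↦ A ⊗ I`. -/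
def UHF (a : ℕ → ℕ) [PosSeq a] : Type := UniformSpace.Completion (PreUHF a)

namespace UHF

variable (a : ℕ → ℕ) [PosSeq a]

instance : CStarAlgebra (UHF a) :=
  inferInstanceAs (CStarAlgebra (UniformSpace.Completion (PreUHF a)))

/-- The inclusion of the union of the matrix algebras. -/
def ofPre : PreUHF a →⋆ₐ[ℂ] UHF a where
  toFun x := (x : UniformSpace.Completion (PreUHF a))
  map_one' := UniformSpace.Completion.coe_one _
  map_mul' := UniformSpace.Completion.coe_mul
  map_zero' := UniformSpace.Completion.coe_zero
  map_add' := UniformSpace.Completion.coe_add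
  commutes' _ := rfl
  map_star' := completion_coe_star

/-- The canonical map from `M_{a₁} ⊗ ⋯ ⊗ M_{aₙ}` to `A(a)`. -/
def ofMatrix (n : ℕ) : UHFMatrix a n →⋆ₐ[ℂ] UHF a := (ofPre a).comp (PreUHF.ofMatrix a n)

theorem ofMatrix_uhfEmbed {n m : ℕ} (h : n ≤ m) (M : UHFMatrix a n) :
    ofMatrix a m (uhfEmbed a n m h M) = ofMatrix a n M :=
  congrArg (ofPre a) (PreUHF.ofMatrix_uhfEmbed a h M)

theorem norm_ofMatrix (n : ℕ) (M : UHFMatrix a n) : ‖ofMatrix a n M‖ = ‖M‖ :=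
  (UniformSpace.Completion.norm_coe (PreUHF.ofMatrix a n M)).trans (PreUHF.norm_ofMatrix a n M)

variable {a}

theorem induction_on {P : UHF a → Prop} (hc : IsClosed {x | P x})
    (h : ∀ n M, P (ofMatrix a n M)) (x : UHF a) : P x :=
  UniformSpace.Completion.induction_on x hc (PreUHF.induction h)

section Lift

variable {C : Type*} [NonUnitalCStarAlgebra C] (f : ∀ n, UHFMatrix a n →⋆ₙₐ[ℂ] C)
  (hf : ∀ n m h M, f m (uhfEmbed a n m h M) = f n M)

/-- The map on the union of the matrix algebras defined by a compatible sequence of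
`*`-homomorphisms on the matrix algebras. -/
def preLift : PreUHF a →⋆ₙₐ[ℂ] C where
  toFun := DirectLimit.lift (uhfEmbed a) (fun n M => f n M) (fun n m h M => (hf n m h M).symm)
  map_smul' c := PreUHF.induction fun n M => by
    rw [← map_smul]; exact map_smul (f n) c M
  map_zero' := by
    rw [← map_zero (PreUHF.ofMatrix a 0)]; exact map_zero (f 0)
  map_add' := PreUHF.induction₂ fun n M N => by
    rw [← map_add]; exact map_add (f n) M N
  map_mul' := PreUHF.induction₂ fun n M N => by
    rw [← map_mul]; exact map_mul (f n) M N
  map_star' := PreUHF.induction fun n M => by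
    rw [← map_star]; exact map_star (f n) M

theorem preLift_ofMatrix (n : ℕ) (M : UHFMatrix a n) :
    preLift f hf (PreUHF.ofMatrix a n M) = f n M := rfl

theorem norm_preLift_le (x : PreUHF a) : ‖preLift f hf x‖ ≤ ‖x‖ := by
  induction x using PreUHF.induction with
  | h n M =>
    rw [preLift_ofMatrix, PreUHF.norm_ofMatrix]
    exact NonUnitalStarAlgHom.norm_apply_le (f n) M

theorem uniformContinuous_preLift : UniformContinuous (preLift f hf) :=
  (AddMonoidHomClass.lipschitz_of_bound (preLift f hf) 1
    (fun x => by rw [one_mul]; exact norm_preLift_le f hf x)).uniformContinuous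

/-- The extension to `A(a)` of the map `preLift`, as a function. -/
def liftFun : UHF a → C := UniformSpace.Completion.extension (preLift f hf)

theorem continuous_liftFun : Continuous (liftFun f hf) :=
  UniformSpace.Completion.continuous_extension

theorem liftFun_ofMatrix (n : ℕ) (M : UHFMatrix a n) :
    liftFun f hf (ofMatrix a n M) = f n M :=
  UniformSpace.Completion.extension_coe (uniformContinuous_preLift f hf) (PreUHF.ofMatrix a n M)

theorem induction_on₂ {P : UHF a → UHF a → Prop} (hc : IsClosed {x : UHF a × UHF a | P x.1 x.2})
    (h : ∀ n M N, P (ofMatrix a n M) (ofMatrix a n N)) (x y : UHF a) : P x y :=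
  UniformSpace.Completion.induction_on₂ x y hc (PreUHF.induction₂ h)

/-- The `*`-homomorphism on `A(a)` defined by a compatible sequence of `*`-homomorphisms on the
matrix algebras. -/
def lift : UHF a →⋆ₙₐ[ℂ] C where
  toFun := liftFun f hf
  map_smul' c x := by
    induction x using induction_on with
    | hc =>
      exact isClosed_eq ((continuous_liftFun f hf).comp (continuous_const_smul c))
        ((continuous_liftFun f hf).const_smul c)
    | h n M =>
      rw [← map_smul, liftFun_ofMatrix, liftFun_ofMatrix]; exact map_smul (f n) c M
  map_zero' := by
    rw [← map_zero (ofMatrix a 0), liftFun_ofMatrix, map_zero]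
  map_add' x y := by
    induction x, y using induction_on₂ with
    | hc =>
      exact isClosed_eq ((continuous_liftFun f hf).comp (continuous_fst.add continuous_snd))
        (((continuous_liftFun f hf).comp continuous_fst).add
          ((continuous_liftFun f hf).comp continuous_snd))
    | h n M N =>
      rw [← map_add, liftFun_ofMatrix, liftFun_ofMatrix, liftFun_ofMatrix, map_add]
  map_mul' x y := by
    induction x, y using induction_on₂ with
    | hc =>
      exact isClosed_eq ((continuous_liftFun f hf).comp (continuous_fst.mul continuous_snd))
        (((continuous_liftFun f hf).comp continuous_fst).mul
          ((continuous_liftFun f hf).comp continuous_snd))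
    | h n M N =>
      rw [← map_mul, liftFun_ofMatrix, liftFun_ofMatrix, liftFun_ofMatrix, map_mul]
  map_star' x := by
    induction x using induction_on with
    | hc =>
      exact isClosed_eq ((continuous_liftFun f hf).comp continuous_star)
        ((continuous_liftFun f hf).star)
    | h n M =>
      rw [← map_star, liftFun_ofMatrix, liftFun_ofMatrix, map_star]

theorem lift_ofMatrix (n : ℕ) (M : UHFMatrix a n) : lift f hf (ofMatrix a n M) = f n M :=
  liftFun_ofMatrix f hf n M

end Lift

end UHF

end UHF

noncomputable section Kronecker

open UHFIndex UHFMatrix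

/-- The sequences `a` of integers `≥ 2` and the constant sequence `1`, as a monoid under
componentwise multiplication. -/
def UHFMonoid : Submonoid (ℕ → ℕ) where
  carrier := {a | (∀ j, 2 ≤ a j) ∨ a = 1}
  one_mem' := Or.inr rfl
  mul_mem' {a b} ha hb := by
    rcases ha with ha | rfl
    · rcases hb with hb | rfl
      · exact Or.inl fun j => (ha j).trans
          (Nat.le_mul_of_pos_right _ (lt_of_lt_of_le two_pos (hb j)))
      · rw [mul_one]; exact Or.inl ha
    · rw [one_mul]; exact hb

instance (a : UHFMonoid) : PosSeq (a : ℕ → ℕ) where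
  pos j := by
    rcases a.2 with h | h
    · exact lt_of_lt_of_le two_pos (h j)
    · rw [h]; exact one_pos

instance posSeqMul (b c : ℕ → ℕ) [PosSeq b] [PosSeq c] : PosSeq (b * c) where
  pos j := Nat.mul_pos (PosSeq.pos j) (PosSeq.pos j)

instance posSeqOne : PosSeq 1 where
  pos _ := one_pos

section MatrixUnits

variable {a : ℕ → ℕ} {n : ℕ}

theorem UHFMatrix.entry_unit (J K P Q : UHFIndex a n) :
    (unit J K).entry P Q = if P = J ∧ Q = K then 1 else 0 := rfl

theorem UHFMatrix.unit_mul_unit (J K P Q : UHFIndex a n) :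
    unit J K * unit P Q = if K = P then unit J Q else 0 :=
  UHFMatrix.ext fun X Y => by
    rw [entry_mul]
    simp only [entry_unit]
    by_cases hKP : K = P
    · subst hKP
      rw [if_pos rfl, entry_unit, Finset.sum_eq_single K]
      · by_cases h1 : X = J <;> by_cases h2 : Y = Q <;> simp [h1, h2]
      · intro L _ hL; simp [hL]
      · exact fun h => absurd (Finset.mem_univ _) h
    · rw [if_neg hKP]
      refine Finset.sum_eq_zero fun L _ => ?_
      by_cases h1 : L = K
      · subst h1; simp [hKP]
      · simp [h1]

theorem UHFMatrix.star_unit (J K : UHFIndex a n) : star (unit J K) = unit K J :=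
  UHFMatrix.ext fun X Y => by
    rw [entry_star, entry_unit, entry_unit]
    by_cases h1 : X = K <;> by_cases h2 : Y = J <;> simp [h1, h2]

theorem UHFMatrix.entry_sum {ι : Type*} (s : Finset ι) (M : ι → UHFMatrix a n) (J K : UHFIndex a n) :
    UHFMatrix.entry (∑ i ∈ s, M i) J K = ∑ i ∈ s, (M i).entry J K := by
  classical
  induction s using Finset.induction_on with
  | empty => rfl
  | insert i s hi ih => rw [Finset.sum_insert hi, Finset.sum_insert hi, entry_add, ih]

theorem UHFMatrix.eq_sum_unit (M : UHFMatrix a n) :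
    M = ∑ J, ∑ K, M.entry J K • unit J K :=
  UHFMatrix.ext fun X Y => by
    simp only [entry_sum, entry_smul, entry_unit]
    rw [Finset.sum_eq_single X, Finset.sum_eq_single Y]
    · simp
    · intro K _ hK; simp [Ne.symm hK]
    · exact fun h => absurd (Finset.mem_univ _) h
    · intro J _ hJ; simp [Ne.symm hJ]
    · exact fun h => absurd (Finset.mem_univ _) h

/-- The `*`-homomorphism sending the matrix units `E_{J,K}` to a given system of matrix units. -/
def unitsHom {C : Type*} [NonUnitalCStarAlgebra C] (e : UHFIndex a n → UHFIndex a n → C)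
    (hmul : ∀ J K P Q, e J K * e P Q = if K = P then e J Q else 0)
    (hstar : ∀ J K, star (e J K) = e K J) : UHFMatrix a n →⋆ₙₐ[ℂ] C where
  toFun M := ∑ J, ∑ K, M.entry J K • e J K
  map_smul' c M := by
    simp only [entry_smul, mul_smul, Finset.smul_sum, MonoidHom.id_apply]
  map_zero' := by
    refine Finset.sum_eq_zero fun J _ => Finset.sum_eq_zero fun K _ => ?_
    exact zero_smul ℂ _
  map_add' M N := by
    simp only [entry_add, add_smul, Finset.sum_add_distrib]
  map_mul' M N := by
    simp only [entry_mul, Finset.sum_smul]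
    rw [Finset.sum_mul]
    refine Finset.sum_congr rfl fun J _ => ?_
    rw [Finset.sum_mul]
    refine Eq.trans Finset.sum_comm (Finset.sum_congr rfl fun L _ => ?_)
    rw [Finset.mul_sum]
    refine Eq.trans ?_ (Finset.sum_eq_single L ?_ ?_).symm
    · rw [Finset.mul_sum]
      refine Finset.sum_congr rfl fun K _ => ?_
      rw [smul_mul_smul_comm, hmul, if_pos rfl]
    · intro P _ hP
      rw [Finset.mul_sum]
      refine Finset.sum_eq_zero fun K _ => ?_
      rw [smul_mul_smul_comm, hmul, if_neg (Ne.symm hP), smul_zero]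
    · exact fun h => absurd (Finset.mem_univ _) h
  map_star' M := by
    simp only [entry_star, star_sum, star_smul, hstar]
    rw [Finset.sum_comm]

theorem unitsHom_apply {C : Type*} [NonUnitalCStarAlgebra C] (e : UHFIndex a n → UHFIndex a n → C)
    (hmul) (hstar) (M : UHFMatrix a n) :
    unitsHom e hmul hstar M = ∑ J, ∑ K, M.entry J K • e J K := rfl

theorem unitsHom_unit {C : Type*} [NonUnitalCStarAlgebra C] (e : UHFIndex a n → UHFIndex a n → C)
    (hmul) (hstar) (P Q : UHFIndex a n) : unitsHom e hmul hstar (unit P Q) = e P Q := by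
  rw [unitsHom_apply, Finset.sum_eq_single P, Finset.sum_eq_single Q]
  · simp [entry_unit]
  · intro K _ hK; simp [entry_unit, hK]
  · exact fun h => absurd (Finset.mem_univ _) h
  · intro J _ hJ; simp [entry_unit, hJ]
  · exact fun h => absurd (Finset.mem_univ _) h

end MatrixUnits

namespace UHFIndex

variable {b c : ℕ → ℕ} {n m : ℕ}

/-- The bijection `J ↦ (J', J'')` from `∏ {1, …, bᵢcᵢ}` to `∏ {1, …, bᵢ} × ∏ {1, …, cᵢ}`. Counting
indices from zero, it is given by `jᵢ = cᵢ jᵢ' + jᵢ''` with `0 ≤ jᵢ' < bᵢ` and `0 ≤ jᵢ'' < cᵢ`. -/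
def split (b c : ℕ → ℕ) (n : ℕ) : UHFIndex (b * c) n ≃ UHFIndex b n × UHFIndex c n where
  toFun J := (fun i => (finProdFinEquiv.symm (J i : Fin (b i * c i))).1,
    fun i => (finProdFinEquiv.symm (J i : Fin (b i * c i))).2)
  invFun p := fun i => (finProdFinEquiv (p.1 i, p.2 i) : Fin (b i * c i))
  left_inv J := funext fun i => finProdFinEquiv.apply_symm_apply (J i : Fin (b i * c i))
  right_inv p := by
    refine Prod.ext (funext fun i => ?_) (funext fun i => ?_)
    · exact congrArg Prod.fst (finProdFinEquiv.symm_apply_apply (p.1 i, p.2 i))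
    · exact congrArg Prod.snd (finProdFinEquiv.symm_apply_apply (p.1 i, p.2 i))

theorem split_spec (J : UHFIndex (b * c) n) (i : Fin n) :
    (J i : ℕ) = c i * ((split b c n J).1 i : ℕ) + ((split b c n J).2 i : ℕ) := by
  have h := congrArg (fun J : UHFIndex (b * c) n => (J i : ℕ)) ((split b c n).symm_apply_apply J)
  refine h.symm.trans ?_
  exact (add_comm _ _)

theorem split_trunc (h : n ≤ m) (J : UHFIndex (b * c) m) :
    split b c n (trunc h J) = (trunc h (split b c m J).1, trunc h (split b c m J).2) := rfl

theorem sameTail_split (J K : UHFIndex (b * c) m) : SameTail n J K ↔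
    SameTail n (split b c m J).1 (split b c m K).1 ∧
      SameTail n (split b c m J).2 (split b c m K).2 := by
  constructor
  · intro h
    constructor
    · intro i hi
      exact congrArg (fun z : Fin (b i * c i) => (finProdFinEquiv.symm z).1) (h i hi)
    · intro i hi
      exact congrArg (fun z : Fin (b i * c i) => (finProdFinEquiv.symm z).2) (h i hi)
  · rintro ⟨h1, h2⟩ i hi
    exact finProdFinEquiv.symm.injective (Prod.ext (h1 i hi) (h2 i hi))

end UHFIndex

section KroneckerHom

variable {b c : ℕ → ℕ} [PosSeq b] [PosSeq c] {X Y : Type*} [NonUnitalCStarAlgebra X]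
  [NonUnitalCStarAlgebra Y] (f : UHF b →⋆ₙₐ[ℂ] X) (g : UHF c →⋆ₙₐ[ℂ] Y)

/-- The element `f(E_{J',K'}) ⊗ g(E_{J'',K''})`, where `J ↦ (J', J'')` is the bijection
`UHFIndex.split`. -/
def kroneckerUnit (n : ℕ) (J K : UHFIndex (b * c) n) : MinTensor X Y :=
  MinTensor.tmul
    (f (UHF.ofMatrix b n (unit (split b c n J).1 (split b c n K).1)))
    (g (UHF.ofMatrix c n (unit (split b c n J).2 (split b c n K).2)))

theorem kroneckerUnit_mul (n : ℕ) (J K P Q : UHFIndex (b * c) n) :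
    kroneckerUnit f g n J K * kroneckerUnit f g n P Q =
      if K = P then kroneckerUnit f g n J Q else 0 := by
  unfold kroneckerUnit
  rw [MinTensor.tmul_mul_tmul, ← map_mul, ← map_mul, ← map_mul, ← map_mul, unit_mul_unit,
    unit_mul_unit]
  by_cases hKP : K = P
  · subst hKP
    rw [if_pos rfl, if_pos rfl, if_pos rfl]
  · rw [if_neg hKP]
    by_cases h1 : (split b c n K).1 = (split b c n P).1
    · have h2 : (split b c n K).2 ≠ (split b c n P).2 := fun h2 =>
        hKP ((split b c n).injective (Prod.ext h1 h2))
      rw [if_neg h2, map_zero, map_zero]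
      exact map_zero (MinTensor.tmulₗ _)
    · rw [if_neg h1, map_zero, map_zero]
      exact LinearMap.map_zero₂ MinTensor.tmulₗ _

theorem star_kroneckerUnit (n : ℕ) (J K : UHFIndex (b * c) n) :
    star (kroneckerUnit f g n J K) = kroneckerUnit f g n K J := by
  unfold kroneckerUnit
  rw [MinTensor.star_tmul, ← map_star, ← map_star, ← map_star, ← map_star, star_unit, star_unit]

/-- The `*`-homomorphism `(f ⊗ g) ∘ φ⁽ⁿ⁾` on the `n`-th matrix algebra, where `φ⁽ⁿ⁾` is the
Kronecker coproduct `E_{J,K} ↦ E_{J',K'} ⊗ E_{J'',K''}`. -/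
def kroneckerMatrixHom (n : ℕ) : UHFMatrix (b * c) n →⋆ₙₐ[ℂ] MinTensor X Y :=
  unitsHom (kroneckerUnit f g n) (kroneckerUnit_mul f g n) (star_kroneckerUnit f g n)

theorem tmul_ofMatrix (n : ℕ) (M : UHFMatrix b n) (N : UHFMatrix c n) :
    MinTensor.tmul (f (UHF.ofMatrix b n M)) (g (UHF.ofMatrix c n N)) =
      ∑ J, ∑ K, (M.entry (split b c n J).1 (split b c n K).1 *
        N.entry (split b c n J).2 (split b c n K).2) • kroneckerUnit f g n J K := by
  have h1 : ∀ F : UHFIndex b n × UHFIndex c n → MinTensor X Y,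
      ∑ J, F (split b c n J) = ∑ P, ∑ Q, F (P, Q) := fun F => by
    rw [(split b c n).sum_comp F, Fintype.sum_prod_type]
  have h2 : ∀ F : UHFIndex b n × UHFIndex c n → UHFIndex b n × UHFIndex c n → MinTensor X Y,
      ∑ J, ∑ K, F (split b c n J) (split b c n K) = ∑ P, ∑ P', ∑ Q, ∑ Q', F (P, P') (Q, Q') :=
    fun F => by
      rw [h1 fun p => ∑ K, F p (split b c n K)]
      exact Finset.sum_congr rfl fun P _ => Finset.sum_congr rfl fun P' _ => h1 _
  refine Eq.trans ?_ (h2 fun p q => (M.entry p.1 q.1 * N.entry p.2 q.2) • MinTensor.tmul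
    (f (UHF.ofMatrix b n (unit p.1 q.1))) (g (UHF.ofMatrix c n (unit p.2 q.2)))).symm
  change MinTensor.tmulₗ _ _ = _
  conv_lhs => rw [eq_sum_unit M, eq_sum_unit N]
  simp only [map_sum, map_smul, LinearMap.sum_apply, LinearMap.smul_apply, Finset.smul_sum,
    smul_smul]
  refine Eq.trans (Finset.sum_congr rfl fun P' _ => ?_) Finset.sum_comm
  refine Eq.trans ?_ (Finset.sum_congr rfl fun P _ => Finset.sum_comm)
  refine Eq.trans (Finset.sum_congr rfl fun Q' _ => ?_) Finset.sum_comm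
  refine Finset.sum_congr rfl fun P _ => Finset.sum_congr rfl fun Q _ => ?_
  rw [mul_comm]
  rfl

theorem kroneckerMatrixHom_uhfEmbed (n m : ℕ) (h : n ≤ m) (M : UHFMatrix (b * c) n) :
    kroneckerMatrixHom f g m (uhfEmbed (b * c) n m h M) = kroneckerMatrixHom f g n M := by
  have key : ∀ P Q : UHFIndex (b * c) n,
      kroneckerMatrixHom f g m (uhfEmbed (b * c) n m h (unit P Q)) =
        kroneckerMatrixHom f g n (unit P Q) := fun P Q => by
    refine Eq.trans ?_ (unitsHom_unit _ _ _ P Q).symm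
    unfold kroneckerUnit
    rw [← UHF.ofMatrix_uhfEmbed b h, ← UHF.ofMatrix_uhfEmbed c h, tmul_ofMatrix]
    refine Finset.sum_congr rfl fun J _ => Finset.sum_congr rfl fun K _ => ?_
    congr 1
    simp only [entry_uhfEmbed, entry_unit]
    by_cases ht : SameTail n J K
    · obtain ⟨h1, h2⟩ := (sameTail_split J K).1 ht
      rw [if_pos ht, if_pos h1, if_pos h2]
      have e1 : ∀ J : UHFIndex (b * c) m, ∀ P : UHFIndex (b * c) n, trunc h J = P ↔
          trunc h (split b c m J).1 = (split b c n P).1 ∧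
            trunc h (split b c m J).2 = (split b c n P).2 := fun J P => by
        rw [← (split b c n).injective.eq_iff, split_trunc, Prod.ext_iff]
      simp only [e1 J P, e1 K Q]
      split_ifs <;> simp_all
    · rw [if_neg ht]
      by_cases h1 : SameTail n (split b c m J).1 (split b c m K).1
      · have h2 : ¬ SameTail n (split b c m J).2 (split b c m K).2 := fun h2 =>
          ht ((sameTail_split J K).2 ⟨h1, h2⟩)
        rw [if_neg h2, mul_zero]
      · rw [if_neg h1, zero_mul]
  rw [eq_sum_unit M]
  simp only [map_sum, map_smul, key]

/-- The `*`-homomorphism `(f ⊗ g) ∘ φ_{b,c} : A(b·c) → X ⊗ Y`, where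
`φ_{b,c} : A(b·c) → A(b) ⊗ A(c)` is the Kronecker coproduct: it sends the matrix unit `E_{J,K}` to
`f(E_{J',K'}) ⊗ g(E_{J'',K''})`. -/
def kroneckerHom : UHF (b * c) →⋆ₙₐ[ℂ] MinTensor X Y :=
  UHF.lift (kroneckerMatrixHom f g) (kroneckerMatrixHom_uhfEmbed f g)

theorem kroneckerHom_unit (n : ℕ) (J K : UHFIndex (b * c) n) :
    kroneckerHom f g (UHF.ofMatrix (b * c) n (unit J K)) = kroneckerUnit f g n J K :=
  (UHF.lift_ofMatrix _ _ n _).trans (unitsHom_unit _ _ _ J K)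

end KroneckerHom

/-- The Kronecker coproduct `φ_{b,c} : A(b·c) → A(b) ⊗ A(c)`. -/
def kroneckerCoproduct (b c : ℕ → ℕ) [PosSeq b] [PosSeq c] :
    UHF (b * c) →⋆ₙₐ[ℂ] MinTensor (UHF b) (UHF c) :=
  kroneckerHom (NonUnitalStarAlgHom.id ℂ (UHF b)) (NonUnitalStarAlgHom.id ℂ (UHF c))

end Kronecker

noncomputable section Comultiplication

open UHFIndex UHFMatrix Filter Topology

theorem continuous_starAlgHom {A B : Type*} [NonUnitalCStarAlgebra A] [NonUnitalCStarAlgebra B]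
    (f : A →⋆ₙₐ[ℂ] B) : Continuous f :=
  AddMonoidHomClass.continuous_of_bound f 1 fun x =>
    (NonUnitalStarAlgHom.norm_apply_le f x).trans_eq (one_mul _).symm

/-- The C*-algebra `A(*)`: the direct sum of the C*-algebras `A(a)`, where `a` runs through the
sequences of integers `≥ 2` and the constant sequence `1`. -/
abbrev UHFSum : Type := C0Sum fun a : UHFMonoid => UHF (a : ℕ → ℕ)

/-- The `(b, c)`-block of the comultiplication: the `*`-homomorphism `(ι_b ⊗ ι_c) ∘ φ_{b,c}` from
`A(b·c)` to `A(*) ⊗ A(*)`, where `φ_{b,c} : A(b·c) → A(b) ⊗ A(c)` is the Kronecker coproduct and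
`ι_b`, `ι_c` are the inclusions of `A(b)`, `A(c)` in `A(*)`. -/
def comulBlock (p : UHFMonoid × UHFMonoid) :
    UHF ((p.1 * p.2 : UHFMonoid) : ℕ → ℕ) →⋆ₙₐ[ℂ] MinTensor UHFSum UHFSum :=
  kroneckerHom (b := (p.1 : ℕ → ℕ)) (c := (p.2 : ℕ → ℕ))
    (C0Sum.single (A := fun a : UHFMonoid => UHF (a : ℕ → ℕ)) p.1)
    (C0Sum.single (A := fun a : UHFMonoid => UHF (a : ℕ → ℕ)) p.2)

/-- The element `(ι_b ⊗ ι_c)(φ_{b,c}(x_{b·c}))` of `A(*) ⊗ A(*)`, where `x_{b·c}` is the component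
of `x` in `A(b·c)`. -/
def comulTerm (p : UHFMonoid × UHFMonoid) : UHFSum →⋆ₙₐ[ℂ] MinTensor UHFSum UHFSum :=
  (comulBlock p).comp (C0Sum.proj (p.1 * p.2))

theorem C0Sum.single_mul_single_of_ne {ι : Type*} {A : ι → Type*} [∀ i, NonUnitalCStarAlgebra (A i)]
    {i j : ι} (h : i ≠ j) (x : A i) (y : A j) : C0Sum.single i x * C0Sum.single j y = 0 :=
  C0Sum.ext fun k => by
    change (C0Sum.single i x).coord k * (C0Sum.single j y).coord k = 0
    by_cases hk : k = i
    · subst hk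
      rw [C0Sum.coord_single_of_ne h y, mul_zero]
    · rw [C0Sum.coord_single_of_ne hk, zero_mul]

theorem comulBlock_ofMatrix (p : UHFMonoid × UHFMonoid) (n : ℕ)
    (M : UHFMatrix ((p.1 * p.2 : UHFMonoid) : ℕ → ℕ) n) :
    comulBlock p (UHF.ofMatrix _ n M) = kroneckerMatrixHom (b := (p.1 : ℕ → ℕ))
      (c := (p.2 : ℕ → ℕ)) (C0Sum.single (A := fun a : UHFMonoid => UHF (a : ℕ → ℕ)) p.1)
        (C0Sum.single (A := fun a : UHFMonoid => UHF (a : ℕ → ℕ)) p.2) n M :=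
  UHF.lift_ofMatrix _ _ n M

/-- On matrix units, `comulBlock` is `E_{J,K} ↦ ι_b(E_{J',K'}) ⊗ ι_c(E_{J'',K''})`. -/
theorem comulBlock_unit (p : UHFMonoid × UHFMonoid) (n : ℕ)
    (J K : UHFIndex ((p.1 : ℕ → ℕ) * (p.2 : ℕ → ℕ)) n) :
    comulBlock p (UHF.ofMatrix _ n (unit J K)) = MinTensor.tmul
      (C0Sum.single p.1 (UHF.ofMatrix (p.1 : ℕ → ℕ) n
        (unit (split _ _ n J).1 (split _ _ n K).1)) : UHFSum)
      (C0Sum.single p.2 (UHF.ofMatrix (p.2 : ℕ → ℕ) n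
        (unit (split _ _ n J).2 (split _ _ n K).2)) : UHFSum) :=
  kroneckerHom_unit (b := (p.1 : ℕ → ℕ)) (c := (p.2 : ℕ → ℕ)) _ _ n J K

theorem comulBlock_mul_tmul {p q : UHFMonoid × UHFMonoid} (h : p ≠ q)
    (x : UHF ((p.1 * p.2 : UHFMonoid) : ℕ → ℕ)) (y : UHF (q.1 : ℕ → ℕ)) (z : UHF (q.2 : ℕ → ℕ)) :
    comulBlock p x * MinTensor.tmul (C0Sum.single q.1 y : UHFSum) (C0Sum.single q.2 z : UHFSum)
      = 0 := by
  induction x using UHF.induction_on with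
  | hc =>
    exact isClosed_eq ((continuous_starAlgHom (comulBlock p)).mul continuous_const)
      continuous_const
  | h n M =>
    rw [comulBlock_ofMatrix]
    refine (Finset.sum_mul _ _ _).trans (Finset.sum_eq_zero fun J _ => ?_)
    refine (Finset.sum_mul _ _ _).trans (Finset.sum_eq_zero fun K _ => ?_)
    rw [smul_mul_assoc]
    refine Eq.trans (congrArg _ ?_) (smul_zero _)
    refine (MinTensor.tmul_mul_tmul _ _ _ _).trans ?_
    by_cases h1 : p.1 = q.1
    · have h2 : p.2 ≠ q.2 := fun h2 => h (Prod.ext h1 h2)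
      rw [C0Sum.single_mul_single_of_ne h2]
      exact map_zero (MinTensor.tmulₗ _)
    · rw [C0Sum.single_mul_single_of_ne h1]
      exact LinearMap.map_zero₂ MinTensor.tmulₗ _

theorem comulBlock_mul_comulBlock {p q : UHFMonoid × UHFMonoid} (h : p ≠ q)
    (x : UHF ((p.1 * p.2 : UHFMonoid) : ℕ → ℕ)) (y : UHF ((q.1 * q.2 : UHFMonoid) : ℕ → ℕ)) :
    comulBlock p x * comulBlock q y = 0 := by
  induction y using UHF.induction_on with
  | hc =>
    exact isClosed_eq (continuous_const.mul (continuous_starAlgHom (comulBlock q)))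
      continuous_const
  | h n M =>
    rw [comulBlock_ofMatrix]
    refine (Finset.mul_sum _ _ _).trans (Finset.sum_eq_zero fun J _ => ?_)
    refine (Finset.mul_sum _ _ _).trans (Finset.sum_eq_zero fun K _ => ?_)
    rw [mul_smul_comm]
    exact (congrArg _ (comulBlock_mul_tmul h x _ _)).trans (smul_zero _)

theorem comulTerm_mul_comulTerm {p q : UHFMonoid × UHFMonoid} (h : p ≠ q) (x y : UHFSum) :
    comulTerm p x * comulTerm q y = 0 :=
  comulBlock_mul_comulBlock h _ _

/-- The finite partial sums of the comultiplication. -/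
def comulPartial (F : Finset (UHFMonoid × UHFMonoid)) :
    UHFSum →⋆ₙₐ[ℂ] MinTensor UHFSum UHFSum where
  toFun x := ∑ p ∈ F, comulTerm p x
  map_smul' c x := by simp only [map_smul, Finset.smul_sum, MonoidHom.id_apply]
  map_zero' := by simp only [map_zero, Finset.sum_const_zero]
  map_add' x y := by simp only [map_add, Finset.sum_add_distrib]
  map_mul' x y := by
    rw [Finset.sum_mul]
    refine Finset.sum_congr rfl fun p hp => ?_
    rw [Finset.mul_sum, Finset.sum_eq_single p, map_mul]
    · exact fun q _ hq => comulTerm_mul_comulTerm hq.symm x y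
    · exact fun h => absurd hp h
  map_star' x := by simp only [map_star, star_sum]

theorem norm_sum_comulTerm_le (F : Finset (UHFMonoid × UHFMonoid)) (x : UHFSum) :
    ‖∑ p ∈ F, comulTerm p x‖ ≤ ‖x‖ :=
  NonUnitalStarAlgHom.norm_apply_le (comulPartial F) x

theorem norm_sum_comulTerm_mul_le (F : Finset (UHFMonoid × UHFMonoid)) (x : UHFSum)
    (t : MinTensor UHFSum UHFSum) : ‖∑ p ∈ F, comulTerm p x * t‖ ≤ ‖x‖ * ‖t‖ := by
  rw [← Finset.sum_mul]
  exact (norm_mul_le _ _).trans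
    (mul_le_mul_of_nonneg_right (norm_sum_comulTerm_le F x) (norm_nonneg _))

theorem isClosed_summable_comulTerm (x : UHFSum) :
    IsClosed {t : MinTensor UHFSum UHFSum | Summable fun p => comulTerm p x * t} := by
  refine isClosed_of_closure_subset fun t ht => ?_
  refine summable_iff_vanishing_norm.2 fun ε hε => ?_
  obtain ⟨s, hs, hd⟩ := Metric.mem_closure_iff.1 ht (ε / (2 * (‖x‖ + 1))) (by positivity)
  obtain ⟨F₀, hF₀⟩ := summable_iff_vanishing_norm.1 hs (ε / 2) (half_pos hε)
  refine ⟨F₀, fun F hF => ?_⟩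
  have h1 : ∑ p ∈ F, comulTerm p x * t =
      ∑ p ∈ F, comulTerm p x * (t - s) + ∑ p ∈ F, comulTerm p x * s := by
    rw [← Finset.sum_add_distrib]
    refine Finset.sum_congr rfl fun p _ => ?_
    rw [← mul_add, sub_add_cancel]
  have h2 : ‖∑ p ∈ F, comulTerm p x * (t - s)‖ ≤ ‖x‖ * ‖t - s‖ := norm_sum_comulTerm_mul_le F x _
  rw [dist_eq_norm, lt_div_iff₀ (by positivity)] at hd
  have h3 : ‖x‖ * ‖t - s‖ ≤ ε / 2 := by nlinarith [norm_nonneg (t - s), norm_nonneg x]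
  rw [h1]
  exact (norm_add_le _ _).trans_lt (by linarith [hF₀ F hF])

theorem MinTensor.continuous_tmul_left {A B : Type*} [NonUnitalCStarAlgebra A]
    [NonUnitalCStarAlgebra B] (b : B) : Continuous fun a : A => MinTensor.tmul a b :=
  AddMonoidHomClass.continuous_of_bound (MinTensor.tmulₗ.flip b : A →ₗ[ℂ] MinTensor A B) ‖b‖
    fun a => (MinTensor.norm_tmul_le a b).trans_eq (mul_comm _ _)

theorem MinTensor.continuous_tmul_right {A B : Type*} [NonUnitalCStarAlgebra A]
    [NonUnitalCStarAlgebra B] (a : A) : Continuous fun b : B => MinTensor.tmul a b :=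
  AddMonoidHomClass.continuous_of_bound (MinTensor.tmulₗ a : B →ₗ[ℂ] MinTensor A B) ‖a‖
    fun b => MinTensor.norm_tmul_le a b

theorem summable_comulTerm_mul (x : UHFSum) (t : MinTensor UHFSum UHFSum) :
    Summable fun p => comulTerm p x * t := by
  have h0 : Summable fun p => comulTerm p x * (0 : MinTensor UHFSum UHFSum) := by
    simp only [mul_zero]; exact summable_zero
  have hadd : ∀ s t : MinTensor UHFSum UHFSum, (Summable fun p => comulTerm p x * s) →
      (Summable fun p => comulTerm p x * t) → Summable fun p => comulTerm p x * (s + t) :=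
    fun s t hs ht => by simp only [mul_add]; exact hs.add ht
  induction t using MinTensor.induction_on with
  | hc => exact isClosed_summable_comulTerm x
  | h0 => exact h0
  | ha s t hs ht => exact hadd s t hs ht
  | ht u v =>
    induction u using C0Sum.induction_on with
    | hc => exact (isClosed_summable_comulTerm x).preimage (MinTensor.continuous_tmul_left v)
    | h0 =>
      rw [show MinTensor.tmul (0 : UHFSum) v = 0 from LinearMap.map_zero₂ MinTensor.tmulₗ v]
      exact h0
    | ha u u' hu hu' => rw [MinTensor.add_tmul]; exact hadd _ _ hu hu'
    | hs b y =>
      induction v using C0Sum.induction_on with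
      | hc => exact (isClosed_summable_comulTerm x).preimage (MinTensor.continuous_tmul_right _)
      | h0 =>
        rw [show MinTensor.tmul (C0Sum.single b y : UHFSum) (0 : UHFSum) = 0 from
          map_zero (MinTensor.tmulₗ _)]
        exact h0
      | ha v v' hv hv' => rw [MinTensor.tmul_add]; exact hadd _ _ hv hv'
      | hs c z =>
        refine summable_of_ne_finset_zero (s := {(b, c)}) fun p hp => ?_
        exact comulBlock_mul_tmul (q := (b, c)) (fun h => hp (Finset.mem_singleton.2 h)) _ y z

theorem star_mul_comulTerm (p) (x : UHFSum) (t : MinTensor UHFSum UHFSum) :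
    star (t * comulTerm p x) = comulTerm p (star x) * star t := by
  rw [star_mul, map_star]

theorem summable_mul_comulTerm (x : UHFSum) (t : MinTensor UHFSum UHFSum) :
    Summable fun p => t * comulTerm p x := by
  have h := (summable_comulTerm_mul (star x) (star t)).star
  refine h.congr fun p => ?_
  rw [← star_mul_comulTerm, star_star]

theorem norm_tsum_comulTerm_mul_le (x : UHFSum) (t : MinTensor UHFSum UHFSum) :
    ‖∑' p, comulTerm p x * t‖ ≤ ‖x‖ * ‖t‖ :=
  le_of_tendsto (summable_comulTerm_mul x t).hasSum.norm
    (Eventually.of_forall fun F => norm_sum_comulTerm_mul_le F x t)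

theorem norm_tsum_mul_comulTerm_le (x : UHFSum) (t : MinTensor UHFSum UHFSum) :
    ‖∑' p, t * comulTerm p x‖ ≤ ‖x‖ * ‖t‖ := by
  have h := norm_tsum_comulTerm_mul_le (star x) (star t)
  rw [norm_star, norm_star] at h
  refine Eq.trans_le ?_ h
  rw [← norm_star, tsum_star]
  simp only [star_mul_comulTerm]

/-- The multiplier `Δ(x)` of `A(*) ⊗ A(*)`: it is the family of all `φ_{b,c}(x_{b·c})`, an element
of the direct product of the C*-algebras `A(b) ⊗ A(c)`, acting on `A(*) ⊗ A(*)` by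
`Δ(x) t = ∑ (ι_b ⊗ ι_c)(φ_{b,c}(x_{b·c})) t` and `t Δ(x) = ∑ t (ι_b ⊗ ι_c)(φ_{b,c}(x_{b·c}))`, the
sums being taken over all pairs `(b, c)`. -/
def comulMultiplier (x : UHFSum) : 𝓜(ℂ, MinTensor UHFSum UHFSum) where
  fst := LinearMap.mkContinuous
    { toFun := fun t => ∑' p, comulTerm p x * t
      map_add' := fun s t => by
        simp only [mul_add]
        exact (summable_comulTerm_mul x s).tsum_add (summable_comulTerm_mul x t)
      map_smul' := fun c t => by
        simp only [mul_smul_comm]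
        exact (summable_comulTerm_mul x t).tsum_const_smul c } ‖x‖
    (norm_tsum_comulTerm_mul_le x)
  snd := LinearMap.mkContinuous
    { toFun := fun t => ∑' p, t * comulTerm p x
      map_add' := fun s t => by
        simp only [add_mul]
        exact (summable_mul_comulTerm x s).tsum_add (summable_mul_comulTerm x t)
      map_smul' := fun c t => by
        simp only [smul_mul_assoc]
        exact (summable_mul_comulTerm x t).tsum_const_smul c } ‖x‖
    (norm_tsum_mul_comulTerm_le x)
  central := fun s t => by
    change (∑' p, s * comulTerm p x) * t = s * ∑' p, comulTerm p x * t
    rw [← (summable_mul_comulTerm x s).tsum_mul_right, ← (summable_comulTerm_mul x t).tsum_mul_left]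
    simp only [mul_assoc]

theorem comulMultiplier_fst (x : UHFSum) (t : MinTensor UHFSum UHFSum) :
    (comulMultiplier x).fst t = ∑' p, comulTerm p x * t := rfl

theorem comulMultiplier_snd (x : UHFSum) (t : MinTensor UHFSum UHFSum) :
    (comulMultiplier x).snd t = ∑' p, t * comulTerm p x := rfl

theorem comulTerm_mul_fst (p) (x y : UHFSum) (t : MinTensor UHFSum UHFSum) :
    comulTerm p x * (comulMultiplier y).fst t = comulTerm p (x * y) * t := by
  rw [comulMultiplier_fst, ← (summable_comulTerm_mul y t).tsum_mul_left, tsum_eq_single p]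
  · rw [← mul_assoc, map_mul]
  · intro q hq
    rw [← mul_assoc, comulTerm_mul_comulTerm hq.symm, zero_mul]

theorem snd_mul_comulTerm (p) (x y : UHFSum) (t : MinTensor UHFSum UHFSum) :
    (comulMultiplier x).snd t * comulTerm p y = t * comulTerm p (x * y) := by
  rw [comulMultiplier_snd, ← (summable_mul_comulTerm x t).tsum_mul_right, tsum_eq_single p]
  · rw [mul_assoc, map_mul]
  · intro q hq
    rw [mul_assoc, comulTerm_mul_comulTerm hq, mul_zero]

/-- The comultiplication `Δ_φ : A(*) → M(A(*) ⊗ A(*))`. -/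
def uhfComul : UHFSum →⋆ₙₐ[ℂ] 𝓜(ℂ, MinTensor UHFSum UHFSum) where
  toFun := comulMultiplier
  map_smul' c x := by
    refine DoubleCentralizer.ext ℂ _ _ _ (Prod.ext ?_ ?_)
    · ext t
      change ∑' p, comulTerm p (c • x) * t = c • ∑' p, comulTerm p x * t
      rw [← (summable_comulTerm_mul x t).tsum_const_smul c]
      simp only [map_smul, smul_mul_assoc]
    · ext t
      change ∑' p, t * comulTerm p (c • x) = c • ∑' p, t * comulTerm p x
      rw [← (summable_mul_comulTerm x t).tsum_const_smul c]
      simp only [map_smul, mul_smul_comm]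
  map_zero' := by
    refine DoubleCentralizer.ext ℂ _ _ _ (Prod.ext ?_ ?_)
    · ext t
      change ∑' p, comulTerm p 0 * t = 0
      simp only [map_zero, zero_mul, tsum_zero]
    · ext t
      change ∑' p, t * comulTerm p 0 = 0
      simp only [map_zero, mul_zero, tsum_zero]
  map_add' x y := by
    refine DoubleCentralizer.ext ℂ _ _ _ (Prod.ext ?_ ?_)
    · ext t
      change ∑' p, comulTerm p (x + y) * t = (∑' p, comulTerm p x * t) + ∑' p, comulTerm p y * t
      rw [← (summable_comulTerm_mul x t).tsum_add (summable_comulTerm_mul y t)]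
      simp only [map_add, add_mul]
    · ext t
      change ∑' p, t * comulTerm p (x + y) = (∑' p, t * comulTerm p x) + ∑' p, t * comulTerm p y
      rw [← (summable_mul_comulTerm x t).tsum_add (summable_mul_comulTerm y t)]
      simp only [map_add, mul_add]
  map_mul' x y := by
    refine DoubleCentralizer.ext ℂ _ _ _ (Prod.ext ?_ ?_)
    · ext t
      change ∑' p, comulTerm p (x * y) * t = ∑' p, comulTerm p x * (comulMultiplier y).fst t
      simp only [comulTerm_mul_fst]
    · ext t
      change ∑' p, t * comulTerm p (x * y) = ∑' p, (comulMultiplier x).snd t * comulTerm p y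
      simp only [snd_mul_comulTerm]
  map_star' x := by
    refine DoubleCentralizer.ext ℂ _ _ _ (Prod.ext ?_ ?_)
    · ext t
      change ∑' p, comulTerm p (star x) * t = star (∑' p, star t * comulTerm p x)
      rw [tsum_star]
      simp only [star_mul_comulTerm, star_star]
    · ext t
      change ∑' p, t * comulTerm p (star x) = star (∑' p, comulTerm p x * star t)
      rw [tsum_star]
      simp only [star_mul, map_star, star_star]

instance uniqueIndexOne (n : ℕ) : Unique (UHFIndex 1 n) :=
  inferInstanceAs (Unique (Fin n → Fin 1))

/-- The identification of `M_1 ⊗ ⋯ ⊗ M_1` with `ℂ`. -/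
def matrixOneHom (n : ℕ) : UHFMatrix 1 n →⋆ₙₐ[ℂ] ℂ where
  toFun M := M.entry default default
  map_smul' _ _ := rfl
  map_zero' := rfl
  map_add' _ _ := rfl
  map_mul' M N := by rw [entry_mul, Fintype.sum_unique]
  map_star' _ := rfl

theorem matrixOneHom_uhfEmbed (n m : ℕ) (h : n ≤ m) (M : UHFMatrix 1 n) :
    matrixOneHom m (uhfEmbed 1 n m h M) = matrixOneHom n M := by
  change (uhfEmbed 1 n m h M).entry default default = M.entry default default
  rw [entry_uhfEmbed, if_pos (SameTail.refl _), Subsingleton.elim (trunc h default) default]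

/-- The identification of `A(1)` with `ℂ`, where `1` is the constant sequence. -/
def uhfOneHom : UHF 1 →⋆ₙₐ[ℂ] ℂ := UHF.lift matrixOneHom matrixOneHom_uhfEmbed

theorem algebraMap_uhfOneHom (x : UHF 1) : algebraMap ℂ (UHF 1) (uhfOneHom x) = x := by
  induction x using UHF.induction_on with
  | hc =>
    exact isClosed_eq ((continuous_algebraMap ℂ (UHF 1)).comp
      (continuous_starAlgHom uhfOneHom)) continuous_id
  | h n M =>
    have h1 : M = algebraMap ℂ (UHFMatrix 1 n) (M.entry default default) :=
      UHFMatrix.ext fun J K => by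
        rw [Algebra.algebraMap_eq_smul_one, entry_smul, entry_one,
          if_pos (Subsingleton.elim J K), mul_one, Subsingleton.elim J default,
          Subsingleton.elim K default]
    have h2 : uhfOneHom (UHF.ofMatrix 1 n M) = M.entry default default :=
      UHF.lift_ofMatrix matrixOneHom matrixOneHom_uhfEmbed n M
    rw [h2]
    conv_rhs => rw [h1]
    exact (AlgHomClass.commutes (UHF.ofMatrix 1 n) _).symm

theorem uhfOneHom_algebraMap (z : ℂ) : uhfOneHom (algebraMap ℂ (UHF 1) z) = z := by
  rw [← AlgHomClass.commutes (UHF.ofMatrix 1 0) z]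
  refine (UHF.lift_ofMatrix matrixOneHom matrixOneHom_uhfEmbed 0 _).trans ?_
  change (algebraMap ℂ (UHFMatrix 1 0) z).entry default default = z
  rw [Algebra.algebraMap_eq_smul_one, entry_smul, entry_one, if_pos rfl, mul_one]

/-- The isomorphism `A(1) = ℂ`. -/
def uhfOneEquiv : UHF 1 ≃⋆ₐ[ℂ] ℂ where
  toFun := uhfOneHom
  invFun := algebraMap ℂ (UHF 1)
  left_inv := algebraMap_uhfOneHom
  right_inv := uhfOneHom_algebraMap
  map_mul' := map_mul uhfOneHom
  map_add' := map_add uhfOneHom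
  map_star' := map_star uhfOneHom
  map_smul' := map_smul uhfOneHom

/-- The map `ε : A(*) → ℂ`: the projection of `A(*)` onto its summand `A(1) = ℂ`. -/
def uhfCounit : UHFSum →⋆ₙₐ[ℂ] ℂ where
  toFun x := uhfOneEquiv (C0Sum.proj (1 : UHFMonoid) x)
  map_smul' c x := by rw [map_smul]; exact map_smul uhfOneHom c _
  map_zero' := by rw [map_zero]; exact map_zero uhfOneHom
  map_add' x y := by rw [map_add]; exact map_add uhfOneHom _ _
  map_mul' x y := by rw [map_mul]; exact map_mul uhfOneHom _ _
  map_star' x := by rw [map_star]; exact map_star uhfOneHom _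

end Comultiplication

/-!
The homomorphisms `φ_{b,c}` embed `A(b·c)` into `A(*) ⊗ A(*)` with mutually orthogonal ranges whose
span is dense. Hence `A(*) ⊗ A(*)` is a `c₀`-sum of the blocks `A(b·c)`, its multipliers are the
bounded families in these blocks, and a multiplier lies in the algebra as soon as its components
tend to zero. In these coordinates `Δ x` has the components `x_{b·c}`, and both sides of each axiom
are multiplier-valued maps that are compared block by block: coassociativity is the associativity
of the Kronecker product of matrices. Properness and cancellation follow because
`(b, c) ↦ (b·c, c)` and `(b, c) ↦ (b·c, b)` are injective. Cocommutativity would identify `x ⊗ y`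
and `y ⊗ x` in `A(b·c)`, which fails because the Kronecker product of matrices is not commutative.
-/

noncomputable section C0SumOperations

open Filter Topology

namespace C0Sum

variable {ι : Type*} {A : ι → Type*} [∀ i, NonUnitalCStarAlgebra (A i)]

theorem coord_zero (i : ι) : (0 : C0Sum A).coord i = 0 := rfl

theorem coord_add (x y : C0Sum A) (i : ι) : (x + y).coord i = x.coord i + y.coord i := rfl

theorem coord_mul (x y : C0Sum A) (i : ι) : (x * y).coord i = x.coord i * y.coord i := rfl

theorem coord_smul (c : ℂ) (x : C0Sum A) (i : ι) : (c • x).coord i = c • x.coord i := rfl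

theorem coord_star (x : C0Sum A) (i : ι) : (star x).coord i = star (x.coord i) := rfl

theorem single_injective (i : ι) : Function.Injective (single (A := A) i) := fun a b h => by
  rw [← coord_single_same i a, h, coord_single_same]

theorem eq_single {x : C0Sum A} {i : ι} (h : ∀ j, j ≠ i → x.coord j = 0) :
    x = single i (x.coord i) := ext fun j => by
  by_cases hj : j = i
  · subst hj; rw [coord_single_same]
  · rw [h j hj, coord_single_of_ne hj]

theorem mul_single (x : C0Sum A) (i : ι) (a : A i) :
    x * single i a = single i (x.coord i * a) := by
  rw [eq_single (x := x * single i a) (i := i), coord_mul, coord_single_same]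
  exact fun j hj => by rw [coord_mul, coord_single_of_ne hj, mul_zero]

theorem coord_sum_single (F : Finset ι) [DecidableEq ι] (x : C0Sum A) (j : ι) :
    (∑ i ∈ F, single i (x.coord i)).coord j = if j ∈ F then x.coord j else 0 := by
  rw [← proj_apply, map_sum]
  split_ifs with hj
  · rw [Finset.sum_eq_single_of_mem j hj fun i _ hij => coord_single_of_ne hij.symm _,
      proj_apply, coord_single_same]
  · exact Finset.sum_eq_zero fun i hi => coord_single_of_ne (ne_of_mem_of_not_mem hi hj).symm _

theorem mul_incl_mem (f : lp A ∞) (x : C0Sum A) : f * incl x ∈ c0Subalgebra A :=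
  squeeze_zero (fun _ => norm_nonneg _)
    (fun i => (norm_mul_le _ _).trans
      (mul_le_mul_of_nonneg_right (lp.norm_apply_le_norm ENNReal.top_ne_zero f i) (norm_nonneg _)))
    (mul_zero ‖f‖ ▸ x.tendsto_norm_coord.const_mul ‖f‖)

theorem incl_mul_mem (f : lp A ∞) (x : C0Sum A) : incl x * f ∈ c0Subalgebra A :=
  squeeze_zero (fun _ => norm_nonneg _)
    (fun i => (norm_mul_le _ _).trans
      (mul_le_mul_of_nonneg_left (lp.norm_apply_le_norm ENNReal.top_ne_zero f i) (norm_nonneg _)))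
    (zero_mul ‖f‖ ▸ x.tendsto_norm_coord.mul_const ‖f‖)

/-- Bounded families are multipliers of the direct sum: the operator of left multiplication. -/
def mulLeft (f : lp A ∞) : C0Sum A →L[ℂ] C0Sum A :=
  LinearMap.mkContinuous
    { toFun := fun x => ⟨f * incl x, mul_incl_mem f x⟩
      map_add' := fun _ _ => ext fun _ => mul_add _ _ _
      map_smul' := fun c _ => ext fun _ => mul_smul_comm c _ _ } ‖f‖
    fun x => norm_mul_le f (incl x)

/-- Bounded families are multipliers of the direct sum: the operator of right multiplication. -/
def mulRight (f : lp A ∞) : C0Sum A →L[ℂ] C0Sum A :=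
  LinearMap.mkContinuous
    { toFun := fun x => ⟨incl x * f, incl_mul_mem f x⟩
      map_add' := fun _ _ => ext fun _ => add_mul _ _ _
      map_smul' := fun c _ => ext fun _ => smul_mul_assoc c _ _ } ‖f‖
    fun x => (norm_mul_le (incl x) f).trans_eq (mul_comm _ _)

theorem coord_mulLeft (f : lp A ∞) (x : C0Sum A) (i : ι) :
    (mulLeft f x).coord i = f i * x.coord i := rfl

theorem mulLeft_single (f : lp A ∞) (i : ι) (a : A i) :
    mulLeft f (single i a) = single i (f i * a) := by
  rw [eq_single (x := mulLeft f (single i a)) (i := i), coord_mulLeft, coord_single_same]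
  exact fun j hj => by rw [coord_mulLeft, coord_single_of_ne hj, mul_zero]

end C0Sum

end C0SumOperations

noncomputable section BlockDecomposition

open Filter Topology

/-- A family of injective `*`-homomorphisms `β i : B i → C` with mutually orthogonal ranges whose
sum is dense in `C`. It exhibits `C` as the direct sum of the C*-algebras `B i`. -/
structure IsBlockDecomposition {ι : Type*} {B : ι → Type*} [∀ i, NonUnitalCStarAlgebra (B i)]
    {C : Type*} [NonUnitalCStarAlgebra C] (β : ∀ i, B i →⋆ₙₐ[ℂ] C) : Prop where
  orthogonal : ∀ i j, i ≠ j → ∀ x y, β i x * β j y = 0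
  injective : ∀ i, Function.Injective (β i)
  dense : Dense (Submodule.span ℂ {t : C | ∃ i x, t = β i x} : Set C)

namespace IsBlockDecomposition

variable {ι : Type*} {B : ι → Type*} [∀ i, NonUnitalCStarAlgebra (B i)]
  {C : Type*} [NonUnitalCStarAlgebra C] {β : ∀ i, B i →⋆ₙₐ[ℂ] C}

theorem induction_on (hβ : IsBlockDecomposition β) {P : C → Prop} (hc : IsClosed {t | P t})
    (h0 : P 0) (hb : ∀ i x, P (β i x)) (ha : ∀ s t, P s → P t → P (s + t)) (t : C) : P t := by
  have hspan : (Submodule.span ℂ {t : C | ∃ i x, t = β i x} : Set C) ⊆ {t | P t} := by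
    intro t ht
    induction ht using Submodule.closure_induction with
    | zero => exact h0
    | add x y _ _ hx hy => exact ha x y hx hy
    | smul_mem c x hx =>
      obtain ⟨i, x, rfl⟩ := hx
      rw [← map_smul]
      exact hb i _
  exact hc.closure_subset_iff.2 hspan (hβ.dense t)

/-- The finite partial sums of the map `x ↦ ∑ β i (x i)`, which are `*`-homomorphisms because the
blocks are orthogonal. -/
def partialHom (hβ : IsBlockDecomposition β) (F : Finset ι) : C0Sum B →⋆ₙₐ[ℂ] C where
  toFun x := ∑ i ∈ F, β i (x.coord i)
  map_smul' c x := by simp only [C0Sum.coord_smul, map_smul, Finset.smul_sum, MonoidHom.id_apply]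
  map_zero' := by simp only [C0Sum.coord_zero, map_zero, Finset.sum_const_zero]
  map_add' x y := by simp only [C0Sum.coord_add, map_add, Finset.sum_add_distrib]
  map_mul' x y := by
    rw [Finset.sum_mul]
    refine Finset.sum_congr rfl fun i hi => ?_
    rw [Finset.mul_sum, Finset.sum_eq_single_of_mem i hi fun j _ hj =>
      hβ.orthogonal i j hj.symm _ _, C0Sum.coord_mul, map_mul]
  map_star' x := by simp only [C0Sum.coord_star, map_star, star_sum]

-- A `*`-homomorphism is contractive; truncate `x` to `F` before applying it.
theorem norm_sum_le (hβ : IsBlockDecomposition β) (F : Finset ι) (x : C0Sum B) {r : ℝ}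
    (hr : 0 ≤ r) (h : ∀ i ∈ F, ‖x.coord i‖ ≤ r) : ‖∑ i ∈ F, β i (x.coord i)‖ ≤ r := by
  classical
  have htrunc : hβ.partialHom F (∑ i ∈ F, C0Sum.single i (x.coord i)) =
      ∑ i ∈ F, β i (x.coord i) :=
    Finset.sum_congr rfl fun i hi => by rw [C0Sum.coord_sum_single, if_pos hi]
  rw [← htrunc]
  refine (NonUnitalStarAlgHom.norm_apply_le _ _).trans (C0Sum.norm_le hr fun i => ?_)
  rw [C0Sum.coord_sum_single]
  split_ifs with hi
  · exact h i hi
  · rwa [norm_zero]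

theorem summable (hβ : IsBlockDecomposition β) (x : C0Sum B) :
    Summable fun i => β i (x.coord i) := by
  refine summable_iff_vanishing_norm.2 fun ε hε => ?_
  have hfin := (Metric.tendsto_nhds.1 x.tendsto_norm_coord) (ε / 2) (half_pos hε)
  rw [eventually_cofinite] at hfin
  refine ⟨hfin.toFinset, fun F hF => ?_⟩
  refine (hβ.norm_sum_le F x (half_pos hε).le fun i hi => ?_).trans_lt (half_lt_self hε)
  by_contra hlt
  refine Finset.disjoint_left.1 hF hi (hfin.mem_toFinset.2 fun h => hlt ?_)
  simpa using h.le

theorem tsum_mul (hβ : IsBlockDecomposition β) (x : C0Sum B) (i : ι) (y : B i) :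
    (∑' j, β j (x.coord j)) * β i y = β i (x.coord i * y) := by
  rw [← (hβ.summable x).tsum_mul_right, tsum_eq_single i, map_mul]
  exact fun j hj => hβ.orthogonal j i hj _ _

/-- The `*`-homomorphism `x ↦ ∑ β i (x i)`. -/
def sumHom (hβ : IsBlockDecomposition β) : C0Sum B →⋆ₙₐ[ℂ] C where
  toFun x := ∑' i, β i (x.coord i)
  map_smul' c x := by
    simp only [C0Sum.coord_smul, map_smul, MonoidHom.id_apply]
    exact (hβ.summable x).tsum_const_smul c
  map_zero' := by simp only [C0Sum.coord_zero, map_zero, tsum_zero]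
  map_add' x y := by
    simp only [C0Sum.coord_add, map_add]
    exact (hβ.summable x).tsum_add (hβ.summable y)
  map_mul' x y := by
    rw [← (hβ.summable y).tsum_mul_left]
    simp only [hβ.tsum_mul, C0Sum.coord_mul]
  map_star' x := by
    rw [tsum_star]
    simp only [C0Sum.coord_star, map_star]

theorem sumHom_apply (hβ : IsBlockDecomposition β) (x : C0Sum B) :
    hβ.sumHom x = ∑' i, β i (x.coord i) := rfl

theorem sumHom_single (hβ : IsBlockDecomposition β) (i : ι) (y : B i) :
    hβ.sumHom (C0Sum.single i y) = β i y := by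
  rw [sumHom_apply, tsum_eq_single i, C0Sum.coord_single_same]
  intro j hj
  rw [C0Sum.coord_single_of_ne hj, map_zero]

theorem sumHom_injective (hβ : IsBlockDecomposition β) : Function.Injective hβ.sumHom := by
  refine (injective_iff_map_eq_zero hβ.sumHom).2 fun x hx => C0Sum.ext fun i => ?_
  have h := hβ.tsum_mul x i (star (x.coord i))
  rw [← hβ.sumHom_apply, hx, zero_mul, ← map_zero (β i)] at h
  exact CStarRing.mul_star_self_eq_zero_iff _ |>.1 (hβ.injective i h).symm

theorem sumHom_surjective (hβ : IsBlockDecomposition β) : Function.Surjective hβ.sumHom := by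
  intro t
  induction t using hβ.induction_on with
  | hc =>
    exact (NonUnitalStarAlgHom.isometry _ hβ.sumHom_injective).isClosedEmbedding.isClosed_range
  | h0 => exact ⟨0, map_zero _⟩
  | hb i x => exact ⟨_, hβ.sumHom_single i x⟩
  | ha s t hs ht =>
    obtain ⟨x, rfl⟩ := hs
    obtain ⟨y, rfl⟩ := ht
    exact ⟨x + y, map_add _ _ _⟩

/-- The isomorphism of the direct sum of the C*-algebras `B i` with `C`. -/
def equiv (hβ : IsBlockDecomposition β) : C0Sum B ≃⋆ₐ[ℂ] C :=
  StarAlgEquiv.ofBijective hβ.sumHom ⟨hβ.sumHom_injective, hβ.sumHom_surjective⟩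

theorem equiv_single (hβ : IsBlockDecomposition β) (i : ι) (y : B i) :
    hβ.equiv (C0Sum.single i y) = β i y := hβ.sumHom_single i y

theorem equiv_symm_apply (hβ : IsBlockDecomposition β) (i : ι) (y : B i) :
    hβ.equiv.symm (β i y) = C0Sum.single i y := by
  rw [← hβ.equiv_single, StarAlgEquiv.symm_apply_apply]

/-- The component of an element of `C` in the block `B i`. -/
def component (hβ : IsBlockDecomposition β) (i : ι) : C →⋆ₙₐ[ℂ] B i :=
  (C0Sum.proj i).comp hβ.equiv.symm.toNonUnitalStarAlgHom

theorem component_apply (hβ : IsBlockDecomposition β) (i : ι) (t : C) :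
    hβ.component i t = (hβ.equiv.symm t).coord i := rfl

theorem component_same (hβ : IsBlockDecomposition β) (i : ι) (y : B i) :
    hβ.component i (β i y) = y := by
  rw [component_apply, equiv_symm_apply, C0Sum.coord_single_same]

theorem component_of_ne (hβ : IsBlockDecomposition β) {i j : ι} (h : j ≠ i) (y : B i) :
    hβ.component j (β i y) = 0 := by
  rw [component_apply, equiv_symm_apply, C0Sum.coord_single_of_ne h]

theorem mul_block (hβ : IsBlockDecomposition β) (t : C) (i : ι) (y : B i) :
    t * β i y = β i (hβ.component i t * y) := by
  apply EquivLike.injective hβ.equiv.symm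
  rw [map_mul, equiv_symm_apply, equiv_symm_apply, C0Sum.mul_single, component_apply]

theorem reindex (hβ : IsBlockDecomposition β) {κ : Type*} {D : κ → Type*}
    [∀ k, NonUnitalCStarAlgebra (D k)] (e : κ ≃ ι) (θ : ∀ k, D k →⋆ₙₐ[ℂ] B (e k))
    (hθ : ∀ k, Function.Bijective (θ k)) :
    IsBlockDecomposition (B := D) fun k => (β (e k)).comp (θ k) where
  orthogonal _ _ h _ _ := hβ.orthogonal _ _ (e.injective.ne h) _ _
  injective k := (hβ.injective _).comp (hθ k).1
  dense := by
    refine hβ.dense.mono (Submodule.span_mono ?_)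
    rintro _ ⟨i, x, rfl⟩
    obtain ⟨k, rfl⟩ := e.surjective i
    obtain ⟨y, rfl⟩ := (hθ k).2 x
    exact ⟨k, y, rfl⟩

end IsBlockDecomposition

theorem C0Sum.isBlockDecomposition_single {ι : Type*} (A : ι → Type*)
    [∀ i, NonUnitalCStarAlgebra (A i)] :
    IsBlockDecomposition fun i => C0Sum.single (A := A) i where
  orthogonal _ _ h := C0Sum.single_mul_single_of_ne h
  injective := C0Sum.single_injective
  dense x := by
    induction x using C0Sum.induction_on with
    | hc => exact isClosed_closure
    | h0 => exact subset_closure (zero_mem _)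
    | hs i a => exact subset_closure (Submodule.subset_span ⟨i, a, rfl⟩)
    | ha x y hx hy => exact (Submodule.span ℂ _).topologicalClosure.add_mem hx hy

end BlockDecomposition

noncomputable section Multipliers

open DoubleCentralizer Filter Topology

section General

variable {C : Type*} [NonUnitalCStarAlgebra C]

theorem eq_of_forall_mul_left_eq {x y : C} (h : ∀ s, s * x = s * y) : x = y := by
  rw [← sub_eq_zero, ← CStarRing.star_mul_self_eq_zero_iff, mul_sub, h, sub_self]

theorem eq_of_forall_mul_right_eq {x y : C} (h : ∀ s, x * s = y * s) : x = y := by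
  rw [← sub_eq_zero, ← CStarRing.mul_star_self_eq_zero_iff, sub_mul, h, sub_self]

theorem multiplier_fst_mul (m : 𝓜(ℂ, C)) (x y : C) : m.fst (x * y) = m.fst x * y :=
  eq_of_forall_mul_left_eq fun s => by rw [← m.central, ← mul_assoc, ← mul_assoc, ← m.central]

theorem multiplier_ext_fst {m m' : 𝓜(ℂ, C)} (h : ∀ t, m.fst t = m'.fst t) : m = m' := by
  rw [← sub_eq_zero, ← norm_eq_zero, ← norm_fst, sub_fst, norm_eq_zero, sub_eq_zero]
  exact ContinuousLinearMap.ext h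

end General

namespace IsBlockDecomposition

variable {ι : Type*} {B : ι → Type*} [∀ i, CStarAlgebra (B i)]
  {C : Type*} [NonUnitalCStarAlgebra C] {β : ∀ i, B i →⋆ₙₐ[ℂ] C}

theorem fst_eq_component (hβ : IsBlockDecomposition β) (m : 𝓜(ℂ, C)) (i : ι) (y : B i) :
    m.fst (β i y) = β i (hβ.component i (m.fst (β i 1)) * y) := by
  conv_lhs => rw [← one_mul y, map_mul, multiplier_fst_mul]
  exact hβ.mul_block _ _ _

theorem snd_eq_component (hβ : IsBlockDecomposition β) (m : 𝓜(ℂ, C)) (i : ι) (y : B i) :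
    m.snd (β i y) = β i (y * hβ.component i (m.fst (β i 1))) :=
  eq_of_forall_mul_right_eq fun t => by
    induction t using hβ.induction_on with
    | hc => exact isClosed_eq (continuous_const_mul _) (continuous_const_mul _)
    | h0 => rw [mul_zero, mul_zero]
    | ha s t hs ht => rw [mul_add, mul_add, hs, ht]
    | hb j z =>
      rw [m.central, hβ.fst_eq_component]
      obtain rfl | h := eq_or_ne i j
      · rw [← map_mul, ← map_mul, mul_assoc]
      · rw [hβ.orthogonal i j h, hβ.orthogonal i j h]

/-- The component of a multiplier of `C` in the block `B i`. -/
def coeff (hβ : IsBlockDecomposition β) (i : ι) : 𝓜(ℂ, C) →⋆ₐ[ℂ] B i where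
  toFun m := hβ.component i (m.fst (β i 1))
  map_one' := hβ.component_same i 1
  map_mul' m m' := by
    change hβ.component i (m.fst (m'.fst (β i 1))) = _
    rw [hβ.fst_eq_component m', mul_one, hβ.fst_eq_component m, component_same, component_same]
  map_zero' := map_zero _
  map_add' m m' := map_add _ _ _
  commutes' c := by
    rw [algebraMap_fst, ContinuousLinearMap.algebraMap_apply, map_smul, component_same,
      Algebra.algebraMap_eq_smul_one]
  map_star' m := by
    rw [star_fst, ← map_star (β i), star_one, hβ.snd_eq_component, one_mul, ← map_star,
      component_same]

theorem fst_block (hβ : IsBlockDecomposition β) (m : 𝓜(ℂ, C)) (i : ι) (y : B i) :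
    m.fst (β i y) = β i (hβ.coeff i m * y) := hβ.fst_eq_component m i y

theorem coeff_eq (hβ : IsBlockDecomposition β) {m : 𝓜(ℂ, C)} {i : ι} {z : B i}
    (h : m.fst (β i 1) = β i z) : hβ.coeff i m = z :=
  (congrArg (hβ.component i) h).trans (hβ.component_same i z)

theorem coeff_coe (hβ : IsBlockDecomposition β) (i : ι) (t : C) :
    hβ.coeff i (t : 𝓜(ℂ, C)) = hβ.component i t :=
  hβ.coeff_eq ((hβ.mul_block t i 1).trans (by rw [mul_one]))

theorem multiplier_ext (hβ : IsBlockDecomposition β) {m m' : 𝓜(ℂ, C)}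
    (h : ∀ i, hβ.coeff i m = hβ.coeff i m') : m = m' := multiplier_ext_fst fun t => by
  induction t using hβ.induction_on with
  | hc => exact isClosed_eq m.fst.continuous m'.fst.continuous
  | h0 => rw [map_zero, map_zero]
  | hb i y => rw [hβ.fst_block, hβ.fst_block, h]
  | ha s t hs ht => rw [map_add, map_add, hs, ht]

theorem exists_eq_coe_of_tendsto (hβ : IsBlockDecomposition β) {m : 𝓜(ℂ, C)}
    (h : Tendsto (fun i => ‖hβ.coeff i m‖) cofinite (𝓝 0)) :
    ∃ t : C, m = (t : 𝓜(ℂ, C)) := by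
  let x : C0Sum B := ⟨⟨fun i => hβ.coeff i m, memℓp_infty h.bddAbove_range_of_cofinite⟩, h⟩
  refine ⟨hβ.equiv x, hβ.multiplier_ext fun i => ?_⟩
  rw [coeff_coe, component_apply, StarAlgEquiv.symm_apply_apply]
  rfl

/-- The multiplier of `C` defined by a bounded family of elements of the blocks. -/
def diagonal (hβ : IsBlockDecomposition β) (f : lp B ∞) : 𝓜(ℂ, C) :=
  let E : C0Sum B →L[ℂ] C := ⟨hβ.equiv, continuous_starAlgHom hβ.sumHom⟩
  let E' : C →L[ℂ] C0Sum B :=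
    ⟨hβ.equiv.symm, continuous_starAlgHom hβ.equiv.symm.toNonUnitalStarAlgHom⟩
  { fst := E ∘L C0Sum.mulLeft f ∘L E'
    snd := E ∘L C0Sum.mulRight f ∘L E'
    central := fun s t => by
      apply EquivLike.injective hβ.equiv.symm
      change hβ.equiv.symm (hβ.equiv _ * t) = hβ.equiv.symm (s * hβ.equiv _)
      rw [map_mul hβ.equiv.symm, map_mul hβ.equiv.symm, StarAlgEquiv.symm_apply_apply,
        StarAlgEquiv.symm_apply_apply]
      exact C0Sum.ext fun i => mul_assoc _ _ _ }

theorem coeff_diagonal (hβ : IsBlockDecomposition β) (f : lp B ∞) (i : ι) :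
    hβ.coeff i (hβ.diagonal f) = f i := hβ.coeff_eq <| by
  change hβ.equiv (C0Sum.mulLeft f (hβ.equiv.symm (β i 1))) = _
  rw [equiv_symm_apply, C0Sum.mulLeft_single, equiv_single, mul_one]

/-- The `*`-homomorphism to the multiplier algebra of `C` with given components. -/
def diagonalHom (hβ : IsBlockDecomposition β) {R : Type*} [CStarAlgebra R]
    (Θ : ∀ i, R →⋆ₐ[ℂ] B i) : R →⋆ₐ[ℂ] 𝓜(ℂ, C) where
  toFun x := hβ.diagonal ⟨fun i => Θ i x, memℓp_infty
    ⟨‖x‖, Set.forall_mem_range.2 fun i => NonUnitalStarAlgHom.norm_apply_le (Θ i) x⟩⟩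
  map_one' := hβ.multiplier_ext fun i => by simp only [coeff_diagonal, map_one]
  map_mul' x y := hβ.multiplier_ext fun i => by simp only [coeff_diagonal, map_mul]
  map_zero' := hβ.multiplier_ext fun i => by simp only [coeff_diagonal, map_zero]
  map_add' x y := hβ.multiplier_ext fun i => by simp only [coeff_diagonal, map_add]
  commutes' c := hβ.multiplier_ext fun i => by simp only [coeff_diagonal, AlgHomClass.commutes]
  map_star' x := hβ.multiplier_ext fun i => by simp only [coeff_diagonal, map_star]

section Pullback

variable (hβ : IsBlockDecomposition β) {κ : Type*} {D : κ → Type*} [∀ k, CStarAlgebra (D k)]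
    {E : Type*} [NonUnitalCStarAlgebra E] {γ : ∀ k, D k →⋆ₙₐ[ℂ] E} (hγ : IsBlockDecomposition γ)
    (e : κ → ι) (θ : ∀ k, B (e k) →⋆ₐ[ℂ] D k)

/-- The map of multiplier algebras `(m i) ↦ (θ k (m (e k)))`, where `m i` are the components of a
multiplier `m`. -/
def pullback : 𝓜(ℂ, C) →⋆ₐ[ℂ] 𝓜(ℂ, E) :=
  hγ.diagonalHom fun k => (θ k).comp (hβ.coeff (e k))

theorem coeff_pullback (m : 𝓜(ℂ, C)) (k : κ) :
    hγ.coeff k (hβ.pullback hγ e θ m) = θ k (hβ.coeff (e k) m) :=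
  hγ.coeff_diagonal _ k

theorem pullback_fst (m : 𝓜(ℂ, C)) (k : κ) (y : D k) :
    (hβ.pullback hγ e θ m).fst (γ k y) = γ k (θ k (hβ.coeff (e k) m) * y) := by
  rw [hγ.fst_block, coeff_pullback]

theorem pullback_nondegenerate : IsNondegenerateExtension (hβ.pullback hγ e θ) := by
  refine hγ.dense.mono (Submodule.span_mono ?_)
  rintro _ ⟨k, y, rfl⟩
  refine ⟨β (e k) 1, γ k y, ?_⟩
  rw [pullback_fst, coeff_coe, component_same, map_one, one_mul]

end Pullback

end IsBlockDecomposition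

end Multipliers

noncomputable section FaithfulTensors

theorem opTensor_ne_zero {H K : Type*} [NormedAddCommGroup H] [InnerProductSpace ℂ H]
    [CompleteSpace H] [NormedAddCommGroup K] [InnerProductSpace ℂ K] [CompleteSpace K]
    {T : H →L[ℂ] H} {S : K →L[ℂ] K} (hT : T ≠ 0) (hS : S ≠ 0) :
    opTensor T S ≠ 0 := by
  obtain ⟨x, hx⟩ := DFunLike.ne_iff.mp hT
  obtain ⟨y, hy⟩ := DFunLike.ne_iff.mp hS
  intro h
  have hxy := congrArg norm (opTensor_tmul T S x y)
  rw [h, zero_apply, norm_zero, UniformSpace.Completion.norm_coe, TensorProduct.norm_tmul,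
    eq_comm, mul_eq_zero, norm_eq_zero, norm_eq_zero] at hxy
  exact hxy.elim hx hy

attribute [local instance] CStarAlgebra.spectralOrder CStarAlgebra.spectralOrderedRing

universe u v

variable {A : Type u} {B : Type v} [NonUnitalCStarAlgebra A] [NonUnitalCStarAlgebra B]

-- The positive cone is closed and convex; separate `-a` from it and complexify the functional.
theorem PosFunctional.exists_apply_ne_zero {a : A} (ha : 0 ≤ a) (ha₀ : a ≠ 0) :
    ∃ f : PosFunctional A, f a ≠ 0 := by
  have hneg : -a ∉ ProperCone.positive ℝ A := fun h =>
    ha₀ (le_antisymm (neg_nonneg.mp h) ha)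
  obtain ⟨φ, hφ, hφa⟩ := ProperCone.hyperplane_separation_point _ hneg
  let ψ : A →ₗ[ℂ] ℂ := Module.Dual.extendRCLike
    ((φ : A →ₗ[ℝ] ℝ) ∘ₗ (selfAdjoint.submodule ℝ A).subtype ∘ₗ realPart)
  have hψ {x : A} (hx : IsSelfAdjoint x) : ψ x = φ x := by
    have hre : (realPart x : A) = x := hx.coe_realPart
    have him : realPart (Complex.I • x) = 0 := by
      rw [realPart_I_smul, hx.imaginaryPart, neg_zero]
    change (φ (realPart x : A) : ℂ) - Complex.I * φ (realPart (Complex.I • x) : A) = φ x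
    simp [hre, him]
  refine ⟨PositiveLinearMap.mk₀ ψ fun x hx => ?_, ?_⟩
  · rw [hψ (.of_nonneg hx)]
    exact_mod_cast hφ x hx
  · change ψ a ≠ 0
    rw [hψ (.of_nonneg ha)]
    have : 0 < φ a := by simpa using hφa
    exact_mod_cast this.ne'

theorem PosFunctional.exists_rep_ne_zero {a : A} (ha : a ≠ 0) :
    ∃ f : PosFunctional A, f.rep a ≠ 0 := by
  set z := a * (star a * a) with hz
  have hz₀ : star z * z ≠ 0 := by
    rw [Ne, CStarRing.star_mul_self_eq_zero_iff]
    intro h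
    have : star (star a * a) * (star a * a) = 0 := by
      rw [star_mul, star_star, mul_assoc, ← hz, h, mul_zero]
    rw [CStarRing.star_mul_self_eq_zero_iff, CStarRing.star_mul_self_eq_zero_iff] at this
    exact ha this
  obtain ⟨f, hf⟩ := exists_apply_ne_zero (star_mul_self_nonneg z) hz₀
  refine ⟨f, fun h => hf ?_⟩
  have hzero : ((f.toPreGNS z : f.PreGNS) : f.Space) = 0 :=
    (PositiveLinearMap.gnsNonUnitalStarAlgHom_apply_coe
      (a := a) (b := f.toPreGNS (star a * a))).symm.trans (DFunLike.congr_fun h _)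
  have hnorm : ‖f.toPreGNS z‖ = 0 := by
    rw [← UniformSpace.Completion.norm_coe, hzero, norm_zero]
  have := f.preGNS_norm_sq (f.toPreGNS z)
  rw [hnorm] at this
  simpa using this.symm

theorem MinTensor.zero_tmul (b : B) : tmul (0 : A) b = 0 := LinearMap.map_zero₂ tmulₗ b

theorem MinTensor.tmul_zero (a : A) : tmul a (0 : B) = 0 := map_zero (tmulₗ a)

theorem MinTensor.tmul_ne_zero {a : A} {b : B} (ha : a ≠ 0) (hb : b ≠ 0) : tmul a b ≠ 0 := by
  obtain ⟨p, hp⟩ : ∃ p : PosFunctional A × PosFunctional B, p.1.rep a ≠ 0 ∧ p.2.rep b ≠ 0 :=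
    Prod.exists.mpr <| exists_and_exists_comm.mp
      ⟨PosFunctional.exists_rep_ne_zero ha, PosFunctional.exists_rep_ne_zero hb⟩
  exact fun h => opTensor_ne_zero hp.1 hp.2 (congrArg (fun t => (incl t).coord p) h)

end FaithfulTensors

noncomputable section Flip

attribute [local instance] CStarAlgebra.spectralOrder CStarAlgebra.spectralOrderedRing

universe u v

variable (H K : Type*) [NormedAddCommGroup H] [InnerProductSpace ℂ H] [NormedAddCommGroup K]
  [InnerProductSpace ℂ K]

/-- The extension of `x ⊗ y ↦ y ⊗ x` to the completed tensor products. -/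
def HilbertTensor.commL : HilbertTensor H K →L[ℂ] HilbertTensor K H :=
  ((TensorProduct.commIsometry ℂ H K).toContinuousLinearEquiv :
    H ⊗[ℂ] K →L[ℂ] K ⊗[ℂ] H).completion

variable {H K} in
theorem HilbertTensor.commL_coe (v : H ⊗[ℂ] K) :
    commL H K v = (TensorProduct.comm ℂ H K v : HilbertTensor K H) := by
  simp [commL]

variable {H K} in
theorem HilbertTensor.commL_commL (v : HilbertTensor H K) : commL K H (commL H K v) = v := by
  induction v using UniformSpace.Completion.induction_on with
  | hp => exact isClosed_eq (by fun_prop) continuous_id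
  | ih v => rw [commL_coe, commL_coe, TensorProduct.comm_comm]

/-- The unitary `x ⊗ y ↦ y ⊗ x`. -/
def HilbertTensor.comm : HilbertTensor H K ≃ₗᵢ[ℂ] HilbertTensor K H where
  toLinearEquiv := .ofLinearMap (commL H K) (commL K H)
    (LinearMap.ext commL_commL) (LinearMap.ext commL_commL)
  norm_map' v := by
    change ‖commL H K v‖ = ‖v‖
    induction v using UniformSpace.Completion.induction_on with
    | hp => exact isClosed_eq (by fun_prop) (by fun_prop)
    | ih v =>
      rw [commL_coe, UniformSpace.Completion.norm_coe, UniformSpace.Completion.norm_coe,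
        TensorProduct.norm_comm]

variable {H K} in
theorem HilbertTensor.comm_tmul (x : H) (y : K) :
    comm H K ((x ⊗ₜ[ℂ] y : H ⊗[ℂ] K) : HilbertTensor H K) =
      ((y ⊗ₜ[ℂ] x : K ⊗[ℂ] H) : HilbertTensor K H) :=
  commL_coe _

variable {H K} in
theorem HilbertTensor.conjStarAlgEquiv_comm_opTensor [CompleteSpace H] [CompleteSpace K]
    (T : H →L[ℂ] H) (S : K →L[ℂ] K) :
    (comm H K).conjStarAlgEquiv (opTensor T S) = opTensor S T :=
  clm_ext fun y x => by
    have hsymm : (comm H K).symm = comm K H := rfl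
    rw [LinearIsometryEquiv.conjStarAlgEquiv_apply_apply, hsymm, comm_tmul, opTensor_tmul,
      comm_tmul, opTensor_tmul]

variable {A : Type u} {B : Type v} [NonUnitalCStarAlgebra A] [NonUnitalCStarAlgebra B]

/-- The bounded operators on `H_f ⊗ H_g`. This is `GNSOp A B (f, g)`, but since it is indexed by the
two functionals separately the identification `GNSPairOp q.swap.1 q.swap.2 = GNSPairOp q.2 q.1` does
not unfold the GNS spaces. -/
def GNSPairOp (f : PosFunctional A) (g : PosFunctional B) : Type max u v :=
  HilbertTensor f.Space g.Space →L[ℂ] HilbertTensor f.Space g.Space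

instance (f : PosFunctional A) (g : PosFunctional B) : CStarAlgebra (GNSPairOp f g) :=
  inferInstanceAs (CStarAlgebra
    (HilbertTensor f.Space g.Space →L[ℂ] HilbertTensor f.Space g.Space))

/-- The operator `T ⊗ S` on `H_f ⊗ H_g` attached to elements of the two algebras. -/
def GNSPairOp.tensor (f : PosFunctional A) (g : PosFunctional B) (a : A) (b : B) :
    GNSPairOp f g :=
  opTensor (f.rep a) (g.rep b)

/-- Conjugation by the unitary `H_f ⊗ H_g → H_g ⊗ H_f`. -/
def GNSPairOp.comm (f : PosFunctional A) (g : PosFunctional B) :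
    GNSPairOp f g ≃⋆ₐ[ℂ] GNSPairOp g f :=
  (HilbertTensor.comm f.Space g.Space).conjStarAlgEquiv

theorem GNSPairOp.comm_tensor (f : PosFunctional A) (g : PosFunctional B) (a : A) (b : B) :
    comm f g (tensor f g a b) = tensor g f b a :=
  HilbertTensor.conjStarAlgEquiv_comm_opTensor _ _

/-- The tautological identification of the two families of operator algebras. -/
def GNSOp.toPairOp (p : PosFunctional A × PosFunctional B) :
    GNSOp A B p ≃⋆ₐ[ℂ] GNSPairOp p.1 p.2 :=
  StarAlgEquiv.refl ℂ (GNSOp A B p)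

theorem GNSOp.toPairOp_gnsTensor (p : PosFunctional A × PosFunctional B) (a : A) (b : B) :
    toPairOp p ((gnsTensor a b).coord p) = GNSPairOp.tensor p.1 p.2 a b := rfl

/-- Conjugation by the unitary `H_f ⊗ H_g → H_g ⊗ H_f`. -/
def GNSOp.comm (q : PosFunctional B × PosFunctional A) : GNSOp A B q.swap ≃⋆ₐ[ℂ] GNSOp B A q :=
  (toPairOp q.swap).trans ((GNSPairOp.comm q.2 q.1).trans (toPairOp q).symm)

theorem GNSOp.comm_gnsTensor (q : PosFunctional B × PosFunctional A) (a : A) (b : B) :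
    comm q ((gnsTensor a b).coord q.swap) = (gnsTensor b a).coord q := by
  refine (toPairOp q).symm_apply_eq.2 ?_
  exact (congrArg (GNSPairOp.comm q.2 q.1) (toPairOp_gnsTensor q.swap a b)).trans
    ((GNSPairOp.comm_tensor q.2 q.1 a b).trans (toPairOp_gnsTensor q b a).symm)

variable (A B) in
/-- The flip on families of operators: conjugation by `x ⊗ y ↦ y ⊗ x` in every component. -/
def GNSTensorAlgebra.comm : GNSTensorAlgebra A B →⋆ₙₐ[ℂ] GNSTensorAlgebra B A where
  toFun x := .mk (fun q => GNSOp.comm q (x.coord q.swap)) ‖x‖ fun q =>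
    (NonUnitalStarAlgHom.norm_apply_le (GNSOp.comm q) _).trans
      (lp.norm_apply_le_norm ENNReal.top_ne_zero (show lp (GNSOp A B) ∞ from x) q.swap)
  map_smul' c x := ext fun q => map_smul (GNSOp.comm q) c (x.coord q.swap)
  map_zero' := ext fun q => map_zero (GNSOp.comm q)
  map_add' x y := ext fun q => map_add (GNSOp.comm q) (x.coord q.swap) (y.coord q.swap)
  map_mul' x y := ext fun q => map_mul (GNSOp.comm q) (x.coord q.swap) (y.coord q.swap)
  map_star' x := ext fun q => map_star (GNSOp.comm q) (x.coord q.swap)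

theorem GNSTensorAlgebra.comm_gnsTensor (a : A) (b : B) :
    comm A B (gnsTensor a b) = gnsTensor b a :=
  ext fun q => GNSOp.comm_gnsTensor q a b

namespace MinTensor

theorem comm_incl_mem (t : MinTensor A B) :
    GNSTensorAlgebra.comm A B (incl t) ∈ minTensorSubalgebra B A := by
  induction t using induction_on with
  | hc =>
    exact IsClosed.preimage
      ((continuous_starAlgHom (GNSTensorAlgebra.comm A B)).comp continuous_incl)
      (isClosed_minTensorSubalgebra B A)
  | h0 => rw [map_zero, map_zero]; exact zero_mem _
  | ht a b => rw [incl_tmul, GNSTensorAlgebra.comm_gnsTensor]; exact gnsTensor_mem b a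
  | ha s t hs ht => rw [map_add, map_add]; exact add_mem hs ht

variable (A B) in
/-- The flip `a ⊗ b ↦ b ⊗ a` as a homomorphism; see `MinTensor.comm` for the isomorphism. -/
def commHom : MinTensor A B →⋆ₙₐ[ℂ] MinTensor B A :=
  NonUnitalStarAlgHom.codRestrict ((GNSTensorAlgebra.comm A B).comp incl) _ comm_incl_mem

theorem commHom_tmul (a : A) (b : B) : commHom A B (tmul a b) = tmul b a :=
  incl_injective (GNSTensorAlgebra.comm_gnsTensor a b)

theorem commHom_commHom (t : MinTensor A B) : commHom B A (commHom A B t) = t := by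
  induction t using induction_on with
  | hc => exact isClosed_eq ((continuous_starAlgHom _).comp (continuous_starAlgHom _)) continuous_id
  | h0 => rw [map_zero, map_zero]
  | ht a b => rw [commHom_tmul, commHom_tmul]
  | ha s t hs ht => rw [map_add, map_add, hs, ht]

variable (A B) in
/-- The flip isomorphism `a ⊗ b ↦ b ⊗ a`. -/
def comm : MinTensor A B ≃⋆ₐ[ℂ] MinTensor B A :=
  .ofBijective (commHom A B)
    ⟨Function.LeftInverse.injective commHom_commHom,
      Function.LeftInverse.surjective commHom_commHom⟩

theorem comm_tmul (a : A) (b : B) : comm A B (tmul a b) = tmul b a := commHom_tmul a b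

end MinTensor

end Flip

noncomputable section UHFAlgebras

open UHFIndex UHFMatrix

section Density

variable {a b c : ℕ → ℕ} [PosSeq a] [PosSeq b] [PosSeq c]

theorem UHF.induction_on_pair {P : UHF a → UHF b → Prop}
    (hc₁ : ∀ y, IsClosed {x | P x y}) (hc₂ : ∀ x, IsClosed {y | P x y})
    (h : ∀ n M N, P (ofMatrix a n M) (ofMatrix b n N)) (x : UHF a) (y : UHF b) : P x y := by
  induction x using UHF.induction_on with
  | hc => exact hc₁ y
  | h n M =>
    induction y using UHF.induction_on with
    | hc => exact hc₂ _
    | h m N =>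
      rw [← ofMatrix_uhfEmbed a (le_max_left n m), ← ofMatrix_uhfEmbed b (le_max_right n m)]
      exact h _ _ _

theorem UHF.induction_on_triple {P : UHF a → UHF b → UHF c → Prop}
    (hc₁ : ∀ y z, IsClosed {x | P x y z}) (hc₂ : ∀ x z, IsClosed {y | P x y z})
    (hc₃ : ∀ x y, IsClosed {z | P x y z})
    (h : ∀ n M N O, P (ofMatrix a n M) (ofMatrix b n N) (ofMatrix c n O))
    (x : UHF a) (y : UHF b) (z : UHF c) : P x y z := by
  induction x, y using UHF.induction_on_pair with
  | hc₁ y => exact hc₁ y z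
  | hc₂ x => exact hc₂ x z
  | h n M N =>
    induction z using UHF.induction_on with
    | hc => exact hc₃ _ _
    | h m O =>
      rw [← ofMatrix_uhfEmbed a (le_max_left n m), ← ofMatrix_uhfEmbed b (le_max_left n m),
        ← ofMatrix_uhfEmbed c (le_max_right n m)]
      exact h _ _ _ _

end Density

section Simplicity

variable {a : ℕ → ℕ} {C : Type*} [NonUnitalCStarAlgebra C]

theorem UHFMatrix.unit_mul_mul_unit {n : ℕ} (P J : UHFIndex a n) (M : UHFMatrix a n)
    (K Q : UHFIndex a n) : unit P J * M * unit K Q = M.entry J K • unit P Q :=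
  UHFMatrix.ext fun R T => by
    simp only [entry_mul, entry_smul, entry_unit, ite_and, ite_mul, mul_ite, one_mul, mul_one,
      zero_mul, mul_zero, Finset.sum_ite_eq', Finset.mem_univ, Finset.sum_ite_irrel,
      Finset.sum_const_zero, if_true]
    split_ifs <;> rfl

theorem UHFMatrix.injective_of_map_one_ne_zero {n : ℕ} (g : UHFMatrix a n →⋆ₙₐ[ℂ] C)
    (hg : g 1 ≠ 0) : Function.Injective g := by
  refine (injective_iff_map_eq_zero g).2 fun M hM => UHFMatrix.ext fun J K =>
    by_contra fun hJK => hg ?_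
  have hunit (P Q : UHFIndex a n) : g (unit P Q) = 0 := by
    have h := congrArg g (unit_mul_mul_unit P J M K Q)
    rw [map_mul, map_mul, hM, mul_zero, zero_mul, map_smul] at h
    exact (smul_eq_zero.1 h.symm).resolve_left hJK
  rw [eq_sum_unit 1]
  simp only [map_sum, map_smul, hunit, smul_zero, Finset.sum_const_zero]

theorem UHFMatrix.unit_ne_zero {n : ℕ} (J K : UHFIndex a n) : unit J K ≠ 0 := fun h => by
  have hJK : (unit J K).entry J K = (0 : UHFMatrix a n).entry J K := by rw [h]
  rw [entry_unit, if_pos ⟨rfl, rfl⟩] at hJK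
  exact one_ne_zero hJK

variable [PosSeq a]

theorem UHF.injective_of_map_one_ne_zero (g : UHF a →⋆ₙₐ[ℂ] C) (hg : g 1 ≠ 0) :
    Function.Injective g := by
  have hinj (n : ℕ) : Function.Injective
      (g.comp (ofMatrix a n : UHFMatrix a n →⋆ₙₐ[ℂ] UHF a)) :=
    UHFMatrix.injective_of_map_one_ne_zero _ fun h =>
      hg ((congrArg g (map_one (ofMatrix a n))).symm.trans h)
  have hnorm (x : UHF a) : ‖g x‖ = ‖x‖ := by
    induction x using UHF.induction_on with
    | hc => exact isClosed_eq (continuous_starAlgHom g).norm continuous_norm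
    | h n M =>
      rw [norm_ofMatrix]
      exact NonUnitalStarAlgHom.norm_map _ (hinj n) M
  exact (AddMonoidHomClass.isometry_of_norm g hnorm).injective

theorem UHF.ofMatrix_injective (n : ℕ) : Function.Injective (ofMatrix a n) :=
  (AddMonoidHomClass.isometry_of_norm _ (norm_ofMatrix a n)).injective

theorem UHF.ofMatrix_unit_ne_zero {n : ℕ} (J K : UHFIndex a n) : ofMatrix a n (unit J K) ≠ 0 :=
  fun h => unit_ne_zero J K (ofMatrix_injective n (h.trans (map_zero _).symm))

instance : Nontrivial (UHF a) :=
  ⟨_, _, UHF.ofMatrix_unit_ne_zero (a := a) (n := 0) default default⟩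

end Simplicity

section Cast

variable {a a' : ℕ → ℕ} [PosSeq a] [PosSeq a']

/-- The identity map between `A(a)` and `A(a')` for equal sequences `a` and `a'`. -/
def UHF.cast (h : a = a') : UHF a →⋆ₐ[ℂ] UHF a' := by
  subst h
  exact StarAlgHom.id ℂ (UHF a)

theorem UHF.cast_bijective (h : a = a') : Function.Bijective (UHF.cast h) := by
  subst h
  exact Function.bijective_id

theorem UHF.continuous_cast (h : a = a') : Continuous (UHF.cast h) := by
  subst h
  exact continuous_id

theorem UHF.cast_ofMatrix (h : a = a') {n : ℕ} {M : UHFMatrix a n} {N : UHFMatrix a' n}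
    (hMN : ∀ J K J' K', (∀ i, (J i : ℕ) = J' i) → (∀ i, (K i : ℕ) = K' i) →
      M.entry J K = N.entry J' K') :
    UHF.cast h (ofMatrix a n M) = ofMatrix a' n N := by
  subst h
  exact congrArg (ofMatrix a n) (UHFMatrix.ext fun J K => hMN J K J K (fun _ => rfl) fun _ => rfl)

end Cast

section Kron

variable {b c d : ℕ → ℕ}

theorem UHFIndex.val_split_fst {n : ℕ} (J : UHFIndex (b * c) n) (i : Fin n) :
    ((split b c n J).1 i : ℕ) = J i / c i := rfl

theorem UHFIndex.val_split_snd {n : ℕ} (J : UHFIndex (b * c) n) (i : Fin n) :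
    ((split b c n J).2 i : ℕ) = J i % c i := rfl

/-- The Kronecker product of matrices. -/
def UHFMatrix.kron {n : ℕ} (M : UHFMatrix b n) (N : UHFMatrix c n) : UHFMatrix (b * c) n :=
  UHFMatrix.of fun J K => M.entry (split b c n J).1 (split b c n K).1 *
    N.entry (split b c n J).2 (split b c n K).2

theorem UHFMatrix.entry_kron {n : ℕ} (M : UHFMatrix b n) (N : UHFMatrix c n)
    (J K : UHFIndex (b * c) n) : (kron M N).entry J K =
      M.entry (split b c n J).1 (split b c n K).1 *
        N.entry (split b c n J).2 (split b c n K).2 := rfl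

theorem UHFMatrix.kron_one_one (n : ℕ) :
    kron (1 : UHFMatrix b n) (1 : UHFMatrix c n) = 1 := UHFMatrix.ext fun J K => by
  have hJK : J = K ↔ (split b c n J).1 = (split b c n K).1 ∧
      (split b c n J).2 = (split b c n K).2 := by
    rw [← Prod.ext_iff, (split b c n).apply_eq_iff_eq]
  rw [entry_kron, entry_one, entry_one, entry_one, if_congr hJK rfl rfl, ite_and, ite_mul, one_mul,
    zero_mul]

variable [PosSeq b] [PosSeq c] [PosSeq d] {X Y : Type*} [NonUnitalCStarAlgebra X]
  [NonUnitalCStarAlgebra Y] (f : UHF b →⋆ₙₐ[ℂ] X) (g : UHF c →⋆ₙₐ[ℂ] Y)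

theorem kroneckerHom_ofMatrix_kron (n : ℕ) (M : UHFMatrix b n) (N : UHFMatrix c n) :
    kroneckerHom f g (UHF.ofMatrix (b * c) n (kron M N)) =
      MinTensor.tmul (f (UHF.ofMatrix b n M)) (g (UHF.ofMatrix c n N)) :=
  (UHF.lift_ofMatrix _ _ n _).trans (tmul_ofMatrix f g n M N).symm

theorem kroneckerHom_one : kroneckerHom f g 1 = MinTensor.tmul (f 1) (g 1) := by
  simpa only [UHFMatrix.kron_one_one, map_one] using kroneckerHom_ofMatrix_kron f g 0 1 1

variable {f g} in
theorem kroneckerHom_injective (hf : Function.Injective f) (hg : Function.Injective g) :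
    Function.Injective (kroneckerHom f g) := by
  refine UHF.injective_of_map_one_ne_zero _ ?_
  rw [kroneckerHom_one]
  exact MinTensor.tmul_ne_zero ((map_ne_zero_iff f hf).2 one_ne_zero)
    ((map_ne_zero_iff g hg).2 one_ne_zero)

theorem kroneckerCoproduct_bijective (b c : ℕ → ℕ) [PosSeq b] [PosSeq c] :
    Function.Bijective (kroneckerCoproduct b c) := by
  have hinj : Function.Injective (kroneckerCoproduct b c) :=
    kroneckerHom_injective Function.injective_id Function.injective_id
  have hcl : IsClosed (Set.range (kroneckerCoproduct b c)) :=
    (NonUnitalStarAlgHom.isometry _ hinj).isClosedEmbedding.isClosed_range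
  refine ⟨hinj, fun t => ?_⟩
  induction t using MinTensor.induction_on with
  | hc => exact hcl
  | h0 => exact ⟨0, map_zero _⟩
  | ht x y =>
    induction x, y using UHF.induction_on_pair with
    | hc₁ y => exact hcl.preimage (MinTensor.continuous_tmul_left y)
    | hc₂ x => exact hcl.preimage (MinTensor.continuous_tmul_right x)
    | h n M N => exact ⟨_, kroneckerHom_ofMatrix_kron _ _ n M N⟩
  | ha s t hs ht =>
    obtain ⟨x, rfl⟩ := hs
    obtain ⟨y, rfl⟩ := ht
    exact ⟨x + y, map_add _ _ _⟩

/-- The Kronecker coproduct as an isomorphism `A(b·c) ≃ A(b) ⊗ A(c)`. -/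
def kroneckerEquiv (b c : ℕ → ℕ) [PosSeq b] [PosSeq c] :
    UHF (b * c) ≃⋆ₐ[ℂ] MinTensor (UHF b) (UHF c) :=
  StarAlgEquiv.ofBijective (kroneckerCoproduct b c) (kroneckerCoproduct_bijective b c)

/-- The Kronecker product `A(b) × A(c) → A(b·c)`. -/
def UHF.kron (x : UHF b) (y : UHF c) : UHF (b * c) :=
  (kroneckerEquiv b c).symm (MinTensor.tmul x y)

theorem UHF.zero_kron (y : UHF c) : kron (0 : UHF b) y = 0 := by
  rw [kron, MinTensor.zero_tmul, map_zero]

theorem UHF.kron_zero (x : UHF b) : kron x (0 : UHF c) = 0 := by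
  rw [kron, MinTensor.tmul_zero, map_zero]

theorem UHF.smul_kron (k : ℂ) (x : UHF b) (y : UHF c) : kron (k • x) y = k • kron x y := by
  rw [kron, MinTensor.smul_tmul, map_smul, kron]

theorem UHF.kron_smul (k : ℂ) (x : UHF b) (y : UHF c) : kron x (k • y) = k • kron x y := by
  rw [kron, MinTensor.tmul_smul, map_smul, kron]

theorem UHF.continuous_kron_left (y : UHF c) : Continuous fun x : UHF b => kron x y :=
  (continuous_starAlgHom (kroneckerEquiv b c).symm.toNonUnitalStarAlgHom).comp
    (MinTensor.continuous_tmul_left y)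

theorem UHF.continuous_kron_right (x : UHF b) : Continuous fun y : UHF c => kron x y :=
  (continuous_starAlgHom (kroneckerEquiv b c).symm.toNonUnitalStarAlgHom).comp
    (MinTensor.continuous_tmul_right x)

theorem UHF.norm_kron_le (x : UHF b) (y : UHF c) : ‖kron x y‖ ≤ ‖x‖ * ‖y‖ :=
  (NonUnitalStarAlgHom.norm_apply_le (kroneckerEquiv b c).symm.toNonUnitalStarAlgHom _).trans
    (MinTensor.norm_tmul_le x y)

theorem UHF.kron_mul_kron (x x' : UHF b) (y y' : UHF c) :
    kron x y * kron x' y' = kron (x * x') (y * y') := by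
  unfold kron
  rw [← map_mul, MinTensor.tmul_mul_tmul]

theorem UHF.kron_ofMatrix (n : ℕ) (M : UHFMatrix b n) (N : UHFMatrix c n) :
    kron (ofMatrix b n M) (ofMatrix c n N) = ofMatrix (b * c) n (UHFMatrix.kron M N) :=
  (kroneckerEquiv b c).symm_apply_eq.2 (kroneckerHom_ofMatrix_kron
    (NonUnitalStarAlgHom.id ℂ (UHF b)) (NonUnitalStarAlgHom.id ℂ (UHF c)) n M N).symm

theorem UHF.kron_one_one : kron (1 : UHF b) (1 : UHF c) = 1 := by
  simpa only [UHFMatrix.kron_one_one, map_one] using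
    kron_ofMatrix 0 (1 : UHFMatrix b 0) (1 : UHFMatrix c 0)

theorem kroneckerHom_kron (x : UHF b) (y : UHF c) :
    kroneckerHom f g (UHF.kron x y) = MinTensor.tmul (f x) (g y) := by
  induction x, y using UHF.induction_on_pair with
  | hc₁ y =>
    exact isClosed_eq ((continuous_starAlgHom _).comp (UHF.continuous_kron_left y))
      ((MinTensor.continuous_tmul_left (g y)).comp (continuous_starAlgHom f))
  | hc₂ x =>
    exact isClosed_eq ((continuous_starAlgHom _).comp (UHF.continuous_kron_right x))
      ((MinTensor.continuous_tmul_right (f x)).comp (continuous_starAlgHom g))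
  | h n M N => rw [UHF.kron_ofMatrix, kroneckerHom_ofMatrix_kron]

theorem UHF.induction_on_kron {P : UHF (b * c) → Prop} (hc : IsClosed {z | P z}) (h0 : P 0)
    (hk : ∀ x y, P (kron x y)) (ha : ∀ z w, P z → P w → P (z + w)) (z : UHF (b * c)) : P z := by
  suffices h : ∀ t, P ((kroneckerEquiv b c).symm t) by
    simpa only [StarAlgEquiv.symm_apply_apply] using h (kroneckerEquiv b c z)
  intro t
  induction t using MinTensor.induction_on with
  | hc =>
    exact hc.preimage (continuous_starAlgHom (kroneckerEquiv b c).symm.toNonUnitalStarAlgHom)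
  | h0 => rwa [map_zero]
  | ht x y => exact hk x y
  | ha s t hs ht => rw [map_add]; exact ha _ _ hs ht

theorem UHF.cast_kron_kron (x : UHF b) (y : UHF c) (z : UHF d) :
    UHF.cast (mul_assoc b c d) (kron (kron x y) z) = kron x (kron y z) := by
  induction x, y, z using UHF.induction_on_triple with
  | hc₁ y z =>
    exact isClosed_eq ((continuous_cast _).comp ((continuous_kron_left z).comp
      (continuous_kron_left y))) (continuous_kron_left _)
  | hc₂ x z =>
    exact isClosed_eq ((continuous_cast _).comp ((continuous_kron_left z).comp
      (continuous_kron_right x))) ((continuous_kron_right x).comp (continuous_kron_left z))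
  | hc₃ x y =>
    exact isClosed_eq ((continuous_cast _).comp (continuous_kron_right _))
      ((continuous_kron_right x).comp (continuous_kron_right y))
  | h n M N O =>
    simp only [kron_ofMatrix]
    refine cast_ofMatrix _ fun J K J' K' hJ hK => ?_
    have hsplit {J : UHFIndex (b * c * d) n} {J' : UHFIndex (b * (c * d)) n}
        (h : ∀ i, (J i : ℕ) = J' i) :
        split b c n (split (b * c) d n J).1 =
            ((split b (c * d) n J').1, (split c d n (split b (c * d) n J').2).1) ∧
          (split (b * c) d n J).2 = (split c d n (split b (c * d) n J').2).2 := by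
      refine ⟨Prod.ext (funext fun i => Fin.ext ?_) (funext fun i => Fin.ext ?_),
        funext fun i => Fin.ext ?_⟩
      · simp only [val_split_fst, h, Pi.mul_apply, Nat.div_div_eq_div_mul, mul_comm]
      · simp only [val_split_fst, val_split_snd, h, Pi.mul_apply, Nat.mod_mul_left_div_self]
      · simp only [val_split_snd, h, Pi.mul_apply, Nat.mod_mul_left_mod]
    simp only [entry_kron, hsplit hJ, hsplit hK, mul_assoc]

theorem UHF.cast_one_kron (y : UHF c) : UHF.cast (one_mul c) (kron (1 : UHF 1) y) = y := by
  induction y using UHF.induction_on with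
  | hc => exact isClosed_eq ((continuous_cast _).comp (continuous_kron_right _)) continuous_id
  | h n M =>
    rw [← map_one (ofMatrix 1 n), kron_ofMatrix]
    refine cast_ofMatrix _ fun J K J' K' hJ hK => ?_
    have hsplit {J : UHFIndex (1 * c) n} {J' : UHFIndex c n} (h : ∀ i, (J i : ℕ) = J' i) :
        (split 1 c n J).2 = J' :=
      funext fun i => Fin.ext (by rw [val_split_snd, h, Nat.mod_eq_of_lt (J' i).isLt])
    rw [entry_kron, hsplit hJ, hsplit hK, entry_one, if_pos (Subsingleton.elim _ _), one_mul]

theorem UHF.cast_kron_one (x : UHF b) : UHF.cast (mul_one b) (kron x (1 : UHF 1)) = x := by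
  induction x using UHF.induction_on with
  | hc => exact isClosed_eq ((continuous_cast _).comp (continuous_kron_left _)) continuous_id
  | h n M =>
    rw [← map_one (ofMatrix 1 n), kron_ofMatrix]
    refine cast_ofMatrix _ fun J K J' K' hJ hK => ?_
    have hsplit {J : UHFIndex (b * 1) n} {J' : UHFIndex b n} (h : ∀ i, (J i : ℕ) = J' i) :
        (split b 1 n J).1 = J' :=
      funext fun i => Fin.ext (by rw [val_split_fst, h, Pi.one_apply, Nat.div_one])
    rw [entry_kron, hsplit hJ, hsplit hK, entry_one, if_pos (Subsingleton.elim _ _), mul_one]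

end Kron

theorem IsBlockDecomposition.dense_span_tmul {ι κ : Type*} {B : ι → Type*} {C : κ → Type*}
    [∀ i, NonUnitalCStarAlgebra (B i)] [∀ k, NonUnitalCStarAlgebra (C k)] {X Y : Type*}
    [NonUnitalCStarAlgebra X] [NonUnitalCStarAlgebra Y] {β : ∀ i, B i →⋆ₙₐ[ℂ] X}
    {γ : ∀ k, C k →⋆ₙₐ[ℂ] Y} (hβ : IsBlockDecomposition β) (hγ : IsBlockDecomposition γ) :
    Dense (Submodule.span ℂ {t : MinTensor X Y |
      ∃ i x k y, t = MinTensor.tmul (β i x) (γ k y)} : Set (MinTensor X Y)) := fun t => by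
  set S := (Submodule.span ℂ {t : MinTensor X Y |
    ∃ i x k y, t = MinTensor.tmul (β i x) (γ k y)}).topologicalClosure
  have hS : IsClosed (S : Set (MinTensor X Y)) := Submodule.isClosed_topologicalClosure _
  change t ∈ S
  induction t using MinTensor.induction_on with
  | hc => exact hS
  | h0 => exact S.zero_mem
  | ha s t hs ht => exact S.add_mem hs ht
  | ht x y =>
    induction x using hβ.induction_on with
    | hc => exact hS.preimage (MinTensor.continuous_tmul_left y)
    | h0 => rw [MinTensor.zero_tmul]; exact S.zero_mem
    | ha x x' hx hx' => rw [MinTensor.add_tmul]; exact S.add_mem hx hx'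
    | hb i x =>
      induction y using hγ.induction_on with
      | hc => exact hS.preimage (MinTensor.continuous_tmul_right (β i x))
      | h0 => rw [MinTensor.tmul_zero]; exact S.zero_mem
      | ha y y' hy hy' => rw [MinTensor.tmul_add]; exact S.add_mem hy hy'
      | hb k y =>
        exact Submodule.le_topologicalClosure _ (Submodule.subset_span ⟨i, x, k, y, rfl⟩)

theorem IsBlockDecomposition.kronecker {ι κ : Type*} {b : ι → ℕ → ℕ} [∀ i, PosSeq (b i)]
    {c : κ → ℕ → ℕ} [∀ k, PosSeq (c k)] {X Y : Type*} [NonUnitalCStarAlgebra X]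
    [NonUnitalCStarAlgebra Y] {β : ∀ i, UHF (b i) →⋆ₙₐ[ℂ] X} {γ : ∀ k, UHF (c k) →⋆ₙₐ[ℂ] Y}
    (hβ : IsBlockDecomposition β) (hγ : IsBlockDecomposition γ) :
    IsBlockDecomposition (B := fun p : ι × κ => UHF (b p.1 * c p.2))
      fun p => kroneckerHom (β p.1) (γ p.2) where
  orthogonal p q hpq z w := by
    induction z using UHF.induction_on_kron with
    | hc => exact isClosed_eq ((continuous_starAlgHom _).mul continuous_const) continuous_const
    | h0 => rw [map_zero, zero_mul]
    | ha z z' hz hz' => rw [map_add, add_mul, hz, hz', add_zero]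
    | hk x y =>
      induction w using UHF.induction_on_kron with
      | hc => exact isClosed_eq (continuous_const.mul (continuous_starAlgHom _)) continuous_const
      | h0 => rw [map_zero, mul_zero]
      | ha w w' hw hw' => rw [map_add, mul_add, hw, hw', add_zero]
      | hk x' y' =>
        rw [kroneckerHom_kron, kroneckerHom_kron, MinTensor.tmul_mul_tmul]
        by_cases h : p.1 = q.1
        · rw [hγ.orthogonal _ _ fun h' => hpq (Prod.ext h h'), MinTensor.tmul_zero]
        · rw [hβ.orthogonal _ _ h, MinTensor.zero_tmul]
  injective p := kroneckerHom_injective (hβ.injective p.1) (hγ.injective p.2)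
  dense := (hβ.dense_span_tmul hγ).mono <| Submodule.span_mono <| by
    rintro _ ⟨i, x, k, y, rfl⟩
    exact ⟨(i, k), UHF.kron x y, (kroneckerHom_kron _ _ x y).symm⟩

end UHFAlgebras

noncomputable section UHFSumBialgebra

open Filter Topology UHFIndex UHFMatrix

theorem C0Sum.coeff_coe {ι : Type*} {A : ι → Type*} [∀ i, CStarAlgebra (A i)] (x : C0Sum A)
    (i : ι) : (isBlockDecomposition_single A).coeff i (x : 𝓜(ℂ, C0Sum A)) = x.coord i :=
  IsBlockDecomposition.coeff_eq _ ((mul_single x i 1).trans (by rw [mul_one]))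

theorem UHFSum.cast_coord (x : UHFSum) {a a' : UHFMonoid} (h : a = a')
    (h' : (a : ℕ → ℕ) = a') : UHF.cast h' (x.coord a) = x.coord a' := by
  subst h
  rfl

section Blocks

theorem isBlockDecomposition_comulBlock : IsBlockDecomposition comulBlock :=
  (C0Sum.isBlockDecomposition_single _).kronecker (C0Sum.isBlockDecomposition_single _)

theorem comulBlock_kron (p : UHFMonoid × UHFMonoid) (x : UHF (p.1 : ℕ → ℕ))
    (y : UHF (p.2 : ℕ → ℕ)) :
    comulBlock p (UHF.kron x y) =
      MinTensor.tmul (C0Sum.single p.1 x : UHFSum) (C0Sum.single p.2 y : UHFSum) :=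
  kroneckerHom_kron _ _ x y

theorem comulBlock_one (p : UHFMonoid × UHFMonoid) :
    comulBlock p 1 =
      MinTensor.tmul (C0Sum.single p.1 1 : UHFSum) (C0Sum.single p.2 1 : UHFSum) :=
  kroneckerHom_one _ _

theorem uhfComul_fst_comulBlock (x : UHFSum) (p : UHFMonoid × UHFMonoid)
    (y : UHF ((p.1 * p.2 : UHFMonoid) : ℕ → ℕ)) :
    (uhfComul x).fst (comulBlock p y) = comulBlock p (x.coord (p.1 * p.2) * y) := by
  refine (comulMultiplier_fst x _).trans ((tsum_eq_single p fun q hq => ?_).trans ?_)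
  · exact comulBlock_mul_comulBlock hq _ _
  · exact (map_mul (comulBlock p) _ _).symm

theorem coeff_uhfComul (x : UHFSum) (p : UHFMonoid × UHFMonoid) :
    isBlockDecomposition_comulBlock.coeff p (uhfComul x) = x.coord (p.1 * p.2) :=
  IsBlockDecomposition.coeff_eq _ (by rw [uhfComul_fst_comulBlock, mul_one])

theorem coeff_tmul (x y : UHFSum) (p : UHFMonoid × UHFMonoid) :
    isBlockDecomposition_comulBlock.coeff p (MinTensor.tmul x y : 𝓜(ℂ, MinTensor UHFSum UHFSum)) =
      UHF.kron (x.coord p.1) (y.coord p.2) :=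
  IsBlockDecomposition.coeff_eq _ <| by
    rw [comulBlock_one, comulBlock_kron]
    refine (MinTensor.tmul_mul_tmul _ _ _ _).trans ?_
    rw [C0Sum.mul_single, C0Sum.mul_single, mul_one, mul_one]

theorem coeff_oneTmul (y : UHFSum) (p : UHFMonoid × UHFMonoid) :
    isBlockDecomposition_comulBlock.coeff p (MinTensor.oneTmul y) = UHF.kron 1 (y.coord p.2) :=
  IsBlockDecomposition.coeff_eq _ <| by
    rw [comulBlock_one, comulBlock_kron, MinTensor.oneTmul_fst_tmul, C0Sum.mul_single, mul_one]

theorem coeff_tmulOne (x : UHFSum) (p : UHFMonoid × UHFMonoid) :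
    isBlockDecomposition_comulBlock.coeff p (MinTensor.tmulOne x) = UHF.kron (x.coord p.1) 1 :=
  IsBlockDecomposition.coeff_eq _ <| by
    rw [comulBlock_one, comulBlock_kron, MinTensor.tmulOne_fst_tmul, C0Sum.mul_single, mul_one]

end Blocks

section Cancellation

instance : IsCancelMul UHFMonoid :=
  haveI : IsLeftCancelMul UHFMonoid := ⟨fun a _ _ h => Subtype.ext <| funext fun i =>
    Nat.eq_of_mul_eq_mul_left (PosSeq.pos (a := (a : ℕ → ℕ)) i) <|
      congrFun (congrArg Subtype.val h) i⟩
  CommMagma.IsLeftCancelMul.toIsCancelMul UHFMonoid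

theorem exists_eq_coe_of_norm_coeff_le {m : 𝓜(ℂ, MinTensor UHFSum UHFSum)} (x y : UHFSum)
    {φ : UHFMonoid × UHFMonoid → UHFMonoid × UHFMonoid} (hφ : Function.Injective φ)
    (h : ∀ p, ‖isBlockDecomposition_comulBlock.coeff p m‖ ≤
      ‖x.coord (φ p).1‖ * ‖y.coord (φ p).2‖) :
    ∃ t : MinTensor UHFSum UHFSum, m = (t : 𝓜(ℂ, MinTensor UHFSum UHFSum)) :=
  isBlockDecomposition_comulBlock.exists_eq_coe_of_tendsto <|
    squeeze_zero (fun _ => norm_nonneg _) h <|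
      (tendsto_mul_cofinite_nhds_zero x.tendsto_norm_coord y.tendsto_norm_coord).comp
        hφ.tendsto_cofinite

theorem injective_mul_prod_snd :
    Function.Injective fun p : UHFMonoid × UHFMonoid => (p.1 * p.2, p.2) := by
  rintro ⟨b, c⟩ ⟨b', c'⟩ h
  obtain ⟨h₁, rfl⟩ := Prod.ext_iff.1 h
  exact Prod.ext (mul_right_cancel h₁) rfl

theorem injective_mul_prod_fst :
    Function.Injective fun p : UHFMonoid × UHFMonoid => (p.1 * p.2, p.1) := by
  rintro ⟨b, c⟩ ⟨b', c'⟩ h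
  obtain ⟨h₁, rfl⟩ := Prod.ext_iff.1 h
  exact Prod.ext rfl (mul_left_cancel h₁)

theorem norm_coeff_oneTmul_le (y : UHFSum) (p : UHFMonoid × UHFMonoid) :
    ‖isBlockDecomposition_comulBlock.coeff p (MinTensor.oneTmul y)‖ ≤ ‖y.coord p.2‖ := by
  rw [coeff_oneTmul]
  exact (UHF.norm_kron_le _ _).trans_eq (by rw [norm_one, one_mul])

theorem norm_coeff_tmulOne_le (x : UHFSum) (p : UHFMonoid × UHFMonoid) :
    ‖isBlockDecomposition_comulBlock.coeff p (MinTensor.tmulOne x)‖ ≤ ‖x.coord p.1‖ := by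
  rw [coeff_tmulOne]
  exact (UHF.norm_kron_le _ _).trans_eq (by rw [norm_one, mul_one])

theorem uhfComul_mul_oneTmul_mem (x y : UHFSum) : ∃ t : MinTensor UHFSum UHFSum,
    uhfComul x * MinTensor.oneTmul y = (t : 𝓜(ℂ, MinTensor UHFSum UHFSum)) :=
  exists_eq_coe_of_norm_coeff_le x y injective_mul_prod_snd fun p => by
    rw [map_mul, coeff_uhfComul]
    exact (norm_mul_le _ _).trans (by gcongr; exact norm_coeff_oneTmul_le y p)

theorem uhfComul_mul_tmulOne_mem (x y : UHFSum) : ∃ t : MinTensor UHFSum UHFSum,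
    uhfComul x * MinTensor.tmulOne y = (t : 𝓜(ℂ, MinTensor UHFSum UHFSum)) :=
  exists_eq_coe_of_norm_coeff_le x y injective_mul_prod_fst fun p => by
    rw [map_mul, coeff_uhfComul]
    exact (norm_mul_le _ _).trans (by gcongr; exact norm_coeff_tmulOne_le y p)

theorem tmulOne_mul_uhfComul_mem (x y : UHFSum) : ∃ t : MinTensor UHFSum UHFSum,
    MinTensor.tmulOne y * uhfComul x = (t : 𝓜(ℂ, MinTensor UHFSum UHFSum)) :=
  exists_eq_coe_of_norm_coeff_le x y injective_mul_prod_fst fun p => by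
    rw [map_mul, coeff_uhfComul, mul_comm ‖x.coord _‖]
    exact (norm_mul_le _ _).trans (by gcongr; exact norm_coeff_tmulOne_le y p)

theorem isProperComul_uhfComul : IsProperComul uhfComul := fun x y =>
  ⟨uhfComul_mul_oneTmul_mem x y, tmulOne_mul_uhfComul_mem x y⟩

theorem coe_comulBlock_eq_mul_oneTmul (p : UHFMonoid × UHFMonoid)
    (z : UHF ((p.1 * p.2 : UHFMonoid) : ℕ → ℕ)) :
    (comulBlock p z : 𝓜(ℂ, MinTensor UHFSum UHFSum)) =
      uhfComul (C0Sum.single (p.1 * p.2) z) * MinTensor.oneTmul (C0Sum.single p.2 1) :=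
  isBlockDecomposition_comulBlock.multiplier_ext fun q => by
    rw [IsBlockDecomposition.coeff_coe, map_mul, coeff_uhfComul, coeff_oneTmul]
    obtain rfl | hqp := eq_or_ne q p
    · rw [IsBlockDecomposition.component_same, C0Sum.coord_single_same, C0Sum.coord_single_same,
        UHF.kron_one_one]
      exact (mul_one z).symm
    rw [IsBlockDecomposition.component_of_ne _ hqp]
    by_cases h : q.2 = p.2
    · rw [C0Sum.coord_single_of_ne, zero_mul]
      exact fun h' => hqp (injective_mul_prod_snd (Prod.ext h' h))
    · rw [C0Sum.coord_single_of_ne h, UHF.kron_zero]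
      exact (mul_zero _).symm

theorem coe_comulBlock_eq_mul_tmulOne (p : UHFMonoid × UHFMonoid)
    (z : UHF ((p.1 * p.2 : UHFMonoid) : ℕ → ℕ)) :
    (comulBlock p z : 𝓜(ℂ, MinTensor UHFSum UHFSum)) =
      uhfComul (C0Sum.single (p.1 * p.2) z) * MinTensor.tmulOne (C0Sum.single p.1 1) :=
  isBlockDecomposition_comulBlock.multiplier_ext fun q => by
    rw [IsBlockDecomposition.coeff_coe, map_mul, coeff_uhfComul, coeff_tmulOne]
    obtain rfl | hqp := eq_or_ne q p
    · rw [IsBlockDecomposition.component_same, C0Sum.coord_single_same, C0Sum.coord_single_same,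
        UHF.kron_one_one]
      exact (mul_one z).symm
    rw [IsBlockDecomposition.component_of_ne _ hqp]
    by_cases h : q.1 = p.1
    · rw [C0Sum.coord_single_of_ne, zero_mul]
      exact fun h' => hqp (injective_mul_prod_fst (Prod.ext h' h))
    · rw [C0Sum.coord_single_of_ne h, UHF.zero_kron]
      exact (mul_zero _).symm

theorem hasCancellation_uhfComul : HasCancellation uhfComul where
  mem_right := uhfComul_mul_oneTmul_mem
  mem_left := uhfComul_mul_tmulOne_mem
  dense_right := isBlockDecomposition_comulBlock.dense.mono <| Submodule.span_mono <| by
    rintro _ ⟨p, z, rfl⟩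
    exact ⟨_, _, coe_comulBlock_eq_mul_oneTmul p z⟩
  dense_left := isBlockDecomposition_comulBlock.dense.mono <| Submodule.span_mono <| by
    rintro _ ⟨p, z, rfl⟩
    exact ⟨_, _, coe_comulBlock_eq_mul_tmulOne p z⟩

end Cancellation

section Coassociativity

/-- The block of `(A(*) ⊗ A(*)) ⊗ A(*)` with index `((b, c), d)`. -/
def tripleBlockLeft (q : (UHFMonoid × UHFMonoid) × UHFMonoid) :
    UHF ((q.1.1 * q.1.2 * q.2 : UHFMonoid) : ℕ → ℕ) →⋆ₙₐ[ℂ]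
      MinTensor (MinTensor UHFSum UHFSum) UHFSum :=
  kroneckerHom (b := ((q.1.1 * q.1.2 : UHFMonoid) : ℕ → ℕ)) (c := (q.2 : ℕ → ℕ))
    (comulBlock q.1) (C0Sum.single (A := fun a : UHFMonoid => UHF (a : ℕ → ℕ)) q.2)

/-- The block of `A(*) ⊗ (A(*) ⊗ A(*))` with index `(b, (c, d))`. -/
def tripleBlockRight (q : UHFMonoid × UHFMonoid × UHFMonoid) :
    UHF ((q.1 * (q.2.1 * q.2.2) : UHFMonoid) : ℕ → ℕ) →⋆ₙₐ[ℂ]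
      MinTensor UHFSum (MinTensor UHFSum UHFSum) :=
  kroneckerHom (b := (q.1 : ℕ → ℕ)) (c := ((q.2.1 * q.2.2 : UHFMonoid) : ℕ → ℕ))
    (C0Sum.single (A := fun a : UHFMonoid => UHF (a : ℕ → ℕ)) q.1) (comulBlock q.2)

theorem isBlockDecomposition_tripleBlockLeft : IsBlockDecomposition tripleBlockLeft :=
  isBlockDecomposition_comulBlock.kronecker (C0Sum.isBlockDecomposition_single _)

theorem isBlockDecomposition_tripleBlockRight : IsBlockDecomposition tripleBlockRight :=
  (C0Sum.isBlockDecomposition_single _).kronecker isBlockDecomposition_comulBlock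

theorem tripleBlockLeft_kron (p : UHFMonoid × UHFMonoid) (d : UHFMonoid)
    (x : UHF ((p.1 * p.2 : UHFMonoid) : ℕ → ℕ)) (z : UHF (d : ℕ → ℕ)) :
    tripleBlockLeft (p, d) (UHF.kron x z) =
      MinTensor.tmul (comulBlock p x) (C0Sum.single d z : UHFSum) :=
  kroneckerHom_kron _ _ x z

theorem tripleBlockRight_kron (b : UHFMonoid) (p : UHFMonoid × UHFMonoid)
    (x : UHF (b : ℕ → ℕ)) (z : UHF ((p.1 * p.2 : UHFMonoid) : ℕ → ℕ)) :
    tripleBlockRight (b, p) (UHF.kron x z) =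
      MinTensor.tmul (C0Sum.single b x : UHFSum) (comulBlock p z) :=
  kroneckerHom_kron _ _ x z

/-- The extension of `Δ ⊗ id` to multipliers: the component of the image with index `((b, c), d)`
is the component with index `(b·c, d)`. -/
def comulTensorId :
    𝓜(ℂ, MinTensor UHFSum UHFSum) →⋆ₐ[ℂ] 𝓜(ℂ, MinTensor (MinTensor UHFSum UHFSum) UHFSum) :=
  isBlockDecomposition_comulBlock.pullback isBlockDecomposition_tripleBlockLeft
    (fun q => (q.1.1 * q.1.2, q.2)) fun _ => StarAlgHom.id ℂ _

/-- The extension of `id ⊗ Δ` to multipliers: the component of the image with index `(b, (c, d))`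
is the component with index `(b, c·d)`. -/
def idTensorComul :
    𝓜(ℂ, MinTensor UHFSum UHFSum) →⋆ₐ[ℂ] 𝓜(ℂ, MinTensor UHFSum (MinTensor UHFSum UHFSum)) :=
  isBlockDecomposition_comulBlock.pullback isBlockDecomposition_tripleBlockRight
    (fun q => (q.1, q.2.1 * q.2.2)) fun _ => StarAlgHom.id ℂ _

theorem comulTensorId_fst (m : 𝓜(ℂ, MinTensor UHFSum UHFSum))
    (q : (UHFMonoid × UHFMonoid) × UHFMonoid)
    (y : UHF ((q.1.1 * q.1.2 * q.2 : UHFMonoid) : ℕ → ℕ)) :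
    (comulTensorId m).fst (tripleBlockLeft q y) = tripleBlockLeft q
      (isBlockDecomposition_comulBlock.coeff (q.1.1 * q.1.2, q.2) m * y) :=
  IsBlockDecomposition.pullback_fst _ isBlockDecomposition_tripleBlockLeft _ _ m q y

theorem idTensorComul_fst (m : 𝓜(ℂ, MinTensor UHFSum UHFSum))
    (q : UHFMonoid × UHFMonoid × UHFMonoid)
    (y : UHF ((q.1 * (q.2.1 * q.2.2) : UHFMonoid) : ℕ → ℕ)) :
    (idTensorComul m).fst (tripleBlockRight q y) = tripleBlockRight q
      (isBlockDecomposition_comulBlock.coeff (q.1, q.2.1 * q.2.2) m * y) :=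
  IsBlockDecomposition.pullback_fst _ isBlockDecomposition_tripleBlockRight _ _ m q y

theorem isComulTensorId_comulTensorId : IsComulTensorId uhfComul comulTensorId where
  nondegenerate := IsBlockDecomposition.pullback_nondegenerate _ _ _ _
  apply a b c t := by
    induction t using isBlockDecomposition_comulBlock.induction_on with
    | hc =>
      exact isClosed_eq ((comulTensorId _).fst.continuous.comp (MinTensor.continuous_tmul_left c))
        ((MinTensor.continuous_tmul_left _).comp (uhfComul a).fst.continuous)
    | h0 => simp only [MinTensor.zero_tmul, map_zero]
    | ha s t hs ht => rw [MinTensor.add_tmul, map_add, map_add, hs, ht, MinTensor.add_tmul]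
    | hb p x =>
      induction c using C0Sum.induction_on with
      | hc =>
        exact isClosed_eq
          ((comulTensorId _).fst.continuous.comp (MinTensor.continuous_tmul_right _))
          ((MinTensor.continuous_tmul_right _).comp (continuous_const_mul b))
      | h0 => simp only [MinTensor.tmul_zero, mul_zero, map_zero]
      | ha c d hc hd => rw [MinTensor.tmul_add, map_add, hc, hd, mul_add, MinTensor.tmul_add]
      | hs d z =>
        rw [← tripleBlockLeft_kron, comulTensorId_fst, coeff_tmul, uhfComul_fst_comulBlock,
          C0Sum.mul_single, ← tripleBlockLeft_kron]
        exact congrArg _ (UHF.kron_mul_kron _ _ _ _)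

theorem isIdTensorComul_idTensorComul : IsIdTensorComul uhfComul idTensorComul where
  nondegenerate := IsBlockDecomposition.pullback_nondegenerate _ _ _ _
  apply a b c t := by
    induction t using isBlockDecomposition_comulBlock.induction_on with
    | hc =>
      exact isClosed_eq ((idTensorComul _).fst.continuous.comp (MinTensor.continuous_tmul_right c))
        ((MinTensor.continuous_tmul_right _).comp (uhfComul b).fst.continuous)
    | h0 => simp only [MinTensor.tmul_zero, map_zero]
    | ha s t hs ht => rw [MinTensor.tmul_add, map_add, map_add, hs, ht, MinTensor.tmul_add]
    | hb p x =>
      induction c using C0Sum.induction_on with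
      | hc =>
        exact isClosed_eq
          ((idTensorComul _).fst.continuous.comp (MinTensor.continuous_tmul_left _))
          ((MinTensor.continuous_tmul_left _).comp (continuous_const_mul a))
      | h0 => simp only [MinTensor.zero_tmul, mul_zero, map_zero]
      | ha c d hc hd => rw [MinTensor.add_tmul, map_add, hc, hd, mul_add, MinTensor.add_tmul]
      | hs d z =>
        rw [← tripleBlockRight_kron, idTensorComul_fst, coeff_tmul, uhfComul_fst_comulBlock,
          C0Sum.mul_single, ← tripleBlockRight_kron]
        exact congrArg _ (UHF.kron_mul_kron _ _ _ _)

theorem isBlockDecomposition_tripleBlockRight_prodAssoc :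
    IsBlockDecomposition (B := fun q : (UHFMonoid × UHFMonoid) × UHFMonoid =>
        UHF ((q.1.1 * q.1.2 * q.2 : UHFMonoid) : ℕ → ℕ)) fun q =>
      (tripleBlockRight (Equiv.prodAssoc _ _ _ q)).comp
        (UHF.cast (mul_assoc (q.1.1 : ℕ → ℕ) q.1.2 q.2) :
          UHF ((q.1.1 * q.1.2 * q.2 : UHFMonoid) : ℕ → ℕ) →⋆ₙₐ[ℂ]
            UHF ((q.1.1 * (q.1.2 * q.2) : UHFMonoid) : ℕ → ℕ)) :=
  isBlockDecomposition_tripleBlockRight.reindex (Equiv.prodAssoc _ _ _) _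
    fun _ => UHF.cast_bijective _

/-- The associativity isomorphism, which identifies the blocks with index `((b, c), d)` and
`(b, (c, d))`. -/
def uhfSumAssoc : MinTensor (MinTensor UHFSum UHFSum) UHFSum ≃⋆ₐ[ℂ]
    MinTensor UHFSum (MinTensor UHFSum UHFSum) :=
  isBlockDecomposition_tripleBlockLeft.equiv.symm.trans
    isBlockDecomposition_tripleBlockRight_prodAssoc.equiv

theorem uhfSumAssoc_tripleBlockLeft (b c d : UHFMonoid)
    (x : UHF ((b * c * d : UHFMonoid) : ℕ → ℕ)) :
    uhfSumAssoc (tripleBlockLeft ((b, c), d) x) =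
      tripleBlockRight (b, c, d) (UHF.cast (mul_assoc (b : ℕ → ℕ) c d) x) := by
  refine (congrArg isBlockDecomposition_tripleBlockRight_prodAssoc.equiv
    (isBlockDecomposition_tripleBlockLeft.equiv_symm_apply ((b, c), d) x)).trans ?_
  exact isBlockDecomposition_tripleBlockRight_prodAssoc.equiv_single ((b, c), d) x

theorem uhfSumAssoc_tmul (x y z : UHFSum) :
    uhfSumAssoc (MinTensor.tmul (MinTensor.tmul x y) z) =
      MinTensor.tmul x (MinTensor.tmul y z) := by
  have hcont : Continuous uhfSumAssoc := continuous_starAlgHom uhfSumAssoc.toNonUnitalStarAlgHom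
  induction x using C0Sum.induction_on with
  | hc =>
    exact isClosed_eq (hcont.comp ((MinTensor.continuous_tmul_left z).comp
      (MinTensor.continuous_tmul_left y))) (MinTensor.continuous_tmul_left _)
  | h0 => simp only [MinTensor.zero_tmul, map_zero]
  | ha x x' hx hx' => simp only [MinTensor.add_tmul, map_add, hx, hx']
  | hs b x =>
    induction y using C0Sum.induction_on with
    | hc =>
      exact isClosed_eq (hcont.comp ((MinTensor.continuous_tmul_left z).comp
        (MinTensor.continuous_tmul_right _)))
        ((MinTensor.continuous_tmul_right _).comp (MinTensor.continuous_tmul_left z))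
    | h0 => simp only [MinTensor.zero_tmul, MinTensor.tmul_zero, map_zero]
    | ha y y' hy hy' => simp only [MinTensor.add_tmul, MinTensor.tmul_add, map_add, hy, hy']
    | hs c y =>
      induction z using C0Sum.induction_on with
      | hc =>
        exact isClosed_eq (hcont.comp (MinTensor.continuous_tmul_right _))
          ((MinTensor.continuous_tmul_right _).comp (MinTensor.continuous_tmul_right _))
      | h0 => simp only [MinTensor.tmul_zero, map_zero]
      | ha z z' hz hz' => simp only [MinTensor.tmul_add, map_add, hz, hz']
      | hs d z =>
        rw [← comulBlock_kron (b, c), ← tripleBlockLeft_kron, uhfSumAssoc_tripleBlockLeft,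
          ← comulBlock_kron (c, d), ← tripleBlockRight_kron]
        exact congrArg _ (UHF.cast_kron_kron x y z)

theorem isCoassociative_uhfComul : IsCoassociative uhfComul := by
  refine ⟨uhfSumAssoc, comulTensorId, idTensorComul, uhfSumAssoc_tmul,
    isComulTensorId_comulTensorId, isIdTensorComul_idTensorComul, fun x t => ?_⟩
  have hcont : Continuous uhfSumAssoc := continuous_starAlgHom uhfSumAssoc.toNonUnitalStarAlgHom
  induction t using isBlockDecomposition_tripleBlockLeft.induction_on with
  | hc =>
    exact isClosed_eq (hcont.comp (comulTensorId _).fst.continuous)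
      ((idTensorComul _).fst.continuous.comp hcont)
  | h0 => simp only [map_zero]
  | ha s t hs ht => simp only [map_add, hs, ht]
  | hb q y =>
    obtain ⟨⟨b, c⟩, d⟩ := q
    rw [comulTensorId_fst, coeff_uhfComul, uhfSumAssoc_tripleBlockLeft,
      uhfSumAssoc_tripleBlockLeft, idTensorComul_fst, coeff_uhfComul,
      ← UHFSum.cast_coord x (mul_assoc b c d) (mul_assoc (b : ℕ → ℕ) c d)]
    exact congrArg _ (map_mul (UHF.cast (mul_assoc (b : ℕ → ℕ) c d)) _ _)

theorem isCStarBialgebra_uhfComul : IsCStarBialgebra uhfComul where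
  dense_span := isBlockDecomposition_comulBlock.dense.mono <| Submodule.span_mono <| by
    rintro _ ⟨p, z, rfl⟩
    refine ⟨C0Sum.single (p.1 * p.2) z, C0Sum.single p.1 1, C0Sum.single p.2 1, ?_⟩
    rw [← comulBlock_one, uhfComul_fst_comulBlock, C0Sum.coord_single_same, mul_one]
  coassociative := isCoassociative_uhfComul

end Coassociativity

section Counit

theorem coord_one_eq_uhfCounit_smul (x : UHFSum) :
    x.coord 1 = uhfCounit x • (1 : UHF ((1 : UHFMonoid) : ℕ → ℕ)) :=
  (algebraMap_uhfOneHom (x.coord 1)).symm.trans (Algebra.algebraMap_eq_smul_one _)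

/-- The extension of `ε ⊗ id` to multipliers: the component of the image with index `a` is the
component with index `(1, a)`. -/
def counitTensorId : 𝓜(ℂ, MinTensor UHFSum UHFSum) →⋆ₐ[ℂ] 𝓜(ℂ, UHFSum) :=
  isBlockDecomposition_comulBlock.pullback (C0Sum.isBlockDecomposition_single _)
    (fun a => (1, a)) fun a => UHF.cast (one_mul (a : ℕ → ℕ))

/-- The extension of `id ⊗ ε` to multipliers: the component of the image with index `a` is the
component with index `(a, 1)`. -/
def idTensorCounit : 𝓜(ℂ, MinTensor UHFSum UHFSum) →⋆ₐ[ℂ] 𝓜(ℂ, UHFSum) :=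
  isBlockDecomposition_comulBlock.pullback (C0Sum.isBlockDecomposition_single _)
    (fun a => (a, 1)) fun a => UHF.cast (mul_one (a : ℕ → ℕ))

theorem counitTensorId_tmul (x y : UHFSum) :
    counitTensorId (MinTensor.tmul x y : 𝓜(ℂ, MinTensor UHFSum UHFSum)) =
      (uhfCounit x • y : UHFSum) :=
  (C0Sum.isBlockDecomposition_single _).multiplier_ext fun a => by
    refine (IsBlockDecomposition.coeff_pullback _ _ _ _ _ a).trans ?_
    rw [coeff_tmul, C0Sum.coeff_coe, C0Sum.coord_smul, coord_one_eq_uhfCounit_smul, UHF.smul_kron]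
    exact (map_smul (UHF.cast _) _ _).trans (congrArg _ (UHF.cast_one_kron _))

theorem idTensorCounit_tmul (x y : UHFSum) :
    idTensorCounit (MinTensor.tmul x y : 𝓜(ℂ, MinTensor UHFSum UHFSum)) =
      (uhfCounit y • x : UHFSum) :=
  (C0Sum.isBlockDecomposition_single _).multiplier_ext fun a => by
    refine (IsBlockDecomposition.coeff_pullback _ _ _ _ _ a).trans ?_
    rw [coeff_tmul, C0Sum.coeff_coe, C0Sum.coord_smul, coord_one_eq_uhfCounit_smul, UHF.kron_smul]
    exact (map_smul (UHF.cast _) _ _).trans (congrArg _ (UHF.cast_kron_one _))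

theorem counitTensorId_uhfComul (x : UHFSum) : counitTensorId (uhfComul x) = x :=
  (C0Sum.isBlockDecomposition_single _).multiplier_ext fun a => by
    refine (IsBlockDecomposition.coeff_pullback _ _ _ _ _ a).trans ?_
    rw [coeff_uhfComul, C0Sum.coeff_coe]
    exact x.cast_coord (one_mul a) _

theorem idTensorCounit_uhfComul (x : UHFSum) : idTensorCounit (uhfComul x) = x :=
  (C0Sum.isBlockDecomposition_single _).multiplier_ext fun a => by
    refine (IsBlockDecomposition.coeff_pullback _ _ _ _ _ a).trans ?_
    rw [coeff_uhfComul, C0Sum.coeff_coe]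
    exact x.cast_coord (mul_one a) _

theorem isCounit_uhfCounit : IsCounit uhfComul uhfCounit :=
  ⟨counitTensorId, idTensorCounit, IsBlockDecomposition.pullback_nondegenerate _ _ _ _,
    IsBlockDecomposition.pullback_nondegenerate _ _ _ _, counitTensorId_tmul, idTensorCounit_tmul,
    fun x => ⟨counitTensorId_uhfComul x, idTensorCounit_uhfComul x⟩⟩

end Counit

section Cocommutativity

theorem IsCocommutative.comm_comulBlock (h : IsCocommutative uhfComul) (b c : UHFMonoid)
    (x : UHF ((b * c : UHFMonoid) : ℕ → ℕ)) :
    MinTensor.comm UHFSum UHFSum (comulBlock (b, c) x) =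
      comulBlock (c, b) (UHF.cast (mul_comm (b : ℕ → ℕ) c) x) := by
  have key := h (MinTensor.comm UHFSum UHFSum) MinTensor.comm_tmul (C0Sum.single (b * c) x)
    (comulBlock (b, c) 1)
  have hone : MinTensor.comm UHFSum UHFSum (comulBlock (b, c) 1) = comulBlock (c, b) 1 := by
    rw [comulBlock_one, comulBlock_one, MinTensor.comm_tmul]
  rwa [hone, uhfComul_fst_comulBlock, uhfComul_fst_comulBlock, mul_one, mul_one,
    ← UHFSum.cast_coord _ (mul_comm b c) (mul_comm (b : ℕ → ℕ) c), C0Sum.coord_single_same] at key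

theorem UHFMatrix.eq_of_unit_self_eq {a : ℕ → ℕ} {n : ℕ} {J K : UHFIndex a n}
    (h : unit J J = unit K K) : J = K := by
  have hentry := congrArg (fun M => M.entry J J) h
  simp only [entry_unit, and_self, if_true] at hentry
  exact of_not_not fun hJK => one_ne_zero (hentry.trans (if_neg hJK))

theorem UHF.cast_ofMatrix_unit {a a' : ℕ → ℕ} [PosSeq a] [PosSeq a'] (h : a = a') {n : ℕ}
    {J K : UHFIndex a n} {J' K' : UHFIndex a' n} (hJ : ∀ i, (J i : ℕ) = J' i)
    (hK : ∀ i, (K i : ℕ) = K' i) :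
    UHF.cast h (ofMatrix a n (unit J K)) = ofMatrix a' n (unit J' K') := by
  subst h
  obtain rfl : J = J' := funext fun i => Fin.ext (hJ i)
  obtain rfl : K = K' := funext fun i => Fin.ext (hK i)
  rfl

theorem IsCocommutative.split_eq_swap (h : IsCocommutative uhfComul) {b c : UHFMonoid} {n : ℕ}
    (J : UHFIndex ((b * c : UHFMonoid) : ℕ → ℕ) n) (J' : UHFIndex ((c * b : UHFMonoid) : ℕ → ℕ) n)
    (hJ : ∀ i, (J i : ℕ) = J' i) :
    split (c : ℕ → ℕ) b n J' = (split (b : ℕ → ℕ) c n J).swap := by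
  let K := (split (c : ℕ → ℕ) b n).symm (split (b : ℕ → ℕ) c n J).swap
  have hK : split (c : ℕ → ℕ) b n K = (split (b : ℕ → ℕ) c n J).swap := Equiv.apply_symm_apply _ _
  have hswap : comulBlock (c, b) (UHF.ofMatrix _ n (unit J' J')) =
      comulBlock (c, b) (UHF.ofMatrix _ n (unit K K)) := calc
    _ = comulBlock (c, b) (UHF.cast (mul_comm (b : ℕ → ℕ) c) (UHF.ofMatrix _ n (unit J J))) :=
      congrArg _ (UHF.cast_ofMatrix_unit _ hJ hJ).symm
    _ = MinTensor.comm UHFSum UHFSum (comulBlock (b, c) (UHF.ofMatrix _ n (unit J J))) :=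
      (h.comm_comulBlock b c _).symm
    _ = _ := by
      rw [comulBlock_unit (c, b) n K K, hK]
      exact (congrArg _ (comulBlock_unit (b, c) n J J)).trans (MinTensor.comm_tmul _ _)
  have hJK : J' = K := UHFMatrix.eq_of_unit_self_eq <| UHF.ofMatrix_injective n <|
    isBlockDecomposition_comulBlock.injective (c, b) hswap
  exact (congrArg _ hJK).trans hK

theorem not_isCocommutative_uhfComul : ¬ IsCocommutative uhfComul := fun h => by
  let b : UHFMonoid := ⟨fun _ => 2, Or.inl fun _ => le_rfl⟩
  let c : UHFMonoid := ⟨fun _ => 3, Or.inl fun _ => Nat.le_succ 2⟩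
  -- Counting from zero, `1 = 3 · 0 + 1 = 2 · 0 + 1` splits into `(0, 1)` in either order.
  have hsplit := h.split_eq_swap (b := b) (c := c) (n := 1) (fun _ => (1 : Fin 6))
    (fun _ => (1 : Fin 6)) fun _ => rfl
  exact absurd (congrFun (congrArg Prod.fst hsplit) 0) (by decide)

end Cocommutativity

end UHFSumBialgebra

theorem mainTheorem1 :
    (IsCStarBialgebra uhfComul ∧ ¬ IsCocommutative uhfComul ∧ IsProperComul uhfComul ∧
      IsCounit uhfComul uhfCounit) ∧ HasCancellation uhfComul :=
  ⟨⟨isCStarBialgebra_uhfComul, not_isCocommutative_uhfComul, isProperComul_uhfComul,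
    isCounit_uhfCounit⟩, hasCancellation_uhfComul⟩
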